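/- **Setting.** Let $p\ge 1$, $q\ge 0$, and let $(M_1^{2p},g_1)$, $(M_2^{2q+1},g_2)$ be closed oriented Riemannian manifolds with $\mathrm{spin}^{\mathbb C}$ structures, with associated line bundles $L_1,L_2$ and $U(1)$-connections $A_1,A_2$ on them. Let $\Delta_{n}$ be the complex spinor module, $\Delta_n=(\mathbb C^2)^{\otimes m}$, $m=[n/2]$, with orthonormal basis $u(\epsilon_1,\dots,\epsilon_m)=u(\epsilon_1)\otimes\cdots\otimes u(\epsilon_m)$, $u(\epsilon)=\frac1{\sqrt2}(1,-\epsilon\sqrt{-1})^T$, $\epsilon_\alpha=\pm1$, and Clifford multiplication $$e_{2\alpha-1}=T\otimes\cdots\otimes T\otimes g_{(1)}\otimes 1\otimes\cdots\otimes 1,\quad e_{2\alpha}=T\otimes\cdots\otimes T\otimes g_{(2)}\otimes 1\otimes\cdots\otimes1,\quad e_{2m+1}=\pm\sqrt{-1}\,T\otimes\cdots\otimes T,$$ where $g_{(1)},g_{(2)}$ stand in position $\alpha$ and $g_{(1)}u(\epsilon)=\sqrt{-1}\,u(-\epsilon)$, $g_{(2)}u(\epsilon)=\epsilon u(-\epsilon)$,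 $Tu(\epsilon)=-\epsilon u(\epsilon)$ (so $e_a^2=-1$; the generator $e_{2m+1}$ is present only for odd $n$, and either sign is allowed there). Let $j_0,j_1:\Delta_n\to\Delta_n$ be the complex-antilinear maps $$j_0u(\epsilon_1,\dots,\epsilon_m)=(\sqrt{-1})^{\sum_\alpha\alpha\epsilon_\alpha}u(-\epsilon_1,\dots,-\epsilon_m),\qquad j_1u(\epsilon_1,\dots,\epsilon_m)=(\sqrt{-1})^{\sum_\alpha(m-\alpha+1)\epsilon_\alpha}u(-\epsilon_1,\dots,-\epsilon_m).$$ Let $Q=M_1\times M_2$ carry the product metric $g_1+g_2$ and the product $\mathrm{spin}^{\mathbb C}$ structure, with line bundle $L=\pi_1^*L_1\otimes\pi_2^*L_2$, connection $A=\pi_1^*A_1+\pi_2^*A_2$ and spinor bundle $\Sigma(Q,L)=\pi_1^*\Sigma(M_1,L_1)\otimes\pi_2^*\Sigma(M_2,L_2)$. Let $E_1,\dots,E_{2p}$ and $F_1,\dots,F_{2q+1}$ be local positively oriented orthonormal frames of $M_1$ and $M_2$, lifted to $Q$, and let $\mu_1=E^1\wedge\cdots\wedge E^{2p}$, $\mu_2=F^1\wedge\cdots\wedge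 F^{2q+1}$ be the volume forms, acting by Clifford multiplication $E_1\cdots E_{2p}$ and $F_1\cdots F_{2q+1}$. Clifford multiplication on $\Sigma(Q,L)$ is $$E_t\cdot(\varphi_1\otimes\varphi_2)=(E_t\cdot\varphi_1)\otimes\varphi_2,\qquad F_l\cdot(\varphi_1\otimes\varphi_2)=(\sqrt{-1})^p(\mu_1\cdot\varphi_1)\otimes(F_l\cdot\varphi_2).$$ Let $\nabla^A$ be the spinor derivative on $\Sigma(Q,L)$ induced by $A$ and the Levi-Civita connection, $D^A$ the $\mathrm{spin}^{\mathbb C}$ Dirac operator of $Q$, and $D_+^{A_1}\psi=\sum_{k=1}^{2p}E_k\cdot\nabla^{A}_{E_k}\psi$. Let $\Sigma(Q,-L)$ and $D^{-A}$ be the spinor bundle and the Dirac operator for the complex conjugate $\mathrm{spin}^{\mathbb C}$ structure (transition functions $f\otimes\bar h$ in place of $f\otimes h\in \mathrm{Spin}\otimes_{\mathbb Z_2}S^1$), with line bundle $-L=L^{-1}$ and connection $-A$. Finally let $j^*,\ \hat j^*,\ j_0^*,\ j_1^*$ be the complex-antilinear maps $j_0\otimes j_1,\ j_1\otimes j_0,\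 j_0\otimes j_0,\ j_1\otimes j_1$ of $\Delta_{2p}\otimes\Delta_{2q+1}$, applied in the local trivializations. **Proposition.** For $i=1,2$, on smooth sections of $\Sigma(Q,L)$: 1. For $p\ge1$, $q\ge0$: $D^A\circ(\mu_i\circ D_+^{A_1})=-(\mu_i\circ D_+^{A_1})\circ D^A$. 2. Let $p,q\ge1$ be both even or both odd. Then $\mu_i\circ j^*$ maps smooth sections of $\Sigma(Q,L)$ to smooth sections of $\Sigma(Q,-L)$, and $D^{-A}\circ(\mu_i\circ j^*)=-(\mu_i\circ j^*)\circ D^A$. 3. Let $p,q\ge1$ be both odd. Then $\mu_i\circ\hat j^*$ and $\mu_i\circ j_0^*$ map smooth sections of $\Sigma(Q,L)$ to smooth sections of $\Sigma(Q,-L)$, and $D^{-A}\circ(\mu_i\circ\hat j^*)=-(\mu_i\circ\hat j^*)\circ D^A$ and $D^{-A}\circ(\mu_i\circ j_0^*)=-(\mu_i\circ j_0^*)\circ D^A$. 4. Let $p,q\ge1$ be both even. Then $j_1^*$ maps smooth sections of $\Sigma(Q,L)$ to smooth sections of $\Sigma(Q,-L)$, and $D^{-A}\circ j_1^*=-j_1^*\circ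 D^A$. -/

import Mathlib

open scoped Manifold ContDiff Matrix Kronecker

noncomputable section

namespace SpinCProduct

section Algebra

/-- The quadratic form `v ↦ -∑ v_a²`, so that the Clifford relations read `e_a² = -1`. -/
def negSq (κ : Type*) [Fintype κ] : QuadraticForm ℝ (κ → ℝ) :=
  QuadraticMap.weightedSumSquares ℝ (fun _ : κ => (-1 : ℝ))

/-- The real Clifford algebra on generators `e_a`, `a : κ`. -/
abbrev Cl (κ : Type*) [Fintype κ] := CliffordAlgebra (negSq κ)

lemma negSq_apply {κ : Type*} [Fintype κ] (v : κ → ℝ) : negSq κ v = -∑ a, v a * v a := by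
  simp [negSq, QuadraticMap.weightedSumSquares_apply]

/-- A complex matrix representation of the Clifford algebra on generators `e_a`, given by the
matrices of the generators. The representation space is `ι → ℂ`. -/
structure CliffordRep (κ ι : Type*) [DecidableEq κ] [Fintype ι] [DecidableEq ι] where
  gen : κ → Matrix ι ι ℂ
  rel : ∀ a b, gen a * gen b + gen b * gen a = if a = b then (-2 : ℂ) • 1 else 0

namespace CliffordRep

variable {κ ι : Type*} [DecidableEq κ] [Fintype ι] [DecidableEq ι]

lemma gen_sq (c : CliffordRep κ ι) (a : κ) : c.gen a * c.gen a = -1 := by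
  have h := c.rel a a
  rw [if_pos rfl, ← two_smul ℂ (c.gen a * c.gen a)] at h
  have h2 := congrArg (fun X => (1 / 2 : ℂ) • X) h
  simp only [smul_smul] at h2
  norm_num at h2
  exact h2

lemma gen_anti (c : CliffordRep κ ι) {a b : κ} (h : a ≠ b) :
    c.gen a * c.gen b = -(c.gen b * c.gen a) := by
  have := c.rel a b
  rw [if_neg h] at this
  exact eq_neg_of_add_eq_zero_left this

/-- The Clifford action of the whole Clifford algebra. -/
def rho [Fintype κ] (c : CliffordRep κ ι) : Cl κ →ₐ[ℝ] Matrix ι ι ℂ :=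
  CliffordAlgebra.lift (negSq κ) ⟨Fintype.linearCombination ℝ c.gen, fun v => by
    have e : Fintype.linearCombination ℝ c.gen v = ∑ a, v a • c.gen a := by
      simp [Fintype.linearCombination_apply]
    have h2 : (2 : ℝ) • ((∑ a, v a • c.gen a) * (∑ a, v a • c.gen a))
        = (2 : ℝ) • algebraMap ℝ (Matrix ι ι ℂ) (negSq κ v) := by
      have e1 : (∑ a, v a • c.gen a) * (∑ a, v a • c.gen a)
          = ∑ a, ∑ b, (v a * v b) • (c.gen a * c.gen b) := by
        rw [Finset.sum_mul_sum]
        refine Finset.sum_congr rfl fun a _ => Finset.sum_congr rfl fun b _ => ?_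
        rw [smul_mul_smul_comm]
      have e2 : (∑ a, v a • c.gen a) * (∑ a, v a • c.gen a)
          = ∑ a, ∑ b, (v a * v b) • (c.gen b * c.gen a) := by
        rw [e1, Finset.sum_comm]
        refine Finset.sum_congr rfl fun a _ => Finset.sum_congr rfl fun b _ => ?_
        rw [mul_comm]
      rw [two_smul]
      nth_rewrite 1 [e1]
      rw [e2, ← Finset.sum_add_distrib]
      simp only [← Finset.sum_add_distrib, ← smul_add, c.rel]
      simp only [smul_ite, smul_zero, Finset.sum_ite_eq, Finset.mem_univ, if_true]
      have e3 : ((-2 : ℂ) • (1 : Matrix ι ι ℂ)) = (-2 : ℝ) • 1 := by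
        ext i j; simp [Matrix.smul_apply]
      rw [negSq_apply, Algebra.algebraMap_eq_smul_one, e3, ← Finset.sum_smul, smul_smul, smul_smul]
      congr 1; ring
    have := smul_right_injective _ (two_ne_zero (α := ℝ)) h2
    rw [e]; exact this⟩

lemma rho_iota [Fintype κ] (c : CliffordRep κ ι) (v : κ → ℝ) :
    c.rho (CliffordAlgebra.ι _ v) = ∑ a, v a • c.gen a := by
  simp [rho, Fintype.linearCombination_apply]

lemma gen_mul_list (c : CliffordRep κ ι) (a : κ) (l : List κ) (hl : l.Nodup) :
    c.gen a * (l.map c.gen).prod =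
      ((if a ∈ l then -1 else 1) * (-1 : ℂ) ^ l.length) • ((l.map c.gen).prod * c.gen a) := by
  induction l with
  | nil => simp
  | cons b l ih =>
    rw [List.nodup_cons] at hl
    have ih := ih hl.2
    simp only [List.map_cons, List.prod_cons, List.length_cons, List.mem_cons]
    by_cases hab : a = b
    · subst hab
      rw [if_neg hl.1] at ih
      rw [mul_assoc (c.gen a) _ (c.gen a), ih]
      simp only [one_mul, true_or, if_true, mul_smul_comm, ← mul_assoc]
      rw [show (-1 * (-1 : ℂ) ^ (l.length + 1)) = (-1) ^ l.length by ring]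
    · rw [← mul_assoc, c.gen_anti hab, neg_mul, mul_assoc, ih, mul_smul_comm, ← neg_smul, mul_assoc]
      simp only [hab, false_or]
      congr 1; ring

lemma list_sq (c : CliffordRep κ ι) (l : List κ) (hl : l.Nodup) :
    (l.map c.gen).prod * (l.map c.gen).prod = ((-1 : ℂ) ^ (l.length * (l.length + 1) / 2)) • 1 := by
  induction l with
  | nil => simp
  | cons a l ih =>
    rw [List.nodup_cons] at hl
    have ih := ih hl.2
    have h := c.gen_mul_list a l hl.2
    rw [if_neg hl.1, one_mul] at h
    simp only [List.map_cons, List.prod_cons, List.length_cons]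
    set P := (l.map c.gen).prod
    have h' : P * c.gen a = (-1 : ℂ) ^ l.length • (c.gen a * P) := by
      rw [h, smul_smul, ← pow_add, Even.neg_one_pow ⟨_, rfl⟩, one_smul]
    calc c.gen a * P * (c.gen a * P) = c.gen a * (P * c.gen a) * P := by simp only [mul_assoc]
      _ = (-1 : ℂ) ^ l.length • ((c.gen a * c.gen a) * (P * P)) := by
          rw [h', mul_smul_comm, smul_mul_assoc]; simp only [mul_assoc]
      _ = _ := by
          rw [ih, c.gen_sq, mul_smul_comm, smul_smul, neg_one_mul, smul_neg, ← neg_smul, ← pow_add]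
          congr 1
          have : (l.length + 1) * (l.length + 1 + 1) / 2
              = l.length + l.length * (l.length + 1) / 2 + 1 := by
            have e : (l.length + 1) * (l.length + 1 + 1)
              = l.length * (l.length + 1) + (l.length + 1) * 2 := by ring
            rw [e, Nat.add_mul_div_right _ _ (by norm_num)]; omega
          rw [this, pow_succ]; ring

/-- Clifford action of the volume form: `e_1 ⋯ e_n`. -/
def vol {n : ℕ} (c : CliffordRep (Fin n) ι) : Matrix ι ι ℂ := (List.ofFn c.gen).prod

lemma vol_eq {n : ℕ} (c : CliffordRep (Fin n) ι) :
    c.vol = ((List.finRange n).map c.gen).prod := by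
  rw [vol, List.ofFn_eq_map]

lemma gen_mul_vol {p : ℕ} (c : CliffordRep (Fin (2 * p)) ι) (a : Fin (2 * p)) :
    c.gen a * c.vol = -(c.vol * c.gen a) := by
  rw [vol_eq, c.gen_mul_list a _ (List.nodup_finRange _)]
  simp

lemma ivol_sq {p : ℕ} (c : CliffordRep (Fin (2 * p)) ι) :
    (Complex.I ^ p • c.vol) * (Complex.I ^ p • c.vol) = 1 := by
  rw [vol_eq, smul_mul_smul_comm, c.list_sq _ (List.nodup_finRange _), smul_smul,
    List.length_finRange, ← mul_pow, Complex.I_mul_I]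
  rw [show 2 * p * (2 * p + 1) / 2 = p * (2 * p + 1) by
    rw [mul_assoc]; exact Nat.mul_div_cancel_left _ (by norm_num), ← pow_add,
    show p + p * (2 * p + 1) = 2 * (p * (p + 1)) by ring, pow_mul]
  simp

/-- The Clifford action on a tensor product of spinor spaces, the first factor being
even-dimensional: `E_t · (φ₁ ⊗ φ₂) = (E_t · φ₁) ⊗ φ₂` and
`F_l · (φ₁ ⊗ φ₂) = i^p (μ₁ · φ₁) ⊗ (F_l · φ₂)`. -/
def prod {p : ℕ} {κ₂ ι₁ ι₂ : Type*} [DecidableEq κ₂] [Fintype ι₁] [DecidableEq ι₁]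
    [Fintype ι₂] [DecidableEq ι₂] (c₁ : CliffordRep (Fin (2 * p)) ι₁) (c₂ : CliffordRep κ₂ ι₂) :
    CliffordRep (Fin (2 * p) ⊕ κ₂) (ι₁ × ι₂) where
  gen := Sum.elim (fun t => c₁.gen t ⊗ₖ (1 : Matrix ι₂ ι₂ ℂ))
    (fun l => (Complex.I ^ p • c₁.vol) ⊗ₖ c₂.gen l)
  rel := by
    have key : ∀ t l, (c₁.gen t ⊗ₖ (1 : Matrix ι₂ ι₂ ℂ)) * ((Complex.I ^ p • c₁.vol) ⊗ₖ c₂.gen l)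
        + ((Complex.I ^ p • c₁.vol) ⊗ₖ c₂.gen l) * (c₁.gen t ⊗ₖ (1 : Matrix ι₂ ι₂ ℂ)) = 0 := by
      intro t l
      rw [← Matrix.mul_kronecker_mul, ← Matrix.mul_kronecker_mul, one_mul, mul_one,
        ← Matrix.add_kronecker, mul_smul_comm, smul_mul_assoc, c₁.gen_mul_vol]
      simp
    rintro (a | a) (b | b)
    · simp only [Sum.elim_inl, Sum.inl.injEq]
      rw [← Matrix.mul_kronecker_mul, ← Matrix.mul_kronecker_mul, ← Matrix.add_kronecker,
        c₁.rel, one_mul]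
      split_ifs
      · rw [Matrix.smul_kronecker, Matrix.one_kronecker_one]
      · simp
    · simpa using key a b
    · rw [add_comm]; simpa using key b a
    · simp only [Sum.elim_inr, Sum.inr.injEq]
      rw [← Matrix.mul_kronecker_mul, ← Matrix.mul_kronecker_mul, ← Matrix.kronecker_add,
        c₂.rel, c₁.ivol_sq]
      split_ifs
      · rw [Matrix.kronecker_smul, Matrix.one_kronecker_one]
      · simp

end CliffordRep

/-! ### The standard spinor modules

`ℂ²` is written in the basis `u(1), u(-1)`, `u(ε) = (1, -ε i)/√2`, and the spinor space
`ℂ² ⊗ ⋯ ⊗ ℂ²` in the basis `u(ε₁, …, ε_m) = u(ε₁) ⊗ ⋯ ⊗ u(ε_m)`; a spinor is the family of its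
coordinates, a function on `Fin m → ℤˣ`. -/

/-- `g₁ = diag(i, -i)`, that is `g₁ u(ε) = i u(-ε)`. -/
def g1 : Matrix ℤˣ ℤˣ ℂ := Matrix.of fun a b => if a = -b then Complex.I else 0

/-- `g₂` with rows `(0, i), (i, 0)`, that is `g₂ u(ε) = ε u(-ε)`. -/
def g2 : Matrix ℤˣ ℤˣ ℂ := Matrix.of fun a b => if a = -b then ((b : ℤ) : ℂ) else 0

/-- `T` with rows `(0, -i), (i, 0)`, that is `T u(ε) = -ε u(ε)`. -/
def gT : Matrix ℤˣ ℤˣ ℂ := Matrix.diagonal fun a => -((a : ℤ) : ℂ)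

/-- The tensor product `A_1 ⊗ ⋯ ⊗ A_m` of operators on `ℂ²`. -/
def tensor {m : ℕ} (A : Fin m → Matrix ℤˣ ℤˣ ℂ) : Matrix (Fin m → ℤˣ) (Fin m → ℤˣ) ℂ :=
  Matrix.of fun a b => ∏ k, A k (a k) (b k)

/-- `T ⊗ ⋯ ⊗ T ⊗ X ⊗ 1 ⊗ ⋯ ⊗ 1` with `X` in position `β`. -/
def site {m : ℕ} (β : Fin m) (X : Matrix ℤˣ ℤˣ ℂ) : Matrix (Fin m → ℤˣ) (Fin m → ℤˣ) ℂ :=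
  tensor fun a => if a < β then gT else if a = β then X else 1

lemma tensor_mul {m : ℕ} (A B : Fin m → Matrix ℤˣ ℤˣ ℂ) :
    tensor A * tensor B = tensor fun k => A k * B k := by
  ext a b
  simp only [tensor, Matrix.mul_apply, Matrix.of_apply, ← Finset.prod_mul_distrib]
  rw [Finset.prod_univ_sum, Fintype.piFinset_univ]

lemma tensor_one {m : ℕ} : tensor (fun _ : Fin m => (1 : Matrix ℤˣ ℤˣ ℂ)) = 1 := by
  ext a b
  simp only [tensor, Matrix.of_apply, Matrix.one_apply, Fintype.prod_ite_zero, funext_iff]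
  simp

lemma tensor_neg {m : ℕ} {A B : Fin m → Matrix ℤˣ ℤˣ ℂ} (β : Fin m) (h : A β = -B β)
    (h' : ∀ k, k ≠ β → A k = B k) : tensor A = -tensor B := by
  ext a b
  simp only [tensor, Matrix.of_apply, Matrix.neg_apply]
  rw [Fintype.prod_eq_mul_prod_compl β, Fintype.prod_eq_mul_prod_compl β, h]
  rw [Finset.prod_congr rfl fun k hk => by
    rw [h' k (by simpa using hk)]]
  simp

lemma g1_sq : g1 * g1 = -1 := by
  ext a b
  fin_cases a <;> fin_cases b <;> simp [g1, Matrix.mul_apply]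

lemma g2_sq : g2 * g2 = -1 := by
  ext a b
  fin_cases a <;> fin_cases b <;> simp [g2, Matrix.mul_apply]

lemma gT_sq : gT * gT = 1 := by
  ext a b
  fin_cases a <;> fin_cases b <;> simp [gT]

lemma g1_g2 : g1 * g2 = -(g2 * g1) := by
  ext a b
  fin_cases a <;> fin_cases b <;> simp [g1, g2, Matrix.mul_apply]

lemma g1_gT : g1 * gT = -(gT * g1) := by
  ext a b
  fin_cases a <;> fin_cases b <;> simp [g1, gT]

lemma g2_gT : g2 * gT = -(gT * g2) := by
  ext a b
  fin_cases a <;> fin_cases b <;> simp [g2, gT]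

lemma site_sq {m : ℕ} (β : Fin m) {X : Matrix ℤˣ ℤˣ ℂ} (h : X * X = -1) :
    site β X * site β X = -1 := by
  rw [site, tensor_mul, ← tensor_one]
  refine tensor_neg β (by simp [h]) fun k hk => ?_
  by_cases h1 : k < β <;> simp [h1, hk, gT_sq]

lemma site_anti {m : ℕ} (β : Fin m) {X Y : Matrix ℤˣ ℤˣ ℂ} (h : X * Y = -(Y * X)) :
    site β X * site β Y = -(site β Y * site β X) := by
  rw [site, site, tensor_mul, tensor_mul]
  refine tensor_neg β (by simp [h]) fun k hk => ?_
  by_cases h1 : k < β <;> simp [h1, hk]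

lemma site_anti_of_lt {m : ℕ} {β β' : Fin m} (hlt : β < β') {X Y : Matrix ℤˣ ℤˣ ℂ}
    (h : X * gT = -(gT * X)) : site β X * site β' Y = -(site β' Y * site β X) := by
  rw [site, site, tensor_mul, tensor_mul]
  refine tensor_neg β (by simp [h, hlt]) fun k hk => ?_
  rcases lt_or_gt_of_ne hk with h1 | h1
  · simp [h1, h1.trans hlt]
  · simp [h1.not_gt, hk]

lemma site_T {m : ℕ} (β : Fin m) {X : Matrix ℤˣ ℤˣ ℂ} (h : X * gT = -(gT * X)) :
    site β X * tensor (fun _ => gT) = -(tensor (fun _ => gT) * site β X) := by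
  rw [site, tensor_mul, tensor_mul]
  refine tensor_neg β (by simp [h]) fun k hk => ?_
  by_cases h1 : k < β <;> simp [h1, hk]

/-- The local factor of the generator with (zero-based) number `k`: `g₁` for the first, `g₂` for
the second element of each pair. -/
def gPair (k : ℕ) : Matrix ℤˣ ℤˣ ℂ := if k % 2 = 0 then g1 else g2

lemma gPair_sq (k : ℕ) : gPair k * gPair k = -1 := by
  unfold gPair; split_ifs
  exacts [g1_sq, g2_sq]

lemma gPair_gT (k : ℕ) : gPair k * gT = -(gT * gPair k) := by
  unfold gPair; split_ifs
  exacts [g1_gT, g2_gT]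

/-- `e_{2α-1} ↦ T ⊗ ⋯ ⊗ T ⊗ g₁ ⊗ 1 ⊗ ⋯ ⊗ 1` and `e_{2α} ↦ T ⊗ ⋯ ⊗ T ⊗ g₂ ⊗ 1 ⊗ ⋯ ⊗ 1`,
with `g₁, g₂` in position `α`. -/
def stdGen (m : ℕ) (k : Fin (2 * m)) : Matrix (Fin m → ℤˣ) (Fin m → ℤˣ) ℂ :=
  site ⟨k / 2, by omega⟩ (gPair k)

lemma stdGen_anti_of_lt {m : ℕ} {k l : Fin (2 * m)} (h : k < l) :
    stdGen m k * stdGen m l = -(stdGen m l * stdGen m k) := by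
  have hv : (k : ℕ) < l := h
  by_cases hd : (k : ℕ) / 2 = l / 2
  · have e : (⟨k / 2, by omega⟩ : Fin m) = ⟨l / 2, by omega⟩ := Fin.ext hd
    rw [stdGen, stdGen, e]
    apply site_anti
    have h0 : (k : ℕ) % 2 = 0 := by omega
    have h1 : ¬ (l : ℕ) % 2 = 0 := by omega
    rw [gPair, gPair, if_pos h0, if_neg h1, g1_g2]
  · exact site_anti_of_lt (by rw [Fin.mk_lt_mk]; omega) (gPair_gT _)

lemma stdGen_rel (m : ℕ) (a b : Fin (2 * m)) :
    stdGen m a * stdGen m b + stdGen m b * stdGen m a = if a = b then (-2 : ℂ) • 1 else 0 := by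
  rcases lt_trichotomy a b with h | h | h
  · rw [stdGen_anti_of_lt h, if_neg h.ne]; simp
  · subst h
    rw [stdGen, site_sq _ (gPair_sq _), if_pos rfl, ← two_smul ℂ]; simp
  · rw [stdGen_anti_of_lt h, if_neg h.ne']; simp

/-- The spinor module `Δ_{2m}`. -/
def stdEven (m : ℕ) : CliffordRep (Fin (2 * m)) (Fin m → ℤˣ) where
  gen := stdGen m
  rel := stdGen_rel m

/-- The spinor module `Δ_{2m+1}`; the last generator acts as `σ i T ⊗ ⋯ ⊗ T`, where the sign `σ`
selects one of the two inequivalent modules. -/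
def stdOdd (m : ℕ) (σ : ℤˣ) : CliffordRep (Fin (2 * m + 1)) (Fin m → ℤˣ) where
  gen := Fin.snoc (α := fun _ => Matrix (Fin m → ℤˣ) (Fin m → ℤˣ) ℂ) (stdGen m)
    ((((σ : ℤ) : ℂ) * Complex.I) • tensor fun _ => gT)
  rel := by
    have key : ∀ k, stdGen m k * ((((σ : ℤ) : ℂ) * Complex.I) • tensor fun _ => gT)
        + ((((σ : ℤ) : ℂ) * Complex.I) • tensor fun _ => gT) * stdGen m k = 0 := by
      intro k
      rw [mul_smul_comm, smul_mul_assoc, stdGen, site_T _ (gPair_gT _)]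
      simp
    intro a b
    induction a using Fin.lastCases with
    | last =>
      induction b using Fin.lastCases with
      | last =>
        rw [Fin.snoc_last, if_pos rfl, smul_mul_smul_comm, tensor_mul, gT_sq, tensor_one,
          ← two_smul ℂ, smul_smul]
        congr 1
        rcases Int.units_eq_one_or σ with rfl | rfl <;> simp
      | cast b =>
        rw [Fin.snoc_last, Fin.snoc_castSucc, if_neg (Fin.castSucc_lt_last b).ne', add_comm, key]
    | cast a =>
      induction b using Fin.lastCases with
      | last =>
        rw [Fin.snoc_last, Fin.snoc_castSucc, if_neg (Fin.castSucc_lt_last a).ne, key]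
      | cast b =>
        simp only [Fin.snoc_castSucc, stdGen_rel, Fin.castSucc_inj]

/-! ### Complex-antilinear maps of spinor spaces -/

/-- The complex-antilinear map sending the `b`-th basis vector to the `b`-th column of `J`. -/
def antilinear {ι : Type*} [Fintype ι] (J : Matrix ι ι ℂ) : (ι → ℂ) →ₛₗ[starRingEnd ℂ] (ι → ℂ) where
  toFun φ := J *ᵥ star φ
  map_add' φ ψ := by rw [star_add, Matrix.mulVec_add]
  map_smul' z φ := by rw [star_smul, Matrix.mulVec_smul]; rfl

/-- The matrix of `j₀`: `j₀ u(ε) = i^{∑ α ε_α} u(-ε)`, `α = 1, …, m`. -/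
def jZero (m : ℕ) : Matrix (Fin m → ℤˣ) (Fin m → ℤˣ) ℂ :=
  Matrix.of fun a b => if a = -b then Complex.I ^ (∑ α : Fin m, ((α : ℤ) + 1) * (b α : ℤ)) else 0

/-- The matrix of `j₁`: `j₁ u(ε) = i^{∑ (m - α + 1) ε_α} u(-ε)`, `α = 1, …, m`. -/
def jOne (m : ℕ) : Matrix (Fin m → ℤˣ) (Fin m → ℤˣ) ℂ :=
  Matrix.of fun a b => if a = -b then Complex.I ^ (∑ α : Fin m, ((m : ℤ) - α) * (b α : ℤ)) else 0

/-! ### The groups `Spin(n)` and `Spin^c(n)` -/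

/-- The subgroup `{±(1, 1)}` of `Spin(n) × S¹`. -/
def spinCKer (κ : Type*) [Fintype κ] : Subgroup (spinGroup (negSq κ) × Circle) where
  carrier := {x | ((x.1 : Cl κ) = 1 ∧ (x.2 : ℂ) = 1) ∨ ((x.1 : Cl κ) = -1 ∧ (x.2 : ℂ) = -1)}
  one_mem' := Or.inl ⟨rfl, rfl⟩
  mul_mem' := by
    rintro x y (⟨h1, h2⟩ | ⟨h1, h2⟩) (⟨h3, h4⟩ | ⟨h3, h4⟩) <;>
      simp [h1, h2, h3, h4, -OneMemClass.coe_eq_one]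
  inv_mem' := by
    rintro x (⟨h1, h2⟩ | ⟨h1, h2⟩) <;> 
      simp [h1, h2, ← spinGroup.star_eq_inv, Circle.coe_inv, -OneMemClass.coe_eq_one]

instance (κ : Type*) [Fintype κ] : (spinCKer κ).Normal where
  conj_mem := by
    rintro n (⟨h1, h2⟩ | ⟨h1, h2⟩) g
    · refine Or.inl ⟨?_, ?_⟩
      · simp [h1, ← spinGroup.star_eq_inv]
      · simp [h2]
    · refine Or.inr ⟨?_, ?_⟩
      · simp [h1, ← spinGroup.star_eq_inv]
      · simp [h2]

/-- `Spin^c(n) = Spin(n) ×_{±1} S¹`. -/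
abbrev SpinC (κ : Type*) [Fintype κ] := (spinGroup (negSq κ) × Circle) ⧸ spinCKer κ

namespace SpinC

variable {κ ι : Type*} [Fintype κ]

/-- The class of `(f, h)` in `Spin^c(n)`. -/
def mk (f : spinGroup (negSq κ)) (h : Circle) : SpinC κ := QuotientGroup.mk (f, h)

/-- The action of `Spin^c(n)` on spinors, `[f, h] ↦ h f`. -/
def rep [DecidableEq κ] [Fintype ι] [DecidableEq ι] (c : CliffordRep κ ι) :
    SpinC κ →* Matrix ι ι ℂ :=
  QuotientGroup.lift (spinCKer κ)
    { toFun := fun x => (x.2 : ℂ) • c.rho (x.1 : Cl κ)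
      map_one' := by simp
      map_mul' := fun x y => by
        rw [Prod.fst_mul, Prod.snd_mul, Submonoid.coe_mul, map_mul, Circle.coe_mul,
          smul_mul_smul_comm] } (by
    rintro x (⟨h1, h2⟩ | ⟨h1, h2⟩) <;> simp [MonoidHom.mem_ker, h1, h2])

/-- The homomorphism `[f, h] ↦ h²` defining the associated line bundle. -/
def det : SpinC κ →* Circle :=
  QuotientGroup.lift (spinCKer κ)
    { toFun := fun x => x.2 ^ 2
      map_one' := by simp
      map_mul' := fun x y => by simp [mul_pow] } (by
    rintro x (⟨h1, h2⟩ | ⟨h1, h2⟩) <;> (rw [MonoidHom.mem_ker]; ext; simp [h2]))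

/-- The conjugation `[f, h] ↦ [f, h̄]`. -/
def conj : SpinC κ →* SpinC κ :=
  QuotientGroup.map (spinCKer κ) (spinCKer κ)
    { toFun := fun x => (x.1, x.2⁻¹)
      map_one' := by simp
      map_mul' := fun x y => by simp [mul_comm] } (by
    rintro x (⟨h1, h2⟩ | ⟨h1, h2⟩)
    · exact Or.inl ⟨h1, by simp [h2]⟩
    · exact Or.inr ⟨h1, by simp [h2]⟩)

/-- `g` lies over the rotation with matrix `R`: `f v f⁻¹ = R v` for all vectors `v`, `g = [f, h]`. -/
def Covers (g : SpinC κ) (R : Matrix κ κ ℝ) : Prop :=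
  ∃ (f : spinGroup (negSq κ)) (h : Circle), g = mk f h ∧ ∀ v : κ → ℝ,
    (f : Cl κ) * CliffordAlgebra.ι _ v * star (f : Cl κ) = CliffordAlgebra.ι _ (R *ᵥ v)

@[simp] lemma rep_mk [DecidableEq κ] [Fintype ι] [DecidableEq ι] (c : CliffordRep κ ι)
    (f : spinGroup (negSq κ)) (h : Circle) : rep c (mk f h) = (h : ℂ) • c.rho (f : Cl κ) := rfl

@[simp] lemma det_mk (f : spinGroup (negSq κ)) (h : Circle) : det (mk f h) = h ^ 2 := rfl

@[simp] lemma conj_mk (f : spinGroup (negSq κ)) (h : Circle) : conj (mk f h) = mk f h⁻¹ := rfl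

lemma exists_mk (g : SpinC κ) : ∃ f h, g = mk f h := by
  obtain ⟨⟨f, h⟩, rfl⟩ := QuotientGroup.mk_surjective g
  exact ⟨f, h, rfl⟩

/-- `det` as a complex number. -/
def detC (g : SpinC κ) : ℂ := Circle.coeHom (det g)

lemma detC_mk (f : spinGroup (negSq κ)) (h : Circle) : detC (mk f h) = (h : ℂ) ^ 2 := by
  rw [detC, det_mk, map_pow]; rfl

lemma detC_conj (g : SpinC κ) : detC (conj g) = Complex.conjCLE (detC g) := by
  obtain ⟨f, h, rfl⟩ := exists_mk g
  rw [conj_mk, detC_mk, detC_mk, Circle.coe_inv_eq_conj]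
  simp

lemma rep_conj [DecidableEq κ] [Fintype ι] [DecidableEq ι] (c : CliffordRep κ ι) (g : SpinC κ) :
    rep c (conj g) = Complex.conjCLE (detC g) • rep c g := by
  obtain ⟨f, h, rfl⟩ := exists_mk g
  rw [← detC_conj, conj_mk, detC_mk, rep_mk, rep_mk, smul_smul, Circle.coe_inv]
  congr 1
  have := Circle.coe_ne_zero h
  field_simp

lemma Covers.conj {g : SpinC κ} {R : Matrix κ κ ℝ} (h : Covers g R) : Covers (conj g) R := by
  obtain ⟨f, z, rfl, hf⟩ := h
  exact ⟨f, z⁻¹, rfl, hf⟩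

end SpinC


/-! ### Products -/

section Product

variable {κ κ' : Type*} [Fintype κ] [Fintype κ']

lemma star_map (f : negSq κ →qᵢ negSq κ') (x : Cl κ) :
    star (CliffordAlgebra.map f x) = CliffordAlgebra.map f (star x) := by
  induction x using CliffordAlgebra.induction with
  | algebraMap r => simp [CliffordAlgebra.star_algebraMap]
  | ι v => simp [CliffordAlgebra.star_ι, CliffordAlgebra.map_apply_ι]
  | mul a b ha hb => simp [ha, hb]
  | add a b ha hb => simp [ha, hb]

lemma map_mem_evenOdd (f : negSq κ →qᵢ negSq κ') {x : Cl κ}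
    (hx : x ∈ CliffordAlgebra.evenOdd (negSq κ) 0) :
    CliffordAlgebra.map f x ∈ CliffordAlgebra.evenOdd (negSq κ') 0 := by
  refine CliffordAlgebra.even_induction (Q := negSq κ)
    (motive := fun x _ => CliffordAlgebra.map f x ∈ CliffordAlgebra.evenOdd (negSq κ') 0)
    (fun r => ?_) (fun x y hx hy ihx ihy => ?_) (fun m₁ m₂ x hx ih => ?_) x hx
  · rw [AlgHom.commutes]
    exact (CliffordAlgebra.even (negSq κ')).algebraMap_mem r
  · rw [map_add]; exact Submodule.add_mem _ ihx ihy
  · rw [map_mul, map_mul, CliffordAlgebra.map_apply_ι, CliffordAlgebra.map_apply_ι]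
    have := SetLike.mul_mem_graded
      (CliffordAlgebra.ι_mul_ι_mem_evenOdd_zero (negSq κ') (f m₁) (f m₂)) ih
    simpa using this

lemma map_mem_spinGroup (f : negSq κ →qᵢ negSq κ') {x : Cl κ} (hx : x ∈ spinGroup (negSq κ)) :
    CliffordAlgebra.map f x ∈ spinGroup (negSq κ') := by
  rw [spinGroup.mem_iff, pinGroup.mem_iff] at hx ⊢
  obtain ⟨⟨⟨u, hu, rfl⟩, hun⟩, he⟩ := hx
  refine ⟨⟨⟨Units.map (CliffordAlgebra.map f : Cl κ →* Cl κ') u, ?_, rfl⟩, ?_⟩, ?_⟩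
  · clear hun he
    change u ∈ lipschitzGroup _ at hu
    change _ ∈ lipschitzGroup _
    unfold lipschitzGroup at hu
    induction hu using Subgroup.closure_induction with
    | mem x hx =>
      obtain ⟨v, hv⟩ := hx
      refine Subgroup.subset_closure ⟨f v, ?_⟩
      rw [← CliffordAlgebra.map_apply_ι, hv]; rfl
    | one => rw [map_one]; exact one_mem _
    | mul x y _ _ hx hy => rw [map_mul]; exact mul_mem hx hy
    | inv x _ hx => rw [map_inv]; exact inv_mem hx
  · rw [Unitary.mem_iff] at hun ⊢
    rw [star_map, ← map_mul, ← map_mul, hun.1, hun.2, map_one]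
    exact ⟨rfl, rfl⟩
  · exact map_mem_evenOdd f he

/-- The inclusion of `Spin` groups induced by an isometric embedding. -/
def spinMap (f : negSq κ →qᵢ negSq κ') : spinGroup (negSq κ) →* spinGroup (negSq κ') where
  toFun x := ⟨CliffordAlgebra.map f x, map_mem_spinGroup f x.2⟩
  map_one' := Subtype.ext (by simp)
  map_mul' x y := Subtype.ext (by simp)

/-- The inclusion of `Spin^c` groups induced by an isometric embedding. -/
def SpinC.map (f : negSq κ →qᵢ negSq κ') : SpinC κ →* SpinC κ' :=
  QuotientGroup.map (spinCKer κ) (spinCKer κ') ((spinMap f).prodMap (MonoidHom.id Circle)) (by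
    rintro x (⟨h1, h2⟩ | ⟨h1, h2⟩)
    · exact Or.inl ⟨by simp [spinMap, h1], by simp [h2]⟩
    · exact Or.inr ⟨by simp [spinMap, h1], by simp [h2]⟩)

@[simp] lemma SpinC.map_mk (f : negSq κ →qᵢ negSq κ') (x : spinGroup (negSq κ)) (h : Circle) :
    SpinC.map f (SpinC.mk x h) = SpinC.mk (spinMap f x) h := rfl

variable {κ₁ κ₂ : Type*} [Fintype κ₁] [Fintype κ₂]

/-- `v ↦ (v, 0)`. -/
def isoInl : negSq κ₁ →qᵢ negSq (κ₁ ⊕ κ₂) where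
  toFun v := Sum.elim v 0
  map_add' v w := by ext (a | a) <;> simp
  map_smul' r v := by ext (a | a) <;> simp
  map_app' v := by simp [negSq_apply]

/-- `v ↦ (0, v)`. -/
def isoInr : negSq κ₂ →qᵢ negSq (κ₁ ⊕ κ₂) where
  toFun v := Sum.elim 0 v
  map_add' v w := by ext (a | a) <;> simp
  map_smul' r v := by ext (a | a) <;> simp
  map_app' v := by simp [negSq_apply]

@[simp] lemma isoInl_apply (v : κ₁ → ℝ) :
    (isoInl v : κ₁ ⊕ κ₂ → ℝ) = Sum.elim v (0 : κ₂ → ℝ) := rfl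

@[simp] lemma isoInr_apply (v : κ₂ → ℝ) :
    (isoInr v : κ₁ ⊕ κ₂ → ℝ) = Sum.elim (0 : κ₁ → ℝ) v := rfl

lemma isOrtho_inl_inr (v : κ₁ → ℝ) (w : κ₂ → ℝ) :
    (negSq (κ₁ ⊕ κ₂)).IsOrtho (isoInl v) (isoInr w) := by
  rw [QuadraticMap.isOrtho_def]
  simp [negSq_apply]
  ring

lemma commute_spinMap (x : spinGroup (negSq κ₁)) (y : spinGroup (negSq κ₂)) :
    Commute (spinMap (isoInl (κ₂ := κ₂)) x) (spinMap (isoInr (κ₁ := κ₁)) y) :=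
  Subtype.ext (CliffordAlgebra.commute_map_mul_map_of_isOrtho_of_mem_evenOdd_zero_left
    isoInl isoInr isOrtho_inl_inr _ _ (spinGroup.mem_even x.2) (spinGroup.mem_even y.2))

/-- The homomorphism `Spin^c(k₁) × Spin^c(k₂) → Spin^c(k₁ + k₂)`. -/
def SpinC.prod (g₁ : SpinC κ₁) (g₂ : SpinC κ₂) : SpinC (κ₁ ⊕ κ₂) :=
  SpinC.map isoInl g₁ * SpinC.map isoInr g₂

lemma SpinC.mk_mul (f f' : spinGroup (negSq κ)) (h h' : Circle) :
    SpinC.mk f h * SpinC.mk f' h' = SpinC.mk (f * f') (h * h') := rfl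

lemma SpinC.prod_mul (g₁ g₁' : SpinC κ₁) (g₂ g₂' : SpinC κ₂) :
    SpinC.prod (g₁ * g₁') (g₂ * g₂') = SpinC.prod g₁ g₂ * SpinC.prod g₁' g₂' := by
  obtain ⟨f₁', h₁', rfl⟩ := SpinC.exists_mk g₁'
  obtain ⟨f₂, h₂, rfl⟩ := SpinC.exists_mk g₂
  have : Commute (SpinC.map (isoInl (κ₂ := κ₂)) (SpinC.mk f₁' h₁'))
      (SpinC.map (isoInr (κ₁ := κ₁)) (SpinC.mk f₂ h₂)) := by
    simp only [Commute, SemiconjBy, SpinC.map_mk, SpinC.mk_mul]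
    rw [(commute_spinMap f₁' f₂).eq, mul_comm h₁']
  simp only [SpinC.prod, map_mul]
  rw [mul_assoc, ← mul_assoc (SpinC.map isoInl (SpinC.mk f₁' h₁')), this.eq]
  simp only [mul_assoc]

lemma SpinC.detC_prod (g₁ : SpinC κ₁) (g₂ : SpinC κ₂) :
    SpinC.detC (SpinC.prod g₁ g₂) = SpinC.detC g₁ * SpinC.detC g₂ := by
  obtain ⟨f₁, h₁, rfl⟩ := SpinC.exists_mk g₁
  obtain ⟨f₂, h₂, rfl⟩ := SpinC.exists_mk g₂
  simp [SpinC.prod, SpinC.detC]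

lemma SpinC.Covers.prod {g₁ : SpinC κ₁} {g₂ : SpinC κ₂} {R₁ : Matrix κ₁ κ₁ ℝ}
    {R₂ : Matrix κ₂ κ₂ ℝ} (h₁ : SpinC.Covers g₁ R₁) (h₂ : SpinC.Covers g₂ R₂) :
    SpinC.Covers (SpinC.prod g₁ g₂) (Matrix.fromBlocks R₁ 0 0 R₂) := by
  obtain ⟨f₁, z₁, rfl, hf₁⟩ := h₁
  obtain ⟨f₂, z₂, rfl, hf₂⟩ := h₂
  refine ⟨spinMap isoInl f₁ * spinMap isoInr f₂, z₁ * z₂, rfl, fun v => ?_⟩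
  set a := CliffordAlgebra.map (isoInl (κ₁ := κ₁) (κ₂ := κ₂)) (f₁ : Cl κ₁) with ha
  set b := CliffordAlgebra.map (isoInr (κ₁ := κ₁) (κ₂ := κ₂)) (f₂ : Cl κ₂) with hb
  have e1 : ∀ w : κ₁ → ℝ, b * CliffordAlgebra.ι _ (isoInl w) * star b
      = CliffordAlgebra.ι _ (isoInl w) := by
    intro w
    have := CliffordAlgebra.commute_map_mul_map_of_isOrtho_of_mem_evenOdd_zero_right
      (isoInl (κ₁ := κ₁) (κ₂ := κ₂)) isoInr isOrtho_inl_inr _ _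
      (CliffordAlgebra.ι_mem_evenOdd_one _ w) (spinGroup.mem_even f₂.2)
    rw [CliffordAlgebra.map_apply_ι, ← hb] at this
    rw [← this.eq, mul_assoc, hb, star_map, ← map_mul, spinGroup.mul_star_self_of_mem f₂.2, map_one,
      mul_one]
  have e2 : ∀ w : κ₂ → ℝ, a * CliffordAlgebra.ι _ (isoInr w) * star a
      = CliffordAlgebra.ι _ (isoInr w) := by
    intro w
    have := CliffordAlgebra.commute_map_mul_map_of_isOrtho_of_mem_evenOdd_zero_left
      (isoInl (κ₁ := κ₁) (κ₂ := κ₂)) isoInr isOrtho_inl_inr _ _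
      (spinGroup.mem_even f₁.2) (CliffordAlgebra.ι_mem_evenOdd_one _ w)
    rw [CliffordAlgebra.map_apply_ι, ← ha] at this
    rw [this.eq, mul_assoc, ha, star_map, ← map_mul, spinGroup.mul_star_self_of_mem f₁.2, map_one,
      mul_one]
  have e3 : ∀ w : κ₁ → ℝ, a * CliffordAlgebra.ι _ (isoInl w) * star a
      = CliffordAlgebra.ι _ (isoInl (R₁ *ᵥ w)) := by
    intro w
    rw [ha, star_map, ← CliffordAlgebra.map_apply_ι, ← map_mul, ← map_mul, hf₁,
      CliffordAlgebra.map_apply_ι]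
  have e4 : ∀ w : κ₂ → ℝ, b * CliffordAlgebra.ι _ (isoInr w) * star b
      = CliffordAlgebra.ι _ (isoInr (R₂ *ᵥ w)) := by
    intro w
    rw [hb, star_map, ← CliffordAlgebra.map_apply_ι, ← map_mul, ← map_mul, hf₂,
      CliffordAlgebra.map_apply_ι]
  have hv : ∀ u : κ₁ ⊕ κ₂ → ℝ, u = isoInl (u ∘ Sum.inl) + isoInr (u ∘ Sum.inr) := by
    intro u; ext (x | x) <;> simp
  have hR : (Matrix.fromBlocks R₁ 0 0 R₂ *ᵥ v) =
      isoInl (R₁ *ᵥ (v ∘ Sum.inl)) + isoInr (R₂ *ᵥ (v ∘ Sum.inr)) := by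
    rw [Matrix.fromBlocks_mulVec]
    ext (x | x) <;> simp
  change (a * b) * CliffordAlgebra.ι _ v * star (a * b) = _
  calc (a * b) * CliffordAlgebra.ι _ v * star (a * b)
      = a * (b * CliffordAlgebra.ι _ (isoInl (v ∘ Sum.inl)) * star b) * star a
        + a * (b * CliffordAlgebra.ι _ (isoInr (v ∘ Sum.inr)) * star b) * star a := by
        nth_rewrite 1 [hv v]
        rw [map_add, star_mul]
        simp only [mul_add, add_mul, mul_assoc]
    _ = _ := by rw [e1, e3, e4, e2, hR, map_add]

variable {ι₁ ι₂ : Type*} [Fintype ι₁] [DecidableEq ι₁] [Fintype ι₂] [DecidableEq ι₂]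
  [DecidableEq κ₂]

lemma rho_map_inl {p : ℕ} (c₁ : CliffordRep (Fin (2 * p)) ι₁) (c₂ : CliffordRep κ₂ ι₂)
    (x : Cl (Fin (2 * p))) :
    (c₁.prod c₂).rho (CliffordAlgebra.map isoInl x) = c₁.rho x ⊗ₖ (1 : Matrix ι₂ ι₂ ℂ) := by
  induction x using CliffordAlgebra.induction with
  | algebraMap r =>
    rw [AlgHom.commutes, AlgHom.commutes, AlgHom.commutes, Algebra.algebraMap_eq_smul_one,
      Algebra.algebraMap_eq_smul_one, Matrix.smul_kronecker, Matrix.one_kronecker_one]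
  | ι v =>
    rw [CliffordAlgebra.map_apply_ι, CliffordRep.rho_iota, CliffordRep.rho_iota, isoInl_apply]
    simp only [Fintype.sum_sum_type, Sum.elim_inl, Sum.elim_inr, Pi.zero_apply, zero_smul,
      Finset.sum_const_zero, add_zero, CliffordRep.prod]
    ext i j
    simp [Matrix.sum_apply, Finset.sum_mul, mul_assoc]
  | mul a b ha hb => rw [map_mul, map_mul, map_mul, ha, hb, ← Matrix.mul_kronecker_mul, one_mul]
  | add a b ha hb => rw [map_add, map_add, map_add, ha, hb, Matrix.add_kronecker]

lemma rho_map_inr {p : ℕ} (c₁ : CliffordRep (Fin (2 * p)) ι₁) (c₂ : CliffordRep κ₂ ι₂)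
    (x : Cl κ₂) (hx : x ∈ CliffordAlgebra.evenOdd (negSq κ₂) 0) :
    (c₁.prod c₂).rho (CliffordAlgebra.map isoInr x) = (1 : Matrix ι₁ ι₁ ℂ) ⊗ₖ c₂.rho x := by
  have hι : ∀ v : κ₂ → ℝ, (c₁.prod c₂).rho (CliffordAlgebra.ι _ (isoInr v))
      = (Complex.I ^ p • c₁.vol) ⊗ₖ c₂.rho (CliffordAlgebra.ι _ v) := by
    intro v
    rw [CliffordRep.rho_iota, CliffordRep.rho_iota, isoInr_apply]
    simp only [Fintype.sum_sum_type, Sum.elim_inl, Sum.elim_inr, Pi.zero_apply, zero_smul,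
      Finset.sum_const_zero, zero_add, CliffordRep.prod]
    ext i j
    simp only [Matrix.sum_apply, Matrix.smul_apply, Matrix.kroneckerMap_apply, Finset.mul_sum,
      mul_smul_comm]
  refine CliffordAlgebra.even_induction (Q := negSq κ₂)
    (motive := fun x _ => (c₁.prod c₂).rho (CliffordAlgebra.map isoInr x)
      = (1 : Matrix ι₁ ι₁ ℂ) ⊗ₖ c₂.rho x)
    (fun r => ?_) (fun x y hx hy ihx ihy => ?_) (fun m₁ m₂ x hx ih => ?_) x hx
  · rw [AlgHom.commutes, AlgHom.commutes, AlgHom.commutes, Algebra.algebraMap_eq_smul_one,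
      Algebra.algebraMap_eq_smul_one, Matrix.kronecker_smul, Matrix.one_kronecker_one]
  · rw [map_add, map_add, map_add, ihx, ihy, Matrix.kronecker_add]
  · simp only [map_mul, CliffordAlgebra.map_apply_ι, ih, hι]
    rw [← Matrix.mul_kronecker_mul, ← Matrix.mul_kronecker_mul, c₁.ivol_sq, one_mul]

lemma SpinC.rep_prod {p : ℕ} (c₁ : CliffordRep (Fin (2 * p)) ι₁) (c₂ : CliffordRep κ₂ ι₂)
    (g₁ : SpinC (Fin (2 * p))) (g₂ : SpinC κ₂) :
    SpinC.rep (c₁.prod c₂) (SpinC.prod g₁ g₂) = SpinC.rep c₁ g₁ ⊗ₖ SpinC.rep c₂ g₂ := by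
  obtain ⟨f₁, h₁, rfl⟩ := SpinC.exists_mk g₁
  obtain ⟨f₂, h₂, rfl⟩ := SpinC.exists_mk g₂
  rw [SpinC.prod, map_mul]
  simp only [SpinC.map_mk, SpinC.rep_mk]
  change ((h₁ : ℂ) • (c₁.prod c₂).rho (CliffordAlgebra.map isoInl (f₁ : Cl _))) *
    ((h₂ : ℂ) • (c₁.prod c₂).rho (CliffordAlgebra.map isoInr (f₂ : Cl _))) = _
  rw [rho_map_inl, rho_map_inr _ _ _ (spinGroup.mem_even f₂.2), smul_mul_smul_comm,
    ← Matrix.mul_kronecker_mul, one_mul, mul_one, Matrix.smul_kronecker, Matrix.kronecker_smul,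
    smul_smul]

end Product

end Algebra

section Geometry

variable {E H M : Type*} [NormedAddCommGroup E] [NormedSpace ℝ E] [TopologicalSpace H]
  (I : ModelWithCorners ℝ E H) [TopologicalSpace M] [ChartedSpace H M]

/-- A field of bilinear forms on the tangent spaces. -/
abbrev MetricField (M : Type*) [TopologicalSpace M] [ChartedSpace H M] :=
  (x : M) → TangentSpace I x →L[ℝ] TangentSpace I x →L[ℝ] ℝ

variable {I}

/-- The derivative of a function at `x` in the direction of a tangent vector. -/
def dirDeriv {F : Type*} [NormedAddCommGroup F] [NormedSpace ℝ F] (f : M → F) (x : M)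
    (v : TangentSpace I x) : F := mfderiv I 𝓘(ℝ, F) f x v

/-- `g(∇_X Y, Z)` for the Levi-Civita connection `∇` of `g`, given by the Koszul formula. -/
def leviCivita (g : MetricField I M) (X Y Z : (x : M) → TangentSpace I x) (x : M) : ℝ :=
  (1 / 2) * (dirDeriv (fun y => g y (Y y) (Z y)) x (X x)
    + dirDeriv (fun y => g y (X y) (Z y)) x (Y x)
    - dirDeriv (fun y => g y (X y) (Y y)) x (Z x)
    + g x (VectorField.mlieBracket I X Y x) (Z x)
    - g x (VectorField.mlieBracket I X Z x) (Y x)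
    - g x (VectorField.mlieBracket I Y Z x) (X x))

lemma contMDiffOn_mul' {f h : M → ℂ} {s : Set M} (hf : ContMDiffOn I 𝓘(ℝ, ℂ) ∞ f s)
    (hh : ContMDiffOn I 𝓘(ℝ, ℂ) ∞ h s) : ContMDiffOn I 𝓘(ℝ, ℂ) ∞ (fun x => f x * h x) s :=
  ((contDiff_fst.mul contDiff_snd : ContDiff ℝ ∞ fun z : ℂ × ℂ => z.1 * z.2).contMDiff).comp_contMDiffOn
    (hf.prodMk_space hh)

variable [IsManifold I 1 M]

/-- A `spin^c` structure on `(M, g)`, presented by a trivializing open cover `U` indexed by `J`: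
smooth orthonormal frames over the sets of the cover, whose changes of frame are lifted to a smooth
`Spin^c(n)`-valued cocycle. The frames determine the orientation. Smoothness of a map into
`Spin^c(n)` is smoothness of its operators on the spinor module together with that of its image
under `det`. -/
structure SpinCStructure (g : MetricField I M) {κ ι : Type*} [Fintype κ] [DecidableEq κ]
    [Fintype ι] [DecidableEq ι] (c : CliffordRep κ ι) (J : Type*) where
  U : J → Set M
  isOpen_U : ∀ i, IsOpen (U i)
  cover : ∀ x, ∃ i, x ∈ U i
  card_eq : Fintype.card κ = Module.finrank ℝ E
  frame : J → κ → (x : M) → TangentSpace I x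
  frame_smooth : ∀ i a, ContMDiffOn I I.tangent ∞
    (fun x => (⟨x, frame i a x⟩ : TangentBundle I M)) (U i)
  orthonormal : ∀ i, ∀ x ∈ U i, ∀ a b, g x (frame i a x) (frame i b x) = if a = b then 1 else 0
  trans : J → J → M → SpinC κ
  trans_smooth : ∀ i j a b, ContMDiffOn I 𝓘(ℝ, ℂ) ∞
    (fun x => SpinC.rep c (trans i j x) a b) (U i ∩ U j)
  det_smooth : ∀ i j, ContMDiffOn I 𝓘(ℝ, ℂ) ∞
    (fun x => SpinC.detC (trans i j x)) (U i ∩ U j)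
  cocycle : ∀ i j k, ∀ x ∈ U i ∩ U j ∩ U k, trans i j x * trans j k x = trans i k x
  covers : ∀ i j, ∀ x ∈ U i ∩ U j, SpinC.Covers (trans i j x)
    (Matrix.of fun l k => g x (frame i l x) (frame j k x))

namespace SpinCStructure

variable {g : MetricField I M} {κ ι J : Type*} [Fintype κ] [DecidableEq κ]
    [Fintype ι] [DecidableEq ι] {c : CliffordRep κ ι}

/-- The conjugate structure, with associated line bundle `-L` (the inverse of `L`): the same frames
and the conjugate transition functions. -/
def conj (S : SpinCStructure g c J) : SpinCStructure g c J where
  U := S.U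
  isOpen_U := S.isOpen_U
  cover := S.cover
  card_eq := S.card_eq
  frame := S.frame
  frame_smooth := S.frame_smooth
  orthonormal := S.orthonormal
  trans i j x := SpinC.conj (S.trans i j x)
  trans_smooth i j a b := by
    have h1 : ContMDiffOn I 𝓘(ℝ, ℂ) ∞
        (fun x => Complex.conjCLE (SpinC.detC (S.trans i j x))) (S.U i ∩ S.U j) :=
      Complex.conjCLE.contDiff.contMDiff.comp_contMDiffOn (S.det_smooth i j)
    refine (contMDiffOn_mul' h1 (S.trans_smooth i j a b)).congr fun x _ => ?_
    rw [SpinC.rep_conj, Matrix.smul_apply, smul_eq_mul]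
  det_smooth i j := by
    have h1 : ContMDiffOn I 𝓘(ℝ, ℂ) ∞
        (fun x => Complex.conjCLE (SpinC.detC (S.trans i j x))) (S.U i ∩ S.U j) :=
      Complex.conjCLE.contDiff.contMDiff.comp_contMDiffOn (S.det_smooth i j)
    refine h1.congr fun x _ => ?_
    rw [SpinC.detC_conj]
  cocycle i j k x hx := by rw [← map_mul, S.cocycle i j k x hx]
  covers i j x hx := (S.covers i j x hx).conj

/-- A `U(1)`-connection on the line bundle `L` of the structure, whose transition functions are
`det` of those of the structure: real one-forms `A_i` on `U_i`, the connection being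
`d + √-1 A_i` in the `i`-th trivialization. -/
structure Connection (S : SpinCStructure g c J) where
  form : J → (x : M) → TangentSpace I x →L[ℝ] ℝ
  smooth : ∀ i a, ContMDiffOn I 𝓘(ℝ, ℝ) ∞ (fun x => form i x (S.frame i a x)) (S.U i)
  gauge : ∀ i j, ∀ x ∈ S.U i ∩ S.U j, ∀ v : TangentSpace I x,
    dirDeriv (fun y => SpinC.detC (S.trans i j y)) x v
      = Complex.I * ((form j x v - form i x v : ℝ) : ℂ) * SpinC.detC (S.trans i j x)

/-- The connection `-A` on `-L`. -/
def Connection.neg {S : SpinCStructure g c J} (A : S.Connection) : S.conj.Connection where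
  form i x := -A.form i x
  smooth i a := (A.smooth i a).neg
  gauge i j x hx v := by
    have hd : MDifferentiableAt I 𝓘(ℝ, ℂ) (fun y => SpinC.detC (S.trans i j y)) x :=
      ((S.det_smooth i j).contMDiffAt
        (((S.isOpen_U i).inter (S.isOpen_U j)).mem_nhds hx)).mdifferentiableAt (by simp)
    have e : (fun y => SpinC.detC (S.conj.trans i j y))
        = Complex.conjCLE ∘ fun y => SpinC.detC (S.trans i j y) :=
      funext fun y => SpinC.detC_conj _
    have h1 : HasMFDerivAt I 𝓘(ℝ, ℂ) (Complex.conjCLE ∘ fun y => SpinC.detC (S.trans i j y)) x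
        ((Complex.conjCLE : ℂ →L[ℝ] ℂ).comp
          (mfderiv I 𝓘(ℝ, ℂ) (fun y => SpinC.detC (S.trans i j y)) x)) :=
      HasMFDerivAt.comp x (Complex.conjCLE.hasFDerivAt.hasMFDerivAt) hd.hasMFDerivAt
    have h4 := congrArg (Complex.conjCLE : ℂ → ℂ) (A.gauge i j x hx v)
    rw [e, dirDeriv, h1.mfderiv]
    refine h4.trans ?_
    change _ = Complex.I * (((-A.form j x v) - (-A.form i x v) : ℝ) : ℂ)
      * SpinC.detC (SpinC.conj (S.trans i j x))
    rw [SpinC.detC_conj]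
    simp
    ring

/-- A smooth section of the spinor bundle associated to the module `Δ = ι → ℂ`: smooth functions `ψ_i : U_i → Δ` with
`ψ_i = g_{ij} ψ_j`. -/
def IsSection (S : SpinCStructure g c J) (ψ : J → M → ι → ℂ) : Prop :=
  (∀ i, ContMDiffOn I 𝓘(ℝ, ι → ℂ) ∞ (ψ i) (S.U i)) ∧
    ∀ i j, ∀ x ∈ S.U i ∩ S.U j, ψ i x = SpinC.rep c (S.trans i j x) *ᵥ ψ j x

/-- Two spinor fields, given in the trivializations over the `U_i`, coincide. -/
def Same (S : SpinCStructure g c J) (φ ψ : J → M → ι → ℂ) : Prop :=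
  ∀ i, ∀ x ∈ S.U i, φ i x = ψ i x

/-- The spinor derivative `∇^A_{e_a} ψ` in the `i`-th trivialization,
`e_a(ψ_i) + ½ (√-1 A(e_a) + ∑_{b<d} ω_{db}(e_a) e_b e_d) ψ_i`, with `ω_{db} = g(∇ e_b, e_d)`;
the sum over `b < d` is half the sum over all `b, d`. -/
def nabla (S : SpinCStructure g c J) (A : S.Connection) (a : κ) (ψ : J → M → ι → ℂ) :
    J → M → ι → ℂ := fun i x =>
  dirDeriv (ψ i) x (S.frame i a x)
    + (1 / 2 : ℂ) • ((Complex.I * (A.form i x (S.frame i a x) : ℂ)) • ψ i x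
      + (1 / 2 : ℂ) • ∑ b, ∑ d,
        (leviCivita g (S.frame i a) (S.frame i b) (S.frame i d) x : ℂ) •
          (c.gen b * c.gen d) *ᵥ ψ i x)

/-- The `spin^c` Dirac operator `D^A ψ = ∑_a e_a · ∇^A_{e_a} ψ`, computed in each of the
trivializations. -/
def dirac (S : SpinCStructure g c J) (A : S.Connection) (ψ : J → M → ι → ℂ) :
    J → M → ι → ℂ := fun i x => ∑ a, c.gen a *ᵥ S.nabla A a ψ i x

end SpinCStructure

/-- The pointwise action of an endomorphism of the spinor module. -/
def act {J M ι : Type*} (T : (ι → ℂ) → (ι → ℂ)) (ψ : J → M → ι → ℂ) : J → M → ι → ℂ :=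
  fun i x => T (ψ i x)

end Geometry

section ProductGeometry

variable {E₁ H₁ M₁ E₂ H₂ M₂ : Type*}
  [NormedAddCommGroup E₁] [NormedSpace ℝ E₁] [TopologicalSpace H₁]
  {I₁ : ModelWithCorners ℝ E₁ H₁} [TopologicalSpace M₁] [ChartedSpace H₁ M₁]
  [NormedAddCommGroup E₂] [NormedSpace ℝ E₂] [TopologicalSpace H₂]
  {I₂ : ModelWithCorners ℝ E₂ H₂} [TopologicalSpace M₂] [ChartedSpace H₂ M₂]

/-- The vector `(v, w)` tangent to a product. -/
def tangentPair {x : M₁ × M₂} (v : TangentSpace I₁ x.1) (w : TangentSpace I₂ x.2) :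
    TangentSpace (I₁.prod I₂) x := (v, w)

/-- `dπ₁` on tangent vectors. -/
def tangentFst (x : M₁ × M₂) : TangentSpace (I₁.prod I₂) x →L[ℝ] TangentSpace I₁ x.1 :=
  ContinuousLinearMap.fst ℝ E₁ E₂

/-- `dπ₂` on tangent vectors. -/
def tangentSnd (x : M₁ × M₂) : TangentSpace (I₁.prod I₂) x →L[ℝ] TangentSpace I₂ x.2 :=
  ContinuousLinearMap.snd ℝ E₁ E₂

/-- The product metric `g₁ + g₂`. -/
def prodMetric (g₁ : MetricField I₁ M₁) (g₂ : MetricField I₂ M₂) :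
    MetricField (I₁.prod I₂) (M₁ × M₂) := fun x =>
  ((show E₁ →L[ℝ] E₁ →L[ℝ] ℝ from g₁ x.1).bilinearComp
      (ContinuousLinearMap.fst ℝ E₁ E₂) (ContinuousLinearMap.fst ℝ E₁ E₂)
    + (show E₂ →L[ℝ] E₂ →L[ℝ] ℝ from g₂ x.2).bilinearComp
      (ContinuousLinearMap.snd ℝ E₁ E₂) (ContinuousLinearMap.snd ℝ E₁ E₂) :
    E₁ × E₂ →L[ℝ] E₁ × E₂ →L[ℝ] ℝ)

lemma prodMetric_pair (g₁ : MetricField I₁ M₁) (g₂ : MetricField I₂ M₂) (x : M₁ × M₂) (v v' : TangentSpace I₁ x.1) (w w' : TangentSpace I₂ x.2) :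
    prodMetric g₁ g₂ x (tangentPair v w) (tangentPair v' w') = g₁ x.1 v v' + g₂ x.2 w w' := rfl

variable [IsManifold I₁ 1 M₁] [IsManifold I₂ 1 M₂]

variable {g₁ : MetricField I₁ M₁} {g₂ : MetricField I₂ M₂} {p : ℕ}
  {κ₂ ι₁ ι₂ J₁ J₂ : Type*} [Fintype κ₂] [DecidableEq κ₂] [Fintype ι₁] [DecidableEq ι₁]
  [Fintype ι₂] [DecidableEq ι₂] {c₁ : CliffordRep (Fin (2 * p)) ι₁} {c₂ : CliffordRep κ₂ ι₂}

lemma smooth_pair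
    {X : (x : M₁) → TangentSpace I₁ x} {Y : (x : M₂) → TangentSpace I₂ x}
    {s : Set M₁} {t : Set M₂}
    (hX : ContMDiffOn I₁ I₁.tangent ∞ (fun x => (⟨x, X x⟩ : TangentBundle I₁ M₁)) s)
    (hY : ContMDiffOn I₂ I₂.tangent ∞ (fun x => (⟨x, Y x⟩ : TangentBundle I₂ M₂)) t) :
    ContMDiffOn (I₁.prod I₂) (I₁.prod I₂).tangent ∞
      (fun x : M₁ × M₂ => (⟨x, tangentPair (X x.1) (Y x.2)⟩ : TangentBundle (I₁.prod I₂) (M₁ × M₂)))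
      (s ×ˢ t) :=
  contMDiff_equivTangentBundleProd_symm.comp_contMDiffOn
    ((hX.comp contMDiffOn_fst fun _ h => h.1).prodMk (hY.comp contMDiffOn_snd fun _ h => h.2))

lemma smooth_zero (s : Set M₁) :
    ContMDiffOn I₁ I₁.tangent ∞ (fun x => (⟨x, (0 : TangentSpace I₁ x)⟩ : TangentBundle I₁ M₁)) s :=
  (Bundle.contMDiff_zeroSection ℝ (TangentSpace I₁ : M₁ → Type _)).contMDiffOn

/-- The product `spin^c` structure on the Riemannian product: the cover by products, the frames
`(E_1, …, E_{2p}, F_1, …, F_{k₂})`, and the products of transition functions. Its spinor bundle is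
the exterior tensor product of the two spinor bundles. -/
def SpinCStructure.prod [FiniteDimensional ℝ E₁] [FiniteDimensional ℝ E₂]
    (S₁ : SpinCStructure g₁ c₁ J₁) (S₂ : SpinCStructure g₂ c₂ J₂) :
    SpinCStructure (prodMetric g₁ g₂) (c₁.prod c₂) (J₁ × J₂) where
  U i := S₁.U i.1 ×ˢ S₂.U i.2
  isOpen_U i := (S₁.isOpen_U i.1).prod (S₂.isOpen_U i.2)
  cover x := by
    obtain ⟨i, hi⟩ := S₁.cover x.1
    obtain ⟨j, hj⟩ := S₂.cover x.2
    exact ⟨(i, j), hi, hj⟩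
  card_eq := by
    rw [Fintype.card_sum, Module.finrank_prod, S₁.card_eq, S₂.card_eq]
  frame i := Sum.elim (fun a x => tangentPair (S₁.frame i.1 a x.1) 0)
    (fun a x => tangentPair 0 (S₂.frame i.2 a x.2))
  frame_smooth i a := by
    rcases a with a | a
    · exact smooth_pair (S₁.frame_smooth i.1 a) (smooth_zero _)
    · exact smooth_pair (smooth_zero _) (S₂.frame_smooth i.2 a)
  orthonormal i x hx a b := by
    rcases a with a | a <;> rcases b with b | b <;>
      simp [prodMetric_pair, S₁.orthonormal i.1 x.1 hx.1, S₂.orthonormal i.2 x.2 hx.2]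
  trans i j x := SpinC.prod (S₁.trans i.1 j.1 x.1) (S₂.trans i.2 j.2 x.2)
  trans_smooth i j a b := by
    have h1 := (S₁.trans_smooth i.1 j.1 a.1 b.1).comp
      (contMDiffOn_fst (I := I₁) (J := I₂)
        (s := (S₁.U i.1 ×ˢ S₂.U i.2) ∩ (S₁.U j.1 ×ˢ S₂.U j.2))) fun _ h => ⟨h.1.1, h.2.1⟩
    have h2 := (S₂.trans_smooth i.2 j.2 a.2 b.2).comp
      (contMDiffOn_snd (I := I₁) (J := I₂)
        (s := (S₁.U i.1 ×ˢ S₂.U i.2) ∩ (S₁.U j.1 ×ˢ S₂.U j.2))) fun _ h => ⟨h.1.2, h.2.2⟩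
    refine (contMDiffOn_mul' h1 h2).congr fun x _ => ?_
    rw [SpinC.rep_prod]
    rfl
  det_smooth i j := by
    have h1 := (S₁.det_smooth i.1 j.1).comp
      (contMDiffOn_fst (I := I₁) (J := I₂)
        (s := (S₁.U i.1 ×ˢ S₂.U i.2) ∩ (S₁.U j.1 ×ˢ S₂.U j.2))) fun _ h => ⟨h.1.1, h.2.1⟩
    have h2 := (S₂.det_smooth i.2 j.2).comp
      (contMDiffOn_snd (I := I₁) (J := I₂)
        (s := (S₁.U i.1 ×ˢ S₂.U i.2) ∩ (S₁.U j.1 ×ˢ S₂.U j.2))) fun _ h => ⟨h.1.2, h.2.2⟩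
    exact (contMDiffOn_mul' h1 h2).congr fun x _ => SpinC.detC_prod _ _
  cocycle i j k x hx := by
    rw [← SpinC.prod_mul, S₁.cocycle i.1 j.1 k.1 x.1 ⟨⟨hx.1.1.1, hx.1.2.1⟩, hx.2.1⟩,
      S₂.cocycle i.2 j.2 k.2 x.2 ⟨⟨hx.1.1.2, hx.1.2.2⟩, hx.2.2⟩]
  covers i j x hx := by
    have h := (S₁.covers i.1 j.1 x.1 ⟨hx.1.1, hx.2.1⟩).prod
      (S₂.covers i.2 j.2 x.2 ⟨hx.1.2, hx.2.2⟩)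
    convert h using 1
    ext (a | a) (b | b) <;> simp [prodMetric_pair]

/-- The product connection `A = π₁^* A₁ + π₂^* A₂` on `L = π₁^* L₁ ⊗ π₂^* L₂`. -/
def SpinCStructure.Connection.prod [FiniteDimensional ℝ E₁] [FiniteDimensional ℝ E₂]
    {S₁ : SpinCStructure g₁ c₁ J₁} {S₂ : SpinCStructure g₂ c₂ J₂}
    (A₁ : S₁.Connection) (A₂ : S₂.Connection) : (S₁.prod S₂).Connection where
  form i x := (A₁.form i.1 x.1).comp (tangentFst x) + (A₂.form i.2 x.2).comp (tangentSnd x)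
  smooth i a := by
    rcases a with a | a
    · refine ((A₁.smooth i.1 a).comp (contMDiffOn_fst (I := I₁) (J := I₂)
        (s := S₁.U i.1 ×ˢ S₂.U i.2)) fun _ h => h.1).congr fun x _ => ?_
      change A₁.form i.1 x.1 (S₁.frame i.1 a x.1) + A₂.form i.2 x.2 0 = _
      rw [map_zero, add_zero]; rfl
    · refine ((A₂.smooth i.2 a).comp (contMDiffOn_snd (I := I₁) (J := I₂)
        (s := S₁.U i.1 ×ˢ S₂.U i.2)) fun _ h => h.2).congr fun x _ => ?_
      change A₁.form i.1 x.1 0 + A₂.form i.2 x.2 (S₂.frame i.2 a x.2) = _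
      rw [map_zero, zero_add]; rfl
  gauge i j x hx v := by
    have hx₁ : x.1 ∈ S₁.U i.1 ∩ S₁.U j.1 := ⟨hx.1.1, hx.2.1⟩
    have hx₂ : x.2 ∈ S₂.U i.2 ∩ S₂.U j.2 := ⟨hx.1.2, hx.2.2⟩
    set f₁ := fun y => SpinC.detC (S₁.trans i.1 j.1 y) with hf₁
    set f₂ := fun y => SpinC.detC (S₂.trans i.2 j.2 y) with hf₂
    have d₁ : MDifferentiableAt I₁ 𝓘(ℝ, ℂ) f₁ x.1 :=
      ((S₁.det_smooth i.1 j.1).contMDiffAt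
        (((S₁.isOpen_U _).inter (S₁.isOpen_U _)).mem_nhds hx₁)).mdifferentiableAt (by simp)
    have d₂ : MDifferentiableAt I₂ 𝓘(ℝ, ℂ) f₂ x.2 :=
      ((S₂.det_smooth i.2 j.2).contMDiffAt
        (((S₂.isOpen_U _).inter (S₂.isOpen_U _)).mem_nhds hx₂)).mdifferentiableAt (by simp)
    have e : (fun y => SpinC.detC ((S₁.prod S₂).trans i j y))
        = (f₁ ∘ Prod.fst) * (f₂ ∘ Prod.snd) :=
      funext fun y => SpinC.detC_prod _ _
    have h₁ : HasMFDerivAt (I₁.prod I₂) 𝓘(ℝ, ℂ) (f₁ ∘ Prod.fst) x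
      ((mfderiv I₁ 𝓘(ℝ, ℂ) f₁ x.1).comp (tangentFst x)) :=
      d₁.hasMFDerivAt.comp x (hasMFDerivAt_fst x)
    have h₂ : HasMFDerivAt (I₁.prod I₂) 𝓘(ℝ, ℂ) (f₂ ∘ Prod.snd) x
      ((mfderiv I₂ 𝓘(ℝ, ℂ) f₂ x.2).comp (tangentSnd x)) :=
      d₂.hasMFDerivAt.comp x (hasMFDerivAt_snd x)
    have hm := (h₁.mul h₂).mfderiv
    have g1 := A₁.gauge i.1 j.1 x.1 hx₁ (tangentFst x v)
    have g2 := A₂.gauge i.2 j.2 x.2 hx₂ (tangentSnd x v)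
    have ex : SpinC.detC ((S₁.prod S₂).trans i j x) = f₁ x.1 * f₂ x.2 := SpinC.detC_prod _ _
    rw [ex, e, dirDeriv, hm]
    change f₁ x.1 * dirDeriv f₂ x.2 (tangentSnd x v)
      + f₂ x.2 * dirDeriv f₁ x.1 (tangentFst x v) = _
    rw [g1, g2]
    change _ = Complex.I * (((A₁.form j.1 x.1 (tangentFst x v) + A₂.form j.2 x.2 (tangentSnd x v))
      - (A₁.form i.1 x.1 (tangentFst x v) + A₂.form i.2 x.2 (tangentSnd x v)) : ℝ) : ℂ)
      * (f₁ x.1 * f₂ x.2)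
    push_cast
    ring

/-- The partial Dirac operator `D₊ ψ = ∑_t E_t · ∇_{E_t} ψ` along the first factor. -/
def SpinCStructure.diracPlus [FiniteDimensional ℝ E₁] [FiniteDimensional ℝ E₂]
    {S₁ : SpinCStructure g₁ c₁ J₁} {S₂ : SpinCStructure g₂ c₂ J₂}
    (A₁ : S₁.Connection) (A₂ : S₂.Connection) (ψ : J₁ × J₂ → M₁ × M₂ → ι₁ × ι₂ → ℂ) :
    J₁ × J₂ → M₁ × M₂ → ι₁ × ι₂ → ℂ := fun i x =>
  ∑ t : Fin (2 * p), (c₁.prod c₂).gen (Sum.inl t) *ᵥ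
    (S₁.prod S₂).nabla (A₁.prod A₂) (Sum.inl t) ψ i x

end ProductGeometry

/-- The Clifford action of the volume form `μ₁ = E^1 ∧ ⋯ ∧ E^{2p}` of the first factor. -/
def muOne {p k : ℕ} {ι₁ ι₂ : Type*} [Fintype ι₁] [DecidableEq ι₁] [Fintype ι₂] [DecidableEq ι₂]
    (c₁ : CliffordRep (Fin (2 * p)) ι₁) (c₂ : CliffordRep (Fin k) ι₂) :
    Matrix (ι₁ × ι₂) (ι₁ × ι₂) ℂ :=
  (List.ofFn fun t => (c₁.prod c₂).gen (Sum.inl t)).prod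

/-- The Clifford action of the volume form `μ₂ = F^1 ∧ ⋯ ∧ F^k` of the second factor. -/
def muTwo {p k : ℕ} {ι₁ ι₂ : Type*} [Fintype ι₁] [DecidableEq ι₁] [Fintype ι₂] [DecidableEq ι₂]
    (c₁ : CliffordRep (Fin (2 * p)) ι₁) (c₂ : CliffordRep (Fin k) ι₂) :
    Matrix (ι₁ × ι₂) (ι₁ × ι₂) ℂ :=
  (List.ofFn fun l => (c₁.prod c₂).gen (Sum.inr l)).prod

/-- `j* = j₀ ⊗ j₁`, `u(ε₁, …, ε_{p+q}) ↦ j₀ u(ε₁, …, ε_p) ⊗ j₁ u(ε_{p+1}, …, ε_{p+q})`. -/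
def jStar (p q : ℕ) := antilinear (jZero p ⊗ₖ jOne q)

/-- `ĵ* = j₁ ⊗ j₀`. -/
def jHatStar (p q : ℕ) := antilinear (jOne p ⊗ₖ jZero q)

/-- `j₀* = j₀ ⊗ j₀`. -/
def jZeroStar (p q : ℕ) := antilinear (jZero p ⊗ₖ jZero q)

/-- `j₁* = j₁ ⊗ j₁`. -/
def jOneStar (p q : ℕ) := antilinear (jOne p ⊗ₖ jOne q)

end SpinCProduct

end

open SpinCProduct

open scoped Manifold ContDiff Matrix Kronecker

noncomputable section

namespace SpinCProduct

/-! ### Signs of `j₀` and `j₁` against the generators of the spinor modules. -/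

section Antilinear

/-! Everything rests on signs and on the fact that the two factors of a Riemannian product do not
interact.

Parts 2 to 4. Suppose an antilinear map `φ ↦ B φ̄` anticommutes with every Clifford generator. It
then commutes with the even Clifford algebra, hence with `Spin(n)` and with the products `e_b e_d`
of the spin connection, whose coefficients are real. Being antilinear, it turns `h ∈ S¹` into `h̄`
and `√-1 A` into `-√-1 A`. So it carries sections for `L` to sections for `-L`, intertwines `∇^A`
with `∇^{-A}`, and anticommutes with the Dirac operators because of the leading `e_a`
(`isSection_antilinear`, `nabla_antilinear`, `dirac_antilinear`).

It remains to find such `B`. Since `j₀` and `j₁` are tensor products of antilinear flips of `ℂ²`,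
each generator can be treated one tensor factor at a time: `j₀` commutes with the generators of
`Δ_{2m}`, and also with the last one of `Δ_{2m+1}` if `m` is odd, while `j₁` has the sign
`(-1)^(m+1)` against every generator in both cases. On the product the conjugate of `i^p`
contributes a further `(-1)^p` for the `F_l`. Both volume forms anticommute with the `E_t` and
commute with the `F_l`, so multiplying by `μ_i` changes only the sign for the `E_t`. The parity
assumptions make all resulting signs `-1`.

Part 1. Write `D = D₊ + D₋` along the two factors. The operator `μ_i` is parallel, anticommutes with
`D₊` and commutes with `D₋`, so the claim reduces to `D₊ D₋ + D₋ D₊ = 0`. Now `E_t` and `F_l`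
anticommute, and `∇_{E_t}`, `∇_{F_l}` commute: in the product frames the mixed brackets vanish, the
connection matrices are `Γ₁ ⊗ 1` and `1 ⊗ Γ₂` with each `Γ_i` depending on its own factor only, and
the plain derivatives commute by symmetry of the second derivative (`nabla_nabla_comm`,
`dirac_act_diracPlus`). -/

lemma star_mulVec_eq {ι : Type*} [Fintype ι] (M : Matrix ι ι ℂ) (φ : ι → ℂ) :
    star (M *ᵥ φ) = M.map star *ᵥ star φ := by
  ext i
  simp [Matrix.mulVec, dotProduct]

lemma map_star_mul {ι : Type*} [Fintype ι] (M N : Matrix ι ι ℂ) :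
    (M * N).map star = M.map star * N.map star :=
  Matrix.map_mul (f := starRingEnd ℂ)

/-- Complex conjugation of tensor products of matrices. -/
lemma tensor_map_star {m : ℕ} (A : Fin m → Matrix ℤˣ ℤˣ ℂ) :
    (tensor A).map star = tensor fun k => (A k).map star := by
  ext a b
  simp [tensor]

lemma tensor_smul {m : ℕ} (s : Fin m → ℂ) (A : Fin m → Matrix ℤˣ ℤˣ ℂ) :
    tensor (fun k => s k • A k) = (∏ k, s k) • tensor A := by
  ext a b
  simp [tensor, Finset.prod_mul_distrib]

/-- The matrix of `u(ε) ↦ i^{nε} u(-ε)`, extended antilinearly. -/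
def jFactor (n : ℤ) : Matrix ℤˣ ℤˣ ℂ :=
  Matrix.of fun a b => if a = -b then Complex.I ^ (n * (b : ℤ)) else 0

/-- A sum of exponents is a product of powers, and a multi-index is flipped when each entry is. This
lets the signs of `j₀` and `j₁` be computed one tensor factor at a time. -/
lemma tensor_jFactor {m : ℕ} (n : Fin m → ℤ) :
    tensor (fun k => jFactor (n k)) = Matrix.of fun a b =>
      if a = -b then Complex.I ^ (∑ k, n k * (b k : ℤ)) else 0 := by
  ext a b
  simp only [tensor, jFactor, Matrix.of_apply, Fintype.prod_ite_zero, funext_iff, Pi.neg_apply]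
  split_ifs
  · induction (Finset.univ : Finset (Fin m)) using Finset.induction_on with
    | empty => simp
    | insert k s hk ih => rw [Finset.prod_insert hk, Finset.sum_insert hk, ih,
        zpow_add₀ Complex.I_ne_zero]
  · rfl

lemma jZero_eq (m : ℕ) : jZero m = tensor fun k : Fin m => jFactor ((k : ℤ) + 1) :=
  (tensor_jFactor _).symm

lemma jOne_eq (m : ℕ) : jOne m = tensor fun k : Fin m => jFactor ((m : ℤ) - k) :=
  (tensor_jFactor _).symm

lemma I_zpow_neg (n : ℤ) : Complex.I ^ (-n) = (-1) ^ n * Complex.I ^ n := by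
  have h : (-1 : ℂ) = Complex.I ^ (-2 : ℤ) := by
    rw [zpow_neg, show (2 : ℤ) = ((2 : ℕ) : ℤ) from rfl, zpow_natCast, Complex.I_sq]; norm_num
  rw [h, ← zpow_mul, ← zpow_add₀ Complex.I_ne_zero]
  congr 1; ring

/-- `T` is real and diagonal with eigenvalue `-ε` on `u(ε)`, so the flip `ε ↦ -ε` reverses its sign,
whatever the phases. -/
lemma jFactor_gT (n : ℤ) : jFactor n * gT.map star = (-1 : ℂ) • (gT * jFactor n) := by
  ext a b
  fin_cases a <;> fin_cases b <;> simp [jFactor, gT, Matrix.mul_apply, Matrix.diagonal]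

/-- Applied to `u(ε)`, the two orders return a multiple of `u(ε)` and differ by the phase `i^{-2nε}
= (-1)^n`. A further `-1` comes from conjugating `i` for `g₁` and from replacing `ε` by `-ε` in the
coefficient for `g₂`. -/
lemma jFactor_gPair (n : ℤ) (k : ℕ) :
    jFactor n * (gPair k).map star = ((-1 : ℂ) ^ (n + 1)) • (gPair k * jFactor n) := by
  have h := I_zpow_neg n
  -- After `i^{-n}` is rewritten, the column of `u(-1)` carries the factor `(-1)^n` twice.
  have h2 : ((-1 : ℂ) ^ n) * (-1) ^ n = 1 := by
    rw [← mul_zpow]; simp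
  rw [zpow_add₀ (by norm_num), zpow_one]
  unfold gPair
  split_ifs <;> ext a b <;> fin_cases a <;> fin_cases b <;>
    simp [jFactor, g1, g2, Matrix.mul_apply, -zpow_neg, h]
  all_goals first
    | ring1
    | linear_combination Complex.I ^ n * h2
    | linear_combination -Complex.I ^ n * h2
    | linear_combination -Complex.I ^ n * Complex.I * h2

/-- A generator at the zero-based site `β` has `β` factors `T` to its left, worth `(-1)^β`, and its
local factor is worth `(-1)^(n β + 1)`; identity factors contribute nothing. The hypothesis asks
that the product be the same for all sites. -/
lemma tensor_jFactor_stdGen {m : ℕ} (n : Fin m → ℤ) (k : Fin (2 * m)) (s : ℂ)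
    (hs : ∀ β : Fin m, (-1 : ℂ) ^ (β : ℕ) * (-1) ^ (n β + 1) = s) :
    tensor (fun k => jFactor (n k)) * (stdGen m k).map star
      = s • (stdGen m k * tensor fun k => jFactor (n k)) := by
  set β : Fin m := ⟨k / 2, by omega⟩ with hβ
  have h : ∀ a : Fin m, jFactor (n a) * (if a < β then gT else if a = β then gPair k else 1).map star
      = (if a < β then (-1 : ℂ) else if a = β then (-1) ^ (n a + 1) else 1) •
        ((if a < β then gT else if a = β then gPair k else 1) * jFactor (n a)) := by
    intro a
    split_ifs
    · exact jFactor_gT _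
    · exact jFactor_gPair _ _
    · rw [Matrix.map_one _ (star_zero ℂ) (star_one ℂ)]; simp
  rw [stdGen, ← hβ, site, tensor_map_star, tensor_mul, tensor_mul]
  simp only [h]
  rw [tensor_smul, ← hs β]
  congr 1
  have e : ∀ a : Fin m, (if a < β then (-1 : ℂ) else if a = β then (-1) ^ (n a + 1) else 1)
      = (if a < β then (-1 : ℂ) else 1) * (if a = β then (-1) ^ (n a + 1) else 1) := by
    intro a
    by_cases h1 : a < β
    · simp [h1, h1.ne]
    · simp [h1]
  simp only [e, Finset.prod_mul_distrib, Finset.prod_ite_eq', Finset.mem_univ, if_true]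
  congr 1
  -- The factors `-1` are indexed by the `a < β`, and there are `β` of these.
  rw [Finset.prod_ite, Finset.prod_const_one, mul_one, Finset.prod_const]
  congr 1
  rw [← Fin.card_Iio β]
  congr 1; ext; simp

/-- The `m` factors `T` give `(-1)^m` and conjugating the scalar `σ i` gives one more `-1`. The
weights `n` play no role. -/
lemma tensor_jFactor_top {m : ℕ} (n : Fin m → ℤ) (σ : ℤˣ) :
    tensor (fun k => jFactor (n k)) *
      ((((σ : ℤ) : ℂ) * Complex.I) • tensor fun _ : Fin m => gT).map star
      = ((-1 : ℂ) ^ (m + 1)) • (((((σ : ℤ) : ℂ) * Complex.I) • tensor fun _ => gT) *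
        tensor fun k => jFactor (n k)) := by
  have e : ((((σ : ℤ) : ℂ) * Complex.I) • tensor fun _ : Fin m => gT).map star
      = (-(((σ : ℤ) : ℂ) * Complex.I)) • tensor fun _ : Fin m => gT.map star := by
    rw [← tensor_map_star]
    ext a b
    simp
  rw [e, mul_smul_comm, tensor_mul, smul_mul_assoc, tensor_mul]
  simp only [jFactor_gT]
  rw [tensor_smul, smul_smul, smul_smul]
  congr 1
  simp
  ring

lemma neg_one_pow_mul_zpow_even {β : ℕ} {n : ℤ} (h : Even ((β : ℤ) + n)) :
    (-1 : ℂ) ^ β * (-1) ^ n = 1 := by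
  rw [← zpow_natCast, ← zpow_add₀ (by norm_num), h.neg_one_zpow]

/-- The weight `β + 1` of `j₀` compensates the string of `T`s: the sign is `(-1)^(β + (β + 2)) = 1`.
-/
lemma jZero_stdGen (m : ℕ) (k : Fin (2 * m)) :
    jZero m * (stdGen m k).map star = stdGen m k * jZero m := by
  rw [jZero_eq, tensor_jFactor_stdGen _ k 1, one_smul]
  intro β
  exact neg_one_pow_mul_zpow_even ⟨β + 1, by ring⟩

/-- The weight `m - β` cancels `β` exactly: `β + (m - β + 1) = m + 1`. -/
lemma jOne_stdGen (m : ℕ) (k : Fin (2 * m)) :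
    jOne m * (stdGen m k).map star = ((-1 : ℂ) ^ (m + 1)) • (stdGen m k * jOne m) := by
  rw [jOne_eq, tensor_jFactor_stdGen _ k ((-1 : ℂ) ^ (m + 1))]
  intro β
  rw [← zpow_natCast, ← zpow_natCast, ← zpow_add₀ (by norm_num)]
  congr 1
  push_cast; ring

/-- The last generator has sign `(-1)^(q+1)`, which agrees with the sign `1` of the others exactly
for odd `q`. -/
lemma jZero_stdOdd (q : ℕ) (σ : ℤˣ) (hq : Odd q) (k : Fin (2 * q + 1)) :
    jZero q * ((stdOdd q σ).gen k).map star = (stdOdd q σ).gen k * jZero q := by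
  induction k using Fin.lastCases with
  | last =>
    simp only [stdOdd, Fin.snoc_last]
    rw [jZero_eq, tensor_jFactor_top, hq.add_one.neg_one_pow, one_smul]
  | cast k =>
    simp only [stdOdd, Fin.snoc_castSucc]
    exact jZero_stdGen q k

/-- For `j₁` the sign of the last generator agrees with that of the others for every `q`, so no
parity is needed. -/
lemma jOne_stdOdd (q : ℕ) (σ : ℤˣ) (k : Fin (2 * q + 1)) :
    jOne q * ((stdOdd q σ).gen k).map star
      = ((-1 : ℂ) ^ (q + 1)) • ((stdOdd q σ).gen k * jOne q) := by
  induction k using Fin.lastCases with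
  | last =>
    simp only [stdOdd, Fin.snoc_last]
    rw [jOne_eq, tensor_jFactor_top]
  | cast k =>
    simp only [stdOdd, Fin.snoc_castSucc]
    exact jOne_stdGen q k

end Antilinear

/-! ### Clifford signs on the tensor product of two spinor modules. -/

section ProductAlgebra

variable {ι : Type*} [Fintype ι] [DecidableEq ι]

lemma mul_list_prod_map_star (J : Matrix ι ι ℂ) (s : ℂ) (l : List (Matrix ι ι ℂ))
    (h : ∀ A ∈ l, J * A.map star = s • (A * J)) :
    J * l.prod.map star = s ^ l.length • (l.prod * J) := by
  induction l with
  | nil => simp [Matrix.map_one]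
  | cons A l ih =>
    rw [List.prod_cons, map_star_mul, ← mul_assoc, h A List.mem_cons_self, smul_mul_assoc,
      mul_assoc, ih fun B hB => h B (List.mem_cons_of_mem _ hB), mul_smul_comm, smul_smul,
      List.length_cons, mul_assoc, pow_succ']

lemma kronecker_map_star {ι₁ ι₂ : Type*} (A : Matrix ι₁ ι₁ ℂ) (B : Matrix ι₂ ι₂ ℂ) :
    (A ⊗ₖ B).map star = A.map star ⊗ₖ B.map star := by
  ext i j
  simp

variable {p : ℕ} {κ₂ ι₁ ι₂ : Type*} [DecidableEq κ₂] [Fintype ι₁] [DecidableEq ι₁]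
  [Fintype ι₂] [DecidableEq ι₂] {c₁ : CliffordRep (Fin (2 * p)) ι₁} {c₂ : CliffordRep κ₂ ι₂}
  {J₁ : Matrix ι₁ ι₁ ℂ} {J₂ : Matrix ι₂ ι₂ ℂ} {s₁ s₂ : ℂ}

lemma kronecker_antilinear_inl (h₁ : ∀ t, J₁ * (c₁.gen t).map star = s₁ • (c₁.gen t * J₁))
    (t : Fin (2 * p)) :
    (J₁ ⊗ₖ J₂) * ((c₁.prod c₂).gen (Sum.inl t)).map star
      = s₁ • ((c₁.prod c₂).gen (Sum.inl t) * (J₁ ⊗ₖ J₂)) := by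
  simp only [CliffordRep.prod, Sum.elim_inl]
  rw [kronecker_map_star, ← Matrix.mul_kronecker_mul, ← Matrix.mul_kronecker_mul, h₁,
    Matrix.map_one _ (star_zero ℂ) (star_one ℂ), mul_one, one_mul, Matrix.smul_kronecker]

/-- `F_l` acts as `i^p μ₁ ⊗ F_l`. Moving `J₁` past the `2p` generators in `μ₁` costs `s₁^(2p) = 1`,
so the first factor contributes only `(-1)^p`, from conjugating `i^p`. -/
lemma kronecker_antilinear_inr (h₁ : ∀ t, J₁ * (c₁.gen t).map star = s₁ • (c₁.gen t * J₁))
    (hs : s₁ ^ 2 = 1) (h₂ : ∀ l, J₂ * (c₂.gen l).map star = s₂ • (c₂.gen l * J₂)) (l : κ₂) :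
    (J₁ ⊗ₖ J₂) * ((c₁.prod c₂).gen (Sum.inr l)).map star
      = ((-1) ^ p * s₂) • ((c₁.prod c₂).gen (Sum.inr l) * (J₁ ⊗ₖ J₂)) := by
  have hv : J₁ * (Complex.I ^ p • c₁.vol).map star
      = ((-1 : ℂ) ^ p) • ((Complex.I ^ p • c₁.vol) * J₁) := by
    have e : (Complex.I ^ p • c₁.vol).map star
        = ((-1 : ℂ) ^ p * Complex.I ^ p) • c₁.vol.map star := by
      ext i j
      simp [← mul_pow]
    rw [e, mul_smul_comm, CliffordRep.vol, mul_list_prod_map_star J₁ s₁, List.length_ofFn, pow_mul,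
      hs, one_pow, one_smul, smul_mul_assoc, smul_smul]
    intro A hA
    obtain ⟨t, rfl⟩ := List.mem_ofFn.1 hA
    exact h₁ t
  simp only [CliffordRep.prod, Sum.elim_inr]
  rw [kronecker_map_star, ← Matrix.mul_kronecker_mul, ← Matrix.mul_kronecker_mul, hv, h₂,
    Matrix.smul_kronecker, Matrix.kronecker_smul, smul_smul]

variable {k : ℕ} {c₂' : CliffordRep (Fin k) ι₂}

lemma muOne_eq : muOne c₁ c₂'
    = (((List.finRange (2 * p)).map Sum.inl).map (c₁.prod c₂').gen).prod := by
  rw [muOne, List.ofFn_eq_map, List.map_map]; rfl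

lemma muTwo_eq : muTwo c₁ c₂'
    = (((List.finRange k).map Sum.inr).map (c₁.prod c₂').gen).prod := by
  rw [muTwo, List.ofFn_eq_map, List.map_map]; rfl

/-- Among the `2p` factors of `μ₁` one is `E_t` itself, leaving an odd number of sign changes; for
`F_l` below all `2p` count. -/
lemma gen_inl_mul_muOne (t : Fin (2 * p)) :
    (c₁.prod c₂').gen (Sum.inl t) * muOne c₁ c₂'
      = -(muOne c₁ c₂' * (c₁.prod c₂').gen (Sum.inl t)) := by
  rw [muOne_eq, CliffordRep.gen_mul_list _ _ _
    ((List.nodup_finRange _).map Sum.inl_injective)]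
  simp

lemma gen_inr_mul_muOne (l : Fin k) :
    (c₁.prod c₂').gen (Sum.inr l) * muOne c₁ c₂'
      = muOne c₁ c₂' * (c₁.prod c₂').gen (Sum.inr l) := by
  rw [muOne_eq, CliffordRep.gen_mul_list _ _ _
    ((List.nodup_finRange _).map Sum.inl_injective)]
  simp

/-- `E_t` passes `k` factors, all different from it, and `F_l` only `k - 1`. For odd `k` these are
the same signs as for `μ₁`, so the two volume forms can be treated together. -/
lemma gen_inl_mul_muTwo (hk : Odd k) (t : Fin (2 * p)) :
    (c₁.prod c₂').gen (Sum.inl t) * muTwo c₁ c₂'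
      = -(muTwo c₁ c₂' * (c₁.prod c₂').gen (Sum.inl t)) := by
  rw [muTwo_eq, CliffordRep.gen_mul_list _ _ _
    ((List.nodup_finRange _).map Sum.inr_injective)]
  simp [hk.neg_one_pow]

lemma gen_inr_mul_muTwo (hk : Odd k) (l : Fin k) :
    (c₁.prod c₂').gen (Sum.inr l) * muTwo c₁ c₂'
      = muTwo c₁ c₂' * (c₁.prod c₂').gen (Sum.inr l) := by
  rw [muTwo_eq, CliffordRep.gen_mul_list _ _ _
    ((List.nodup_finRange _).map Sum.inr_injective)]
  simp [hk.neg_one_pow]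

end ProductAlgebra

/-- If an antilinear map anticommutes with the generators, it intertwines the actions
of `g` and of its conjugate. -/
lemma antilinear_rep {κ ι : Type*} [Fintype κ] [DecidableEq κ] [Fintype ι] [DecidableEq ι]
    {c : CliffordRep κ ι} {B : Matrix ι ι ℂ} (hB : ∀ a, B * (c.gen a).map star = -(c.gen a * B))
    (g : SpinC κ) (φ : ι → ℂ) :
    antilinear B (SpinC.rep c g *ᵥ φ) = SpinC.rep c (SpinC.conj g) *ᵥ antilinear B φ := by
  have hι : ∀ v, B * (c.rho (CliffordAlgebra.ι _ v)).map star
      = -(c.rho (CliffordAlgebra.ι _ v) * B) := by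
    intro v
    rw [CliffordRep.rho_iota]
    have e : (∑ a, v a • c.gen a).map star = ∑ a, v a • (c.gen a).map star := by
      ext i j
      simp [Matrix.sum_apply]
    rw [e, Finset.mul_sum, Finset.sum_mul, ← Finset.sum_neg_distrib]
    refine Finset.sum_congr rfl fun a _ => ?_
    rw [mul_smul_comm, hB, smul_mul_assoc, smul_neg]
  -- Even elements are built from products of two vectors, on which the two minus signs cancel.
  have heven : ∀ x ∈ CliffordAlgebra.evenOdd (negSq κ) 0,
      B * (c.rho x).map star = c.rho x * B := by
    refine CliffordAlgebra.even_induction (Q := negSq κ)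
      (motive := fun x _ => B * (c.rho x).map star = c.rho x * B)
      (fun r => ?_) (fun x y hx hy ihx ihy => ?_) (fun m₁ m₂ x hx ih => ?_)
    · rw [AlgHom.commutes, Algebra.algebraMap_eq_smul_one]
      have : (r • (1 : Matrix ι ι ℂ)).map star = r • 1 := by
        ext i j
        by_cases h : i = j <;> simp [h]
      rw [this, mul_smul_comm, smul_mul_assoc, one_mul, mul_one]
    · have : (c.rho x + c.rho y).map star = (c.rho x).map star + (c.rho y).map star := by
        ext i j; simp
      rw [map_add, this, mul_add, ihx, ihy, add_mul]
    · rw [map_mul, map_mul, map_star_mul, map_star_mul, ← mul_assoc, ← mul_assoc, hι, neg_mul,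
        mul_assoc (c.rho _) B, hι, mul_neg, neg_neg, mul_assoc, mul_assoc, mul_assoc, ih]
      simp only [mul_assoc]
  obtain ⟨f, h, rfl⟩ := SpinC.exists_mk g
  change B *ᵥ star (SpinC.rep c _ *ᵥ φ) = SpinC.rep c _ *ᵥ (B *ᵥ star φ)
  rw [SpinC.conj_mk, SpinC.rep_mk, SpinC.rep_mk, Matrix.smul_mulVec, star_smul, Matrix.mulVec_smul,
    star_mulVec_eq, Matrix.mulVec_mulVec, heven _ (spinGroup.mem_even f.2), Circle.coe_inv_eq_conj,
    ← Matrix.mulVec_mulVec, Matrix.smul_mulVec]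
  rfl

/-! ### Antilinear maps, sections, spinor derivatives and Dirac operators. -/

section Geometry

variable {E H M : Type*} [NormedAddCommGroup E] [NormedSpace ℝ E] [TopologicalSpace H]
  {I : ModelWithCorners ℝ E H} [TopologicalSpace M] [ChartedSpace H M]

lemma dirDeriv_clm_comp {F F' : Type*} [NormedAddCommGroup F] [NormedSpace ℝ F]
    [NormedAddCommGroup F'] [NormedSpace ℝ F'] (L : F →L[ℝ] F') {f : M → F} {x : M}
    (hf : MDifferentiableAt I 𝓘(ℝ, F) f x) (v : TangentSpace I x) :
    dirDeriv (fun y => L (f y)) x v = L (dirDeriv f x v) := by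
  have h : HasMFDerivAt I 𝓘(ℝ, F') (L ∘ f) x (L.comp (mfderiv I 𝓘(ℝ, F) f x)) :=
    HasMFDerivAt.comp x L.hasFDerivAt.hasMFDerivAt hf.hasMFDerivAt
  exact congrArg (fun D => D v) h.mfderiv

lemma mdifferentiableAt_clm_comp {F F' : Type*} [NormedAddCommGroup F] [NormedSpace ℝ F]
    [NormedAddCommGroup F'] [NormedSpace ℝ F'] (L : F →L[ℝ] F') {f : M → F} {x : M}
    (hf : MDifferentiableAt I 𝓘(ℝ, F) f x) :
    MDifferentiableAt I 𝓘(ℝ, F') (fun y => L (f y)) x :=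
  (HasMFDerivAt.comp x L.hasFDerivAt.hasMFDerivAt hf.hasMFDerivAt).mdifferentiableAt

/-- The real-linear operator `φ ↦ B φ̄`. -/
def antilinearCLM {ι : Type*} [Fintype ι] (B : Matrix ι ι ℂ) : (ι → ℂ) →L[ℝ] (ι → ℂ) :=
  LinearMap.toContinuousLinearMap
    { toFun := antilinear B
      map_add' := map_add _
      map_smul' := fun r φ => by
        have := (antilinear B).map_smulₛₗ (r : ℂ) φ
        simpa using this }

lemma antilinear_gen {κ ι : Type*} [DecidableEq κ] [Fintype ι] [DecidableEq ι]
    {c : CliffordRep κ ι} {B : Matrix ι ι ℂ} (hB : ∀ a, B * (c.gen a).map star = -(c.gen a * B))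
    (a : κ) (φ : ι → ℂ) : antilinear B (c.gen a *ᵥ φ) = -(c.gen a *ᵥ antilinear B φ) := by
  change B *ᵥ star (_ *ᵥ φ) = -(c.gen a *ᵥ (B *ᵥ star φ))
  rw [star_mulVec_eq, Matrix.mulVec_mulVec, hB, Matrix.neg_mulVec, Matrix.mulVec_mulVec]

variable [IsManifold I 1 M]

namespace SpinCStructure

variable {g : MetricField I M} {κ ι J : Type*} [Fintype κ] [DecidableEq κ]
    [Fintype ι] [DecidableEq ι] {c : CliffordRep κ ι}

lemma IsSection.mdifferentiableAt {S : SpinCStructure g c J} {ψ : J → M → ι → ℂ}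
    (hψ : S.IsSection ψ) {i : J} {x : M} (hx : x ∈ S.U i) :
    MDifferentiableAt I 𝓘(ℝ, ι → ℂ) (ψ i) x :=
  ((hψ.1 i).contMDiffAt ((S.isOpen_U i).mem_nhds hx)).mdifferentiableAt (by simp)

lemma isSection_antilinear {S : SpinCStructure g c J} {B : Matrix ι ι ℂ}
    (hB : ∀ a, B * (c.gen a).map star = -(c.gen a * B)) {ψ : J → M → ι → ℂ}
    (hψ : S.IsSection ψ) : S.conj.IsSection (act (antilinear B) ψ) := by
  refine ⟨fun i => ?_, fun i j x hx => ?_⟩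
  · exact (antilinearCLM B).contDiff.contMDiff.comp_contMDiffOn (hψ.1 i)
  · change antilinear B (ψ i x) = SpinC.rep c (SpinC.conj _) *ᵥ antilinear B (ψ j x)
    rw [hψ.2 i j x hx, antilinear_rep hB]

/-- `B` is constant in the trivialization and real-linear, so it passes the derivative. The `e_b
e_d` commute with it, their coefficients are real, and `√-1 A` is conjugated to `-√-1 A`. -/
lemma nabla_antilinear {S : SpinCStructure g c J} (A : S.Connection) {B : Matrix ι ι ℂ}
    (hB : ∀ a, B * (c.gen a).map star = -(c.gen a * B)) {ψ : J → M → ι → ℂ}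
    (hψ : S.IsSection ψ) (a : κ) {i : J} {x : M} (hx : x ∈ S.U i) :
    S.conj.nabla A.neg a (act (antilinear B) ψ) i x = antilinear B (S.nabla A a ψ i x) := by
  have h1 := dirDeriv_clm_comp (antilinearCLM B) (hψ.mdifferentiableAt hx) (S.frame i a x)
  have h2 : ∀ b d φ, antilinear B ((c.gen b * c.gen d) *ᵥ φ)
      = (c.gen b * c.gen d) *ᵥ antilinear B φ := by
    intro b d φ
    rw [← Matrix.mulVec_mulVec, ← Matrix.mulVec_mulVec, antilinear_gen hB, antilinear_gen hB,
      Matrix.mulVec_neg, neg_neg]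
  have h3 : antilinear B ((Complex.I * (A.form i x (S.frame i a x) : ℂ)) • ψ i x)
      = (Complex.I * ((-A.form i x (S.frame i a x) : ℝ) : ℂ)) • antilinear B (ψ i x) := by
    rw [LinearMap.map_smulₛₗ]
    congr 1
    simp
  unfold nabla
  rw [map_add, LinearMap.map_smulₛₗ, map_add, h3, LinearMap.map_smulₛₗ, map_sum]
  simp only [map_sum, LinearMap.map_smulₛₗ, h2, Complex.conj_ofReal]
  have e : (starRingEnd ℂ) (1 / 2 : ℂ) = 1 / 2 := by simp [map_ofNat]
  rw [e]
  congr 1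

/-- An antilinear map of the spinor module anticommuting with Clifford multiplication by vectors
anticommutes with the Dirac operators. -/
lemma dirac_antilinear {S : SpinCStructure g c J} (A : S.Connection) {B : Matrix ι ι ℂ}
    (hB : ∀ a, B * (c.gen a).map star = -(c.gen a * B)) {ψ : J → M → ι → ℂ}
    (hψ : S.IsSection ψ) :
    S.conj.Same (S.conj.dirac A.neg (act (antilinear B) ψ))
      (-act (antilinear B) (S.dirac A ψ)) := by
  intro i x hx
  change ∑ a, c.gen a *ᵥ S.conj.nabla A.neg a (act (antilinear B) ψ) i x
    = -antilinear B (∑ a, c.gen a *ᵥ S.nabla A a ψ i x)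
  rw [map_sum, ← Finset.sum_neg_distrib]
  refine Finset.sum_congr rfl fun a _ => ?_
  rw [nabla_antilinear A hB hψ a hx, antilinear_gen hB, neg_neg]

end SpinCStructure

lemma act_mulVec_act_antilinear {J M ι : Type*} [Fintype ι] (μ B : Matrix ι ι ℂ)
    (ψ : J → M → ι → ℂ) :
    act μ.mulVec (act (antilinear B) ψ) = act (antilinear (μ * B)) ψ := by
  funext i x
  exact Matrix.mulVec_mulVec _ _ _

end Geometry

/-! ### Derivatives along the two factors of a product manifold. -/

section ProductCalculus

variable {E₁ H₁ M₁ E₂ H₂ M₂ F : Type*}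
  [NormedAddCommGroup E₁] [NormedSpace ℝ E₁] [TopologicalSpace H₁]
  {I₁ : ModelWithCorners ℝ E₁ H₁} [TopologicalSpace M₁] [ChartedSpace H₁ M₁]
  [NormedAddCommGroup E₂] [NormedSpace ℝ E₂] [TopologicalSpace H₂]
  {I₂ : ModelWithCorners ℝ E₂ H₂} [TopologicalSpace M₂] [ChartedSpace H₂ M₂]
  [NormedAddCommGroup F] [NormedSpace ℝ F]

lemma dirDeriv_congr_of_eventuallyEq {f h : M₁ → F} {x : M₁} (e : f =ᶠ[nhds x] h)
    (v : TangentSpace I₁ x) : dirDeriv f x v = dirDeriv h x v := by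
  exact congrArg (fun D : E₁ →L[ℝ] F => D v) (e.mfderiv_eq (I := I₁) (I' := 𝓘(ℝ, F)))

/-- The derivative along the first factor is the derivative of the restriction to a slice. -/
lemma dirDeriv_tangentPair_fst {h : M₁ × M₂ → F} {x : M₁ × M₂}
    (hh : MDifferentiableAt (I₁.prod I₂) 𝓘(ℝ, F) h x) (v : TangentSpace I₁ x.1) :
    dirDeriv h x (tangentPair v (0 : TangentSpace I₂ x.2))
      = dirDeriv (fun y => h (y, x.2)) x.1 v := by
  have h1 := HasMFDerivAt.comp (I := I₁) (f := fun y : M₁ => (y, x.2)) x.1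
    (g := h) hh.hasMFDerivAt
    ((mdifferentiableAt_id.prodMk mdifferentiableAt_const).hasMFDerivAt.congr_mfderiv
      mfderiv_prod_left)
  exact (congrArg (fun D : E₁ →L[ℝ] F => D v) h1.mfderiv).symm

/-- The derivative along the second factor is the derivative of the restriction to a slice. -/
lemma dirDeriv_tangentPair_snd {h : M₁ × M₂ → F} {x : M₁ × M₂}
    (hh : MDifferentiableAt (I₁.prod I₂) 𝓘(ℝ, F) h x) (w : TangentSpace I₂ x.2) :
    dirDeriv h x (tangentPair (0 : TangentSpace I₁ x.1) w)
      = dirDeriv (fun y => h (x.1, y)) x.2 w := by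
  have h1 := HasMFDerivAt.comp (I := I₂) (f := fun y : M₂ => (x.1, y)) x.2
    (g := h) hh.hasMFDerivAt
    ((mdifferentiableAt_const.prodMk mdifferentiableAt_id).hasMFDerivAt.congr_mfderiv
      mfderiv_prod_right)
  exact (congrArg (fun D : E₂ →L[ℝ] F => D w) h1.mfderiv).symm

lemma two_le_infty : (2 : WithTop ℕ∞) ≤ ∞ :=
  WithTop.coe_le_coe.2 le_top

variable [I₁.Boundaryless] [I₂.Boundaryless]

/-- A function in the charts at `x`. -/
def inCharts (I₁ : ModelWithCorners ℝ E₁ H₁) (I₂ : ModelWithCorners ℝ E₂ H₂)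
    (f : M₁ × M₂ → F) (x : M₁ × M₂) : E₁ × E₂ → F :=
  fun z => f ((extChartAt I₁ x.1).symm z.1, (extChartAt I₂ x.2).symm z.2)

lemma contDiffAt_inCharts {f : M₁ × M₂ → F} {x : M₁ × M₂}
    (hf : ContMDiffAt (I₁.prod I₂) 𝓘(ℝ, F) ∞ f x) {z : E₁ × E₂}
    (hz : z = (extChartAt I₁ x.1 x.1, extChartAt I₂ x.2 x.2)) :
    ContDiffAt ℝ ∞ (inCharts I₁ I₂ f x) z := by
  subst hz
  have := (contMDiffAt_iff (I := I₁.prod I₂) (I' := 𝓘(ℝ, F)) ).1 hf |>.2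
  simp only [extChartAt_prod, ModelWithCorners.range_eq_univ, contDiffWithinAt_univ] at this
  exact this

/-- The chain rule for `f = inCharts f ∘ (chart × chart)`, which holds near `x`. The charts stay
fixed at `x` while `y` varies, so that the formula can be differentiated again. -/
lemma dirDeriv_eq_fderiv_inCharts [IsManifold I₁ ∞ M₁] [IsManifold I₂ ∞ M₂] {f : M₁ × M₂ → F} {x : M₁ × M₂}
    (hf : ContMDiffAt (I₁.prod I₂) 𝓘(ℝ, F) ∞ f x) :
    ∀ᶠ y : M₁ × M₂ in nhds x, ∀ (v : TangentSpace I₁ y.1) (w : TangentSpace I₂ y.2),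
      dirDeriv f y (tangentPair v w)
        = fderiv ℝ (inCharts I₁ I₂ f x) (extChartAt I₁ x.1 y.1, extChartAt I₂ x.2 y.2)
          (mfderiv I₁ 𝓘(ℝ, E₁) (extChartAt I₁ x.1) y.1 v,
            mfderiv I₂ 𝓘(ℝ, E₂) (extChartAt I₂ x.2) y.2 w) := by
  have hF := contDiffAt_inCharts hf rfl
  have hc : ContinuousAt (fun y : M₁ × M₂ => (extChartAt I₁ x.1 y.1, extChartAt I₂ x.2 y.2)) x :=
    ((continuousAt_extChartAt x.1).comp continuousAt_fst).prodMk
      ((continuousAt_extChartAt x.2).comp continuousAt_snd)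
  have h1 : ∀ᶠ z in nhds (extChartAt I₁ x.1 x.1, extChartAt I₂ x.2 x.2),
      DifferentiableAt ℝ (inCharts I₁ I₂ f x) z := by
    filter_upwards [(hF.of_le (m := 1) (by simp)).eventually (by simp)] with z hz
    exact hz.differentiableAt (by simp)
  have hs : ∀ᶠ y in nhds x, y ∈ (chartAt H₁ x.1).source ×ˢ (chartAt H₂ x.2).source :=
    (((chartAt H₁ x.1).open_source.prod (chartAt H₂ x.2).open_source)).mem_nhds
      ⟨mem_chart_source _ _, mem_chart_source _ _⟩
  filter_upwards [hc.eventually h1, hs.eventually_nhds] with y hy hys v w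
  have hm := hys.self_of_nhds
  have e : f =ᶠ[nhds y] inCharts I₁ I₂ f x ∘
      Prod.map (extChartAt I₁ x.1) (extChartAt I₂ x.2) := by
    filter_upwards [hys] with z hz
    have e1 := (extChartAt I₁ x.1).left_inv (by rw [extChartAt_source]; exact hz.1)
    have e2 := (extChartAt I₂ x.2).left_inv (by rw [extChartAt_source]; exact hz.2)
    change f z = f (_, _)
    rw [Prod.map_fst, Prod.map_snd, e1, e2]
  have d1 := hasMFDerivAt_extChartAt (I := I₁) (x := x.1) hm.1
  have d2 := hasMFDerivAt_extChartAt (I := I₂) (x := x.2) hm.2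
  have d3 := d1.prodMap d2
  have d4 : HasMFDerivAt 𝓘(ℝ, E₁ × E₂) 𝓘(ℝ, F) (inCharts I₁ I₂ f x)
    (Prod.map (extChartAt I₁ x.1) (extChartAt I₂ x.2) y) _ := hy.hasFDerivAt.hasMFDerivAt
  -- The product of the model structures on `E₁` and `E₂` is identified with the model structure on
  -- `E₁ × E₂`, so that the chain rule applies.
  rw [← modelWithCornersSelf_prod, chartedSpaceSelf_prod] at d3
  rw [dirDeriv_congr_of_eventuallyEq e]
  have d5 := d4.comp y d3
  exact (congrArg (fun D : E₁ × E₂ →L[ℝ] F => D (v, w)) d5.mfderiv)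

/-- Derivatives along vector fields of the two factors commute. -/
lemma dirDeriv_dirDeriv_comm [IsManifold I₁ ∞ M₁] [IsManifold I₂ ∞ M₂] {f : M₁ × M₂ → F}
    {x : M₁ × M₂} (hf : ContMDiffAt (I₁.prod I₂) 𝓘(ℝ, F) ∞ f x)
    (X : (y : M₁) → TangentSpace I₁ y) (Y : (y : M₂) → TangentSpace I₂ y)
    (hX : MDifferentiableAt (I₁.prod I₂) 𝓘(ℝ, F)
      (fun y => dirDeriv f y (tangentPair (X y.1) (0 : TangentSpace I₂ y.2))) x)
    (hY : MDifferentiableAt (I₁.prod I₂) 𝓘(ℝ, F)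
      (fun y => dirDeriv f y (tangentPair (0 : TangentSpace I₁ y.1) (Y y.2))) x) :
    dirDeriv (fun y => dirDeriv f y (tangentPair (X y.1) (0 : TangentSpace I₂ y.2))) x
        (tangentPair (0 : TangentSpace I₁ x.1) (Y x.2))
      = dirDeriv (fun y => dirDeriv f y (tangentPair (0 : TangentSpace I₁ y.1) (Y y.2))) x
        (tangentPair (X x.1) (0 : TangentSpace I₂ x.2)) := by
  have hF := contDiffAt_inCharts hf rfl
  have hev := dirDeriv_eq_fderiv_inCharts hf
  set G := inCharts I₁ I₂ f x
  set a := extChartAt I₁ x.1 x.1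
  set b := extChartAt I₂ x.2 x.2
  have hG : HasFDerivAt (fderiv ℝ G) (fderiv ℝ (fderiv ℝ G) (a, b)) (a, b) :=
    ((hF.fderiv_right (m := 1) (one_add_one_eq_two.trans_le two_le_infty)).differentiableAt (by simp)).hasFDerivAt
  have hsymm : IsSymmSndFDerivAt ℝ G (a, b) := hF.isSymmSndFDerivAt (by simpa using two_le_infty)
  have d1 := hasMFDerivAt_extChartAt (I := I₁) (mem_chart_source H₁ x.1)
  have d2 := hasMFDerivAt_extChartAt (I := I₂) (mem_chart_source H₂ x.2)
  set ξ : E₁ := mfderiv I₁ 𝓘(ℝ, E₁) (extChartAt I₁ x.1) x.1 (X x.1) with hξ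
  set η : E₂ := mfderiv I₂ 𝓘(ℝ, E₂) (extChartAt I₂ x.2) x.2 (Y x.2) with hη
  have c1 : ContinuousAt (fun y : M₁ => (y, x.2)) x.1 := by fun_prop
  have c2 : ContinuousAt (fun y : M₂ => (x.1, y)) x.2 := by fun_prop
  -- On a slice of the first factor the field `Y` is frozen at `Y x.2`, with chart components `η`.
  -- Only `G` is differentiated again, so no derivatives of `X` and `Y` appear.
  have k1 : HasFDerivAt (fun u : E₁ => fderiv ℝ G (u, b) (0, η))
      ((ContinuousLinearMap.apply ℝ F ((0, η) : E₁ × E₂)).comp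
        ((fderiv ℝ (fderiv ℝ G) (a, b)).comp (ContinuousLinearMap.inl ℝ E₁ E₂))) a :=
    (ContinuousLinearMap.apply ℝ F ((0, η) : E₁ × E₂)).hasFDerivAt.comp a
      (HasFDerivAt.comp a hG (hasFDerivAt_prodMk_left a b))
  have k2 : HasFDerivAt (fun u : E₂ => fderiv ℝ G (a, u) (ξ, 0))
      ((ContinuousLinearMap.apply ℝ F ((ξ, 0) : E₁ × E₂)).comp
        ((fderiv ℝ (fderiv ℝ G) (a, b)).comp (ContinuousLinearMap.inr ℝ E₁ E₂))) b :=
    (ContinuousLinearMap.apply ℝ F ((ξ, 0) : E₁ × E₂)).hasFDerivAt.comp b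
      (HasFDerivAt.comp b hG (hasFDerivAt_prodMk_right a b))
  have m1 := HasMFDerivAt.comp (I := I₁) x.1 k1.hasMFDerivAt d1.mdifferentiableAt.hasMFDerivAt
  have m2 := HasMFDerivAt.comp (I := I₂) x.2 k2.hasMFDerivAt d2.mdifferentiableAt.hasMFDerivAt
  have e1 : (fun y : M₁ => dirDeriv f (y, x.2) (tangentPair (0 : TangentSpace I₁ y) (Y x.2)))
      =ᶠ[nhds x.1] (fun u : E₁ => fderiv ℝ G (u, b) (0, η)) ∘ extChartAt I₁ x.1 := by
    filter_upwards [c1.eventually hev] with y hy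
    refine (hy _ _).trans ?_
    rw [map_zero]
    rfl
  have e2 : (fun y : M₂ => dirDeriv f (x.1, y) (tangentPair (X x.1) (0 : TangentSpace I₂ y)))
      =ᶠ[nhds x.2] (fun u : E₂ => fderiv ℝ G (a, u) (ξ, 0)) ∘ extChartAt I₂ x.2 := by
    filter_upwards [c2.eventually hev] with y hy
    refine (hy _ _).trans ?_
    rw [map_zero]
    rfl
  rw [dirDeriv_tangentPair_snd hX, dirDeriv_tangentPair_fst hY, dirDeriv_congr_of_eventuallyEq e1,
    dirDeriv_congr_of_eventuallyEq e2]
  have r1 := congrArg (fun D : E₁ →L[ℝ] F => D (X x.1)) m1.mfderiv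
  have r2 := congrArg (fun D : E₂ →L[ℝ] F => D (Y x.2)) m2.mfderiv
  refine r2.trans (Eq.trans ?_ r1.symm)
  -- Both sides are now the second derivative of `G` on `(ξ, 0)` and `(0, η)`, in opposite orders.
  change fderiv ℝ (fderiv ℝ G) (a, b) (0, η) (ξ, 0) = fderiv ℝ (fderiv ℝ G) (a, b) (ξ, 0) (0, η)
  exact hsymm.eq _ _

end ProductCalculus

/-! ### The Lie bracket on a product manifold. -/

section ProductBracket

variable {E₁ H₁ M₁ E₂ H₂ M₂ : Type*}
  [NormedAddCommGroup E₁] [NormedSpace ℝ E₁] [TopologicalSpace H₁]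
  {I₁ : ModelWithCorners ℝ E₁ H₁} [TopologicalSpace M₁] [ChartedSpace H₁ M₁]
  [NormedAddCommGroup E₂] [NormedSpace ℝ E₂] [TopologicalSpace H₂]
  {I₂ : ModelWithCorners ℝ E₂ H₂} [TopologicalSpace M₂] [ChartedSpace H₂ M₂]
  [I₁.Boundaryless] [I₂.Boundaryless] [IsManifold I₁ ∞ M₁] [IsManifold I₂ ∞ M₂]

lemma inverse_prodMap_apply {A : E₁ →L[ℝ] E₁} {B : E₂ →L[ℝ] E₂} (hA : A.IsInvertible)
    (hB : B.IsInvertible) (v : E₁) (w : E₂) :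
    (A.prodMap B).inverse (v, w) = (A.inverse v, B.inverse w) := by
  obtain ⟨A, rfl⟩ := hA
  obtain ⟨B, rfl⟩ := hB
  have e : (A : E₁ →L[ℝ] E₁).prodMap (B : E₂ →L[ℝ] E₂)
    = (A.prodCongr B : E₁ × E₂ →L[ℝ] E₁ × E₂) := rfl
  rw [e, ContinuousLinearMap.inverse_equiv, ContinuousLinearMap.inverse_equiv,
    ContinuousLinearMap.inverse_equiv]
  rfl

/-- The bracket on a manifold is the chart bracket pulled back by the inverse of the chart
derivative; moving that inverse across gives this form. Without boundary the range of the model is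
the whole space, so the restrictions to it drop out. -/
lemma mlieBracket_eq_lieBracket (X Y : (y : M₁) → TangentSpace I₁ y) (x : M₁) :
    mfderiv I₁ 𝓘(ℝ, E₁) (extChartAt I₁ x) x (VectorField.mlieBracket I₁ X Y x)
      = VectorField.lieBracket ℝ
        (VectorField.mpullback 𝓘(ℝ, E₁) I₁ (extChartAt I₁ x).symm X)
        (VectorField.mpullback 𝓘(ℝ, E₁) I₁ (extChartAt I₁ x).symm Y) (extChartAt I₁ x x) := by
  rw [← VectorField.mlieBracketWithin_univ, VectorField.mlieBracketWithin_apply]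
  simp only [ModelWithCorners.range_eq_univ, VectorField.mpullbackWithin_univ, Set.preimage_univ,
    Set.univ_inter]
  exact ((isInvertible_mfderiv_extChartAt (I := I₁)
    (mem_extChartAt_source x)).inverse_apply_eq.1 rfl).symm.trans
      (congrFun (VectorField.lieBracketWithin_univ (E := E₁)) _)

/-- The product chart has a block diagonal derivative, whose inverse is again block diagonal. -/
lemma mpullback_tangentPair (X : (y : M₁) → TangentSpace I₁ y) (Z : (y : M₂) → TangentSpace I₂ y)
    (x : M₁ × M₂) {z : E₁ × E₂} (h₁ : z.1 ∈ (extChartAt I₁ x.1).target)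
    (h₂ : z.2 ∈ (extChartAt I₂ x.2).target) :
    VectorField.mpullback 𝓘(ℝ, E₁ × E₂) (I₁.prod I₂) (extChartAt (I₁.prod I₂) x).symm
        (fun y => tangentPair (X y.1) (Z y.2)) z
      = (VectorField.mpullback 𝓘(ℝ, E₁) I₁ (extChartAt I₁ x.1).symm X z.1,
        VectorField.mpullback 𝓘(ℝ, E₂) I₂ (extChartAt I₂ x.2).symm Z z.2) := by
  have i₁ := isInvertible_mfderivWithin_extChartAt_symm h₁
  have i₂ := isInvertible_mfderivWithin_extChartAt_symm h₂
  rw [ModelWithCorners.range_eq_univ, mfderivWithin_univ] at i₁ i₂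
  have d₁ : MDifferentiableAt 𝓘(ℝ, E₁) I₁ (extChartAt I₁ x.1).symm z.1 := by
    have := mdifferentiableWithinAt_extChartAt_symm h₁
    rwa [ModelWithCorners.range_eq_univ, mdifferentiableWithinAt_univ] at this
  have d₂ : MDifferentiableAt 𝓘(ℝ, E₂) I₂ (extChartAt I₂ x.2).symm z.2 := by
    have := mdifferentiableWithinAt_extChartAt_symm h₂
    rwa [ModelWithCorners.range_eq_univ, mdifferentiableWithinAt_univ] at this
  have e : ((extChartAt (I₁.prod I₂) x).symm : E₁ × E₂ → M₁ × M₂)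
      = Prod.map (extChartAt I₁ x.1).symm (extChartAt I₂ x.2).symm := by
    rw [extChartAt_prod]; rfl
  have d := d₁.hasMFDerivAt.prodMap d₂.hasMFDerivAt
  have d' := (d.congr_of_eventuallyEq (Filter.EventuallyEq.of_eq e)).mfderiv
  rw [← modelWithCornersSelf_prod, chartedSpaceSelf_prod] at d'
  refine Eq.trans (congrArg₂ (fun (D : E₁ × E₂ →L[ℝ] E₁ × E₂) (v : E₁ × E₂) => D.inverse v) d'
    (congrArg (fun y : M₁ × M₂ => ((X y.1, Z y.2) : E₁ × E₂)) (congrFun e z))) ?_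
  exact inverse_prodMap_apply (E₁ := E₁) (E₂ := E₂) i₁ i₂ _ _

/-- The Lie bracket on a product manifold is computed componentwise. -/
lemma mlieBracket_tangentPair [CompleteSpace E₁] [CompleteSpace E₂]
    {X Y : (y : M₁) → TangentSpace I₁ y} {Z W : (y : M₂) → TangentSpace I₂ y} {x : M₁ × M₂}
    (hX : MDifferentiableAt I₁ I₁.tangent (fun y => (⟨y, X y⟩ : TangentBundle I₁ M₁)) x.1)
    (hY : MDifferentiableAt I₁ I₁.tangent (fun y => (⟨y, Y y⟩ : TangentBundle I₁ M₁)) x.1)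
    (hZ : MDifferentiableAt I₂ I₂.tangent (fun y => (⟨y, Z y⟩ : TangentBundle I₂ M₂)) x.2)
    (hW : MDifferentiableAt I₂ I₂.tangent (fun y => (⟨y, W y⟩ : TangentBundle I₂ M₂)) x.2) :
    VectorField.mlieBracket (I₁.prod I₂) (fun y : M₁ × M₂ => tangentPair (X y.1) (Z y.2))
        (fun y => tangentPair (Y y.1) (W y.2)) x
      = tangentPair (VectorField.mlieBracket I₁ X Y x.1) (VectorField.mlieBracket I₂ Z W x.2) := by
  have diff₁ : ∀ {X : (y : M₁) → TangentSpace I₁ y},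
      MDifferentiableAt I₁ I₁.tangent (fun y => (⟨y, X y⟩ : TangentBundle I₁ M₁)) x.1 →
      DifferentiableAt ℝ (VectorField.mpullback 𝓘(ℝ, E₁) I₁ (extChartAt I₁ x.1).symm X)
        (extChartAt I₁ x.1 x.1) := by
    intro X hX
    have : IsManifold I₁ 2 M₁ := IsManifold.of_le two_le_infty
    have := hX.mdifferentiableWithinAt.differentiableWithinAt_mpullbackWithin_vectorField
      (s := Set.univ)
    simp only [ModelWithCorners.range_eq_univ, VectorField.mpullbackWithin_univ,
      Set.preimage_univ, Set.univ_inter] at this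
    exact differentiableWithinAt_univ.1 this
  have diff₂ : ∀ {X : (y : M₂) → TangentSpace I₂ y},
      MDifferentiableAt I₂ I₂.tangent (fun y => (⟨y, X y⟩ : TangentBundle I₂ M₂)) x.2 →
      DifferentiableAt ℝ (VectorField.mpullback 𝓘(ℝ, E₂) I₂ (extChartAt I₂ x.2).symm X)
        (extChartAt I₂ x.2 x.2) := by
    intro X hX
    have : IsManifold I₂ 2 M₂ := IsManifold.of_le two_le_infty
    have := hX.mdifferentiableWithinAt.differentiableWithinAt_mpullbackWithin_vectorField
      (s := Set.univ)
    simp only [ModelWithCorners.range_eq_univ, VectorField.mpullbackWithin_univ,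
      Set.preimage_univ, Set.univ_inter] at this
    exact differentiableWithinAt_univ.1 this
  have ev : ∀ (X : (y : M₁) → TangentSpace I₁ y) (Z : (y : M₂) → TangentSpace I₂ y),
      VectorField.mpullback 𝓘(ℝ, E₁ × E₂) (I₁.prod I₂) (extChartAt (I₁.prod I₂) x).symm
        (fun y => tangentPair (X y.1) (Z y.2))
      =ᶠ[nhds (extChartAt I₁ x.1 x.1, extChartAt I₂ x.2 x.2)]
        Prod.map (VectorField.mpullback 𝓘(ℝ, E₁) I₁ (extChartAt I₁ x.1).symm X)
          (VectorField.mpullback 𝓘(ℝ, E₂) I₂ (extChartAt I₂ x.2).symm Z) := by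
    intro X Z
    filter_upwards [prod_mem_nhds (extChartAt_target_mem_nhds x.1)
      (extChartAt_target_mem_nhds x.2)] with z hz
    exact mpullback_tangentPair X Z x hz.1 hz.2
  have key := mlieBracket_eq_lieBracket (I₁ := I₁.prod I₂)
    (fun y : M₁ × M₂ => tangentPair (X y.1) (Z y.2)) (fun y => tangentPair (Y y.1) (W y.2)) x
  have hp : extChartAt (I₁.prod I₂) x x = (extChartAt I₁ x.1 x.1, extChartAt I₂ x.2 x.2) := by
    rw [extChartAt_prod]; rfl
  have hd₁ := (mdifferentiableAt_extChartAt (I := I₁)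
    (mem_chart_source H₁ x.1)).hasMFDerivAt.comp x (hasMFDerivAt_fst (I := I₁) (I' := I₂) x)
  have hd₂ := (mdifferentiableAt_extChartAt (I := I₂)
    (mem_chart_source H₂ x.2)).hasMFDerivAt.comp x (hasMFDerivAt_snd (I := I₁) (I' := I₂) x)
  have hd : HasMFDerivAt (I₁.prod I₂) 𝓘(ℝ, E₁ × E₂)
      (Prod.map (extChartAt I₁ x.1) (extChartAt I₂ x.2)) x _ :=
    ⟨hd₁.1.prodMk hd₂.1, hd₁.2.prodMk hd₂.2⟩
  have he : (extChartAt (I₁.prod I₂) x : M₁ × M₂ → E₁ × E₂)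
      = Prod.map (extChartAt I₁ x.1) (extChartAt I₂ x.2) := by
    rw [extChartAt_prod]; rfl
  have hd' := hd.congr_of_eventuallyEq (Filter.EventuallyEq.of_eq he)
  -- The chart derivative is invertible, so the two brackets may be compared after applying it, that
  -- is, inside the model space.
  have inj : Function.Injective (fun v : E₁ × E₂ =>
      ((mfderiv (I₁.prod I₂) 𝓘(ℝ, E₁ × E₂) (extChartAt (I₁.prod I₂) x) x) v : E₁ × E₂)) := by
    obtain ⟨A, hA⟩ := isInvertible_mfderiv_extChartAt (I := I₁.prod I₂) (mem_extChartAt_source x)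
    rw [← hA]
    exact A.injective
  refine inj (key.trans ?_)
  rw [hp, ((ev X Z).lieBracket_vectorField_eq (ev Y W))]
  have f₁ : ∀ (X : (y : M₁) → TangentSpace I₁ y) (Z : (y : M₂) → TangentSpace I₂ y), 
      MDifferentiableAt I₁ I₁.tangent (fun y => (⟨y, X y⟩ : TangentBundle I₁ M₁)) x.1 →
      MDifferentiableAt I₂ I₂.tangent (fun y => (⟨y, Z y⟩ : TangentBundle I₂ M₂)) x.2 → _ :=
    fun X Z hX hZ => ((diff₁ hX).hasFDerivAt.prodMap
      (extChartAt I₁ x.1 x.1, extChartAt I₂ x.2 x.2) (diff₂ hZ).hasFDerivAt).fderiv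
  -- In the model space each field is a `Prod.map`, so its derivative is block diagonal and the
  -- bracket splits.
  rw [VectorField.lieBracket, f₁ X Z hX hZ, f₁ Y W hY hW]
  refine Eq.trans ?_ (congrArg (fun D : E₁ × E₂ →L[ℝ] E₁ × E₂ =>
    D (VectorField.mlieBracket I₁ X Y x.1, VectorField.mlieBracket I₂ Z W x.2)) hd'.mfderiv).symm
  exact Prod.ext (mlieBracket_eq_lieBracket X Y x.1).symm (mlieBracket_eq_lieBracket Z W x.2).symm

end ProductBracket

/-! ### Smoothness of derivatives, and the spinor derivative as derivative plus matrix. -/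

section Smoothness

variable {E H M : Type*} [NormedAddCommGroup E] [NormedSpace ℝ E] [TopologicalSpace H]
  {I : ModelWithCorners ℝ E H} [TopologicalSpace M] [ChartedSpace H M]

/-- The derivative of a smooth function along a smooth vector field is smooth. -/
lemma contMDiffOn_dirDeriv [IsManifold I 1 M] {F : Type*} [NormedAddCommGroup F] [NormedSpace ℝ F]
    {f : M → F} {U : Set M} (hU : IsOpen U) (hf : ContMDiffOn I 𝓘(ℝ, F) ∞ f U)
    {X : (x : M) → TangentSpace I x}
    (hX : ContMDiffOn I I.tangent ∞ (fun x => (⟨x, X x⟩ : TangentBundle I M)) U) :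
    ContMDiffOn I 𝓘(ℝ, F) ∞ (fun x => dirDeriv f x (X x)) U := by
  have h1 := hf.contMDiffOn_tangentMapWithin (m := ∞) le_rfl hU.uniqueMDiffOn
  have h2 := (contMDiff_snd_tangentBundle_modelSpace (n := ∞) F 𝓘(ℝ, F)).comp_contMDiffOn
    (h1.comp hX fun x hx => hx)
  refine h2.congr fun x hx => ?_
  change mfderiv I 𝓘(ℝ, F) f x (X x) = mfderivWithin I 𝓘(ℝ, F) f U x (X x)
  rw [mfderivWithin_of_isOpen hU hx]

lemma contMDiffOn_mulVec {ι : Type*} [Fintype ι] {Γ : M → Matrix ι ι ℂ} {φ : M → ι → ℂ}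
    {U : Set M} (hΓ : ∀ a b, ContMDiffOn I 𝓘(ℝ, ℂ) ∞ (fun x => Γ x a b) U)
    (hφ : ContMDiffOn I 𝓘(ℝ, ι → ℂ) ∞ φ U) :
    ContMDiffOn I 𝓘(ℝ, ι → ℂ) ∞ (fun x => Γ x *ᵥ φ x) U := by
  rw [contMDiffOn_pi_space] at hφ ⊢
  intro a
  simp only [Matrix.mulVec, dotProduct]
  exact contMDiffOn_finsetSum fun b _ => contMDiffOn_mul' (hΓ a b) (hφ b)

/-- Constant matrices as real-linear maps. -/
def mulVecCLM {ι : Type*} [Fintype ι] (C : Matrix ι ι ℂ) : (ι → ℂ) →L[ℝ] (ι → ℂ) :=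
  LinearMap.toContinuousLinearMap (C.mulVecLin.restrictScalars ℝ)

lemma contMDiffOn_ofReal {f : M → ℝ} {U : Set M} (hf : ContMDiffOn I 𝓘(ℝ, ℝ) ∞ f U) :
    ContMDiffOn I 𝓘(ℝ, ℂ) ∞ (fun x => (f x : ℂ)) U :=
  Complex.ofRealCLM.contDiff.contMDiff.comp_contMDiffOn hf

lemma dirDeriv_add {F : Type*} [NormedAddCommGroup F] [NormedSpace ℝ F] {f h : M → F} {x : M}
    (hf : MDifferentiableAt I 𝓘(ℝ, F) f x) (hh : MDifferentiableAt I 𝓘(ℝ, F) h x)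
    (v : TangentSpace I x) :
    dirDeriv (fun y => f y + h y) x v = dirDeriv f x v + dirDeriv h x v :=
  congrArg (fun D : E →L[ℝ] F => D v) (hf.hasMFDerivAt.add hh.hasMFDerivAt).mfderiv

lemma dirDeriv_const {F : Type*} [NormedAddCommGroup F] [NormedSpace ℝ F] (k : F) (x : M)
    (v : TangentSpace I x) : dirDeriv (fun _ : M => k) x v = 0 :=
  congrArg (fun D : E →L[ℝ] F => D v) (mfderiv_const (I := I) (I' := 𝓘(ℝ, F)) (c := k) (x := x))

lemma mdifferentiableAt_sum_apply {ι J K : Type*} [Fintype ι] {i : J} {x : M} (s : Finset K)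
    {ψ : K → J → M → ι → ℂ} (hψ : ∀ k, MDifferentiableAt I 𝓘(ℝ, ι → ℂ) (ψ k i) x) :
    MDifferentiableAt I 𝓘(ℝ, ι → ℂ) ((∑ k ∈ s, ψ k) i) x := by
  classical
  induction s using Finset.induction_on with
  | empty => exact mdifferentiableAt_const (c := (0 : ι → ℂ))
  | insert k s hk ih =>
    rw [Finset.sum_insert hk]
    exact (hψ k).add ih

namespace SpinCStructure

variable [IsManifold I 1 M] {g : MetricField I M} {κ ι J : Type*} [Fintype κ] [DecidableEq κ]
    [Fintype ι] [DecidableEq ι] {c : CliffordRep κ ι}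

/-- The metric coefficients of an orthonormal frame are locally constant, so the derivative terms in
the Koszul formula vanish and only the brackets remain. -/
lemma leviCivita_frame (S : SpinCStructure g c J) {i : J} {x : M} (hx : x ∈ S.U i) (a b d : κ) :
    leviCivita g (S.frame i a) (S.frame i b) (S.frame i d) x
      = (1 / 2) * (g x (VectorField.mlieBracket I (S.frame i a) (S.frame i b) x) (S.frame i d x)
        - g x (VectorField.mlieBracket I (S.frame i a) (S.frame i d) x) (S.frame i b x)
        - g x (VectorField.mlieBracket I (S.frame i b) (S.frame i d) x) (S.frame i a x)) := by
  have h : ∀ a b (v : TangentSpace I x), dirDeriv (fun y => g y (S.frame i a y) (S.frame i b y)) x v = 0 := by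
    intro a b v
    have e : (fun y => g y (S.frame i a y) (S.frame i b y))
        =ᶠ[nhds x] fun _ => if a = b then 1 else 0 := by
      filter_upwards [(S.isOpen_U i).mem_nhds hx] with y hy
      exact S.orthonormal i y hy a b
    rw [dirDeriv_congr_of_eventuallyEq e, dirDeriv_const]
  rw [leviCivita, h, h, h]
  simp

/-- The zeroth order term of the spinor derivative in a trivialization. -/
def connMatrix (S : SpinCStructure g c J) (A : S.Connection) (i : J) (a : κ) (x : M) :
    Matrix ι ι ℂ :=
  (1 / 2 : ℂ) • ((Complex.I * (A.form i x (S.frame i a x) : ℂ)) • (1 : Matrix ι ι ℂ)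
    + (1 / 2 : ℂ) • ∑ b, ∑ d,
      (leviCivita g (S.frame i a) (S.frame i b) (S.frame i d) x : ℂ) • (c.gen b * c.gen d))

lemma nabla_eq (S : SpinCStructure g c J) (A : S.Connection) (a : κ) (ψ : J → M → ι → ℂ)
    (i : J) (x : M) :
    S.nabla A a ψ i x
      = dirDeriv (ψ i) x (S.frame i a x) + S.connMatrix A i a x *ᵥ ψ i x := by
  simp only [nabla, connMatrix, Matrix.smul_mulVec, Matrix.add_mulVec, Matrix.sum_mulVec,
    Matrix.one_mulVec]

lemma nabla_mulVec {S : SpinCStructure g c J} (A : S.Connection) {C : Matrix ι ι ℂ} {i : J}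
    {a : κ} {x : M} (hC : C * S.connMatrix A i a x = S.connMatrix A i a x * C)
    {ψ : J → M → ι → ℂ} (hψ : MDifferentiableAt I 𝓘(ℝ, ι → ℂ) (ψ i) x) :
    S.nabla A a (act C.mulVec ψ) i x = C *ᵥ S.nabla A a ψ i x := by
  rw [nabla_eq, nabla_eq, Matrix.mulVec_add, Matrix.mulVec_mulVec, hC, ← Matrix.mulVec_mulVec]
  congr 1
  exact dirDeriv_clm_comp (mulVecCLM C) hψ _

lemma nabla_add {S : SpinCStructure g c J} (A : S.Connection) {i : J} {a : κ} {x : M}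
    {ψ φ : J → M → ι → ℂ} (hψ : MDifferentiableAt I 𝓘(ℝ, ι → ℂ) (ψ i) x)
    (hφ : MDifferentiableAt I 𝓘(ℝ, ι → ℂ) (φ i) x) :
    S.nabla A a (ψ + φ) i x = S.nabla A a ψ i x + S.nabla A a φ i x := by
  rw [nabla_eq, nabla_eq, nabla_eq]
  have h : dirDeriv ((ψ + φ) i) x (S.frame i a x) = _ := dirDeriv_add hψ hφ (S.frame i a x)
  rw [h, Pi.add_apply, Pi.add_apply, Matrix.mulVec_add]
  abel

lemma nabla_zero {S : SpinCStructure g c J} (A : S.Connection) (i : J) (a : κ) (x : M) :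
    S.nabla A a (0 : J → M → ι → ℂ) i x = 0 := by
  rw [nabla_eq]
  have h : dirDeriv ((0 : J → M → ι → ℂ) i) x (S.frame i a x) = _ := dirDeriv_const 0 _ _
  rw [h]
  simp

lemma nabla_sum {S : SpinCStructure g c J} (A : S.Connection) {i : J} {a : κ} {x : M}
    {K : Type*} (s : Finset K) {ψ : K → J → M → ι → ℂ}
    (hψ : ∀ k, MDifferentiableAt I 𝓘(ℝ, ι → ℂ) (ψ k i) x) :
    S.nabla A a (∑ k ∈ s, ψ k) i x = ∑ k ∈ s, S.nabla A a (ψ k) i x := by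
  classical
  induction s using Finset.induction_on with
  | empty => exact nabla_zero A i a x
  | insert k s hk ih =>
    rw [Finset.sum_insert hk, Finset.sum_insert hk,
      nabla_add A (hψ k) (mdifferentiableAt_sum_apply s hψ), ih]

end SpinCStructure

end Smoothness

/-! ### Smoothness of the connection coefficients. -/

section SmoothConnection

variable {E H M : Type*} [NormedAddCommGroup E] [NormedSpace ℝ E] [CompleteSpace E]
  [TopologicalSpace H]
  {I : ModelWithCorners ℝ E H} [TopologicalSpace M] [ChartedSpace H M] [IsManifold I ∞ M]

namespace SpinCStructure

variable {g : MetricField I M} {κ ι J : Type*} [Fintype κ] [DecidableEq κ]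
    [Fintype ι] [DecidableEq ι] {c : CliffordRep κ ι}

/-- By `leviCivita_frame` it suffices that the bracket of smooth frame fields is smooth and that a
smooth metric evaluated on smooth fields is smooth. -/
lemma contMDiffOn_leviCivita_frame (hg : ContMDiff I (I.prod 𝓘(ℝ, E →L[ℝ] E →L[ℝ] ℝ)) ∞
      (fun x => Bundle.TotalSpace.mk' (E →L[ℝ] E →L[ℝ] ℝ)
        (E := fun x : M => TangentSpace I x →L[ℝ] TangentSpace I x →L[ℝ] ℝ) x (g x)))
    (S : SpinCStructure g c J) (i : J) (a b d : κ) :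
    ContMDiffOn I 𝓘(ℝ, ℝ) ∞
      (fun x => leviCivita g (S.frame i a) (S.frame i b) (S.frame i d) x) (S.U i) := by
  have h : ∀ a b d, ContMDiffOn I 𝓘(ℝ, ℝ) ∞ (fun x =>
      g x (VectorField.mlieBracket I (S.frame i a) (S.frame i b) x) (S.frame i d x)) (S.U i) := by
    intro a b d x hx
    have hU := (S.isOpen_U i).mem_nhds hx
    have hbr : ContMDiffAt I I.tangent ∞ (fun y => (⟨y, VectorField.mlieBracket I (S.frame i a)
        (S.frame i b) y⟩ : TangentBundle I M)) x := by
      -- The bracket costs one derivative, and `∞ + 1 = ∞`.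
      have : IsManifold I ((⊤ : ℕ∞) + 1) M := ‹IsManifold I ∞ M›
      have : IsManifold I (minSmoothness ℝ 2) M := by
        rw [minSmoothness_of_isRCLikeNormedField]
        exact IsManifold.of_le two_le_infty
      exact ((S.frame_smooth i a).contMDiffAt hU).mlieBracket_vectorField (m := ⊤) (n := ⊤)
        ((S.frame_smooth i b).contMDiffAt hU) (by simp)
    have h2 := ContMDiffAt.clm_bundle_apply₂ (F₁ := E) (F₂ := E) (F₃ := ℝ)
      (E₃ := fun _ : M => ℝ) (hg x) hbr ((S.frame_smooth i d).contMDiffAt hU)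
    exact ((Bundle.contMDiffAt_totalSpace.1 h2).2).contMDiffWithinAt
  have h2 : ContMDiffOn I 𝓘(ℝ, ℝ) ∞ (fun x => (1 / 2 : ℝ) *
      (g x (VectorField.mlieBracket I (S.frame i a) (S.frame i b) x) (S.frame i d x)
        - g x (VectorField.mlieBracket I (S.frame i a) (S.frame i d) x) (S.frame i b x)
        - g x (VectorField.mlieBracket I (S.frame i b) (S.frame i d) x) (S.frame i a x)))
      (S.U i) :=
    contMDiffOn_const.mul (((h a b d).sub (h a d b)).sub (h b d a))
  exact h2.congr fun x hx => S.leviCivita_frame hx a b d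

lemma contMDiffOn_connMatrix (hg : ContMDiff I (I.prod 𝓘(ℝ, E →L[ℝ] E →L[ℝ] ℝ)) ∞
      (fun x => Bundle.TotalSpace.mk' (E →L[ℝ] E →L[ℝ] ℝ)
        (E := fun x : M => TangentSpace I x →L[ℝ] TangentSpace I x →L[ℝ] ℝ) x (g x)))
    {S : SpinCStructure g c J} (A : S.Connection) (i : J) (a : κ) (k l : ι) :
    ContMDiffOn I 𝓘(ℝ, ℂ) ∞ (fun x => S.connMatrix A i a x k l) (S.U i) := by
  simp only [connMatrix, Matrix.smul_apply, Matrix.add_apply, Matrix.sum_apply, smul_eq_mul]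
  refine contMDiffOn_mul' contMDiffOn_const (ContMDiffOn.add ?_ ?_)
  · exact contMDiffOn_mul' (contMDiffOn_mul' contMDiffOn_const
      (contMDiffOn_ofReal (A.smooth i a))) contMDiffOn_const
  · refine contMDiffOn_mul' contMDiffOn_const (contMDiffOn_finsetSum fun b _ =>
      contMDiffOn_finsetSum fun d _ => ?_)
    exact contMDiffOn_mul' (contMDiffOn_ofReal (S.contMDiffOn_leviCivita_frame hg i a b d))
      contMDiffOn_const

end SpinCStructure

end SmoothConnection

/-! ### The spin connection of the product. -/

section ProductDirac

variable {E₁ H₁ M₁ E₂ H₂ M₂ : Type*}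
  [NormedAddCommGroup E₁] [NormedSpace ℝ E₁] [FiniteDimensional ℝ E₁] [TopologicalSpace H₁]
  {I₁ : ModelWithCorners ℝ E₁ H₁} [TopologicalSpace M₁] [ChartedSpace H₁ M₁]
  [NormedAddCommGroup E₂] [NormedSpace ℝ E₂] [FiniteDimensional ℝ E₂] [TopologicalSpace H₂]
  {I₂ : ModelWithCorners ℝ E₂ H₂} [TopologicalSpace M₂] [ChartedSpace H₂ M₂]
  [I₁.Boundaryless] [I₂.Boundaryless] [IsManifold I₁ ∞ M₁] [IsManifold I₂ ∞ M₂]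

namespace SpinCStructure

variable {g₁ : MetricField I₁ M₁} {g₂ : MetricField I₂ M₂} {p : ℕ}
  {κ₂ ι₁ ι₂ J₁ J₂ : Type*} [Fintype κ₂] [DecidableEq κ₂] [Fintype ι₁] [DecidableEq ι₁]
  [Fintype ι₂] [DecidableEq ι₂] {c₁ : CliffordRep (Fin (2 * p)) ι₁} {c₂ : CliffordRep κ₂ ι₂}

lemma mdifferentiableAt_frame {E H M : Type*} [NormedAddCommGroup E] [NormedSpace ℝ E]
    [TopologicalSpace H] {I : ModelWithCorners ℝ E H} [TopologicalSpace M] [ChartedSpace H M]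
    [IsManifold I 1 M] {g : MetricField I M} {κ ι J : Type*} [Fintype κ] [DecidableEq κ]
    [Fintype ι] [DecidableEq ι] {c : CliffordRep κ ι} (S : SpinCStructure g c J) {i : J} {x : M}
    (hx : x ∈ S.U i) (a : κ) :
    MDifferentiableAt I I.tangent (fun y => (⟨y, S.frame i a y⟩ : TangentBundle I M)) x :=
  ((S.frame_smooth i a).contMDiffAt ((S.isOpen_U i).mem_nhds hx)).mdifferentiableAt (by simp)

lemma mdifferentiableAt_zero {E H M : Type*} [NormedAddCommGroup E] [NormedSpace ℝ E]
    [TopologicalSpace H] {I : ModelWithCorners ℝ E H} [TopologicalSpace M] [ChartedSpace H M]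
    [IsManifold I 1 M] (x : M) :
    MDifferentiableAt I I.tangent (fun y => (⟨y, (0 : TangentSpace I y)⟩ : TangentBundle I M)) x :=
  ((smooth_zero Set.univ).contMDiffAt Filter.univ_mem).mdifferentiableAt (by simp)

variable (S₁ : SpinCStructure g₁ c₁ J₁) (S₂ : SpinCStructure g₂ c₂ J₂)
  {i : J₁ × J₂} {x : M₁ × M₂}

lemma mlieBracket_inl_inl (hx : x ∈ (S₁.prod S₂).U i) (a b : Fin (2 * p)) :
    VectorField.mlieBracket (I₁.prod I₂) ((S₁.prod S₂).frame i (Sum.inl a))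
        ((S₁.prod S₂).frame i (Sum.inl b)) x
      = tangentPair (VectorField.mlieBracket I₁ (S₁.frame i.1 a) (S₁.frame i.1 b) x.1) 0 := by
  refine (mlieBracket_tangentPair (S₁.mdifferentiableAt_frame hx.1 a)
    (S₁.mdifferentiableAt_frame hx.1 b) (mdifferentiableAt_zero x.2)
    (mdifferentiableAt_zero x.2)).trans ?_
  exact congrArg _ (congrFun VectorField.mlieBracket_zero_left x.2)

lemma mlieBracket_inr_inr (hx : x ∈ (S₁.prod S₂).U i) (a b : κ₂) :
    VectorField.mlieBracket (I₁.prod I₂) ((S₁.prod S₂).frame i (Sum.inr a))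
        ((S₁.prod S₂).frame i (Sum.inr b)) x
      = tangentPair 0 (VectorField.mlieBracket I₂ (S₂.frame i.2 a) (S₂.frame i.2 b) x.2) := by
  refine (mlieBracket_tangentPair (mdifferentiableAt_zero x.1) (mdifferentiableAt_zero x.1)
    (S₂.mdifferentiableAt_frame hx.2 a) (S₂.mdifferentiableAt_frame hx.2 b)).trans ?_
  exact congrArg (fun v => tangentPair v _) (congrFun VectorField.mlieBracket_zero_left x.1)

/-- In each component one of the two fields is zero. -/
lemma mlieBracket_inl_inr (hx : x ∈ (S₁.prod S₂).U i) (a : Fin (2 * p)) (b : κ₂) :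
    VectorField.mlieBracket (I₁.prod I₂) ((S₁.prod S₂).frame i (Sum.inl a))
        ((S₁.prod S₂).frame i (Sum.inr b)) x = 0 := by
  refine (mlieBracket_tangentPair (S₁.mdifferentiableAt_frame hx.1 a)
    (mdifferentiableAt_zero x.1) (mdifferentiableAt_zero x.2)
    (S₂.mdifferentiableAt_frame hx.2 b)).trans ?_
  exact congrArg₂ tangentPair (congrFun VectorField.mlieBracket_zero_right x.1)
    (congrFun VectorField.mlieBracket_zero_left x.2)

lemma mlieBracket_inr_inl (hx : x ∈ (S₁.prod S₂).U i) (a : κ₂) (b : Fin (2 * p)) :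
    VectorField.mlieBracket (I₁.prod I₂) ((S₁.prod S₂).frame i (Sum.inr a))
        ((S₁.prod S₂).frame i (Sum.inl b)) x = 0 := by
  rw [VectorField.mlieBracket_swap_apply, mlieBracket_inl_inr S₁ S₂ hx, neg_zero]

omit [I₁.Boundaryless] [I₂.Boundaryless] in
lemma prodMetric_inl (a : Fin (2 * p)) (v : TangentSpace I₁ x.1) (w : TangentSpace I₂ x.2) :
    prodMetric g₁ g₂ x (tangentPair v w) ((S₁.prod S₂).frame i (Sum.inl a) x)
      = g₁ x.1 v (S₁.frame i.1 a x.1) := by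
  change prodMetric g₁ g₂ x (tangentPair v w) (tangentPair (S₁.frame i.1 a x.1) 0) = _
  rw [prodMetric_pair, map_zero, add_zero]

omit [I₁.Boundaryless] [I₂.Boundaryless] in
lemma prodMetric_inr (a : κ₂) (v : TangentSpace I₁ x.1) (w : TangentSpace I₂ x.2) :
    prodMetric g₁ g₂ x (tangentPair v w) ((S₁.prod S₂).frame i (Sum.inr a) x)
      = g₂ x.2 w (S₂.frame i.2 a x.2) := by
  change prodMetric g₁ g₂ x (tangentPair v w) (tangentPair 0 (S₂.frame i.2 a x.2)) = _
  rw [prodMetric_pair, map_zero, zero_add]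

/-- The Levi-Civita connection of a product has no mixed components. -/
lemma leviCivita_prod_inl (hx : x ∈ (S₁.prod S₂).U i) (t : Fin (2 * p)) (b d : Fin (2 * p) ⊕ κ₂) :
    leviCivita (prodMetric g₁ g₂) ((S₁.prod S₂).frame i (Sum.inl t))
        ((S₁.prod S₂).frame i b) ((S₁.prod S₂).frame i d) x
      = Sum.elim (fun b => Sum.elim (fun d => leviCivita g₁ (S₁.frame i.1 t) (S₁.frame i.1 b)
          (S₁.frame i.1 d) x.1) (fun _ => 0) d) (fun _ => 0) b := by
  rw [leviCivita_frame _ hx]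
  rcases b with b | b <;> rcases d with d | d
  · rw [mlieBracket_inl_inl S₁ S₂ hx, mlieBracket_inl_inl S₁ S₂ hx, mlieBracket_inl_inl S₁ S₂ hx,
      prodMetric_inl, prodMetric_inl, prodMetric_inl]
    exact (S₁.leviCivita_frame hx.1 t b d).symm
  · rw [mlieBracket_inl_inl S₁ S₂ hx, mlieBracket_inl_inr S₁ S₂ hx, mlieBracket_inl_inr S₁ S₂ hx,
      prodMetric_inr]
    simp
  · rw [mlieBracket_inl_inr S₁ S₂ hx, mlieBracket_inl_inl S₁ S₂ hx, mlieBracket_inr_inl S₁ S₂ hx,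
      prodMetric_inr]
    simp
  · rw [mlieBracket_inl_inr S₁ S₂ hx, mlieBracket_inl_inr S₁ S₂ hx, mlieBracket_inr_inr S₁ S₂ hx,
      prodMetric_inl]
    simp

lemma leviCivita_prod_inr (hx : x ∈ (S₁.prod S₂).U i) (t : κ₂) (b d : Fin (2 * p) ⊕ κ₂) :
    leviCivita (prodMetric g₁ g₂) ((S₁.prod S₂).frame i (Sum.inr t))
        ((S₁.prod S₂).frame i b) ((S₁.prod S₂).frame i d) x
      = Sum.elim (fun _ => 0) (fun b => Sum.elim (fun _ => 0) (fun d => leviCivita g₂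
          (S₂.frame i.2 t) (S₂.frame i.2 b) (S₂.frame i.2 d) x.2) d) b := by
  rw [leviCivita_frame _ hx]
  rcases b with b | b <;> rcases d with d | d
  · rw [mlieBracket_inr_inl S₁ S₂ hx, mlieBracket_inr_inl S₁ S₂ hx, mlieBracket_inl_inl S₁ S₂ hx,
      prodMetric_inr]
    simp
  · rw [mlieBracket_inr_inl S₁ S₂ hx, mlieBracket_inr_inr S₁ S₂ hx, mlieBracket_inl_inr S₁ S₂ hx,
      prodMetric_inl]
    simp
  · rw [mlieBracket_inr_inr S₁ S₂ hx, mlieBracket_inr_inl S₁ S₂ hx, mlieBracket_inr_inl S₁ S₂ hx,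
      prodMetric_inl]
    simp
  · rw [mlieBracket_inr_inr S₁ S₂ hx, mlieBracket_inr_inr S₁ S₂ hx, mlieBracket_inr_inr S₁ S₂ hx,
      prodMetric_inr, prodMetric_inr, prodMetric_inr]
    exact (S₂.leviCivita_frame hx.2 t b d).symm

variable {S₁ S₂} (A₁ : S₁.Connection) (A₂ : S₂.Connection)

/-- This records that the coefficient depends on `x.1` only and acts on the first tensor factor
only. -/
lemma connMatrix_prod_inl (hx : x ∈ (S₁.prod S₂).U i) (t : Fin (2 * p)) :
    (S₁.prod S₂).connMatrix (A₁.prod A₂) i (Sum.inl t) x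
      = S₁.connMatrix A₁ i.1 t x.1 ⊗ₖ (1 : Matrix ι₂ ι₂ ℂ) := by
  have hA : (A₁.prod A₂).form i x ((S₁.prod S₂).frame i (Sum.inl t) x)
      = A₁.form i.1 x.1 (S₁.frame i.1 t x.1) := by
    change A₁.form i.1 x.1 (S₁.frame i.1 t x.1) + A₂.form i.2 x.2 0 = _
    rw [map_zero, add_zero]
  have hc : ∀ b d, (c₁.prod c₂).gen (Sum.inl b) * (c₁.prod c₂).gen (Sum.inl d)
      = (c₁.gen b * c₁.gen d) ⊗ₖ (1 : Matrix ι₂ ι₂ ℂ) := by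
    intro b d
    simp only [CliffordRep.prod, Sum.elim_inl]
    rw [← Matrix.mul_kronecker_mul, one_mul]
  unfold connMatrix
  rw [hA]
  simp only [leviCivita_prod_inl S₁ S₂ hx, Fintype.sum_sum_type, Sum.elim_inl, Sum.elim_inr,
    Complex.ofReal_zero, zero_smul, Finset.sum_const_zero, add_zero, hc]
  ext ⟨k, k'⟩ ⟨l, l'⟩
  simp only [Matrix.smul_apply, Matrix.add_apply, Matrix.sum_apply, Matrix.kroneckerMap_apply,
    smul_eq_mul, ← Matrix.one_kronecker_one (m := ι₁) (n := ι₂), Finset.sum_mul, mul_add, add_mul,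
    Finset.mul_sum, mul_assoc]

/-- Each `F_l` involves `i^p μ₁`, but the connection contains only products of two of them, and
`(i^p μ₁)² = 1`; hence nothing is left on the first tensor factor. -/
lemma connMatrix_prod_inr (hx : x ∈ (S₁.prod S₂).U i) (l : κ₂) :
    (S₁.prod S₂).connMatrix (A₁.prod A₂) i (Sum.inr l) x
      = (1 : Matrix ι₁ ι₁ ℂ) ⊗ₖ S₂.connMatrix A₂ i.2 l x.2 := by
  have hA : (A₁.prod A₂).form i x ((S₁.prod S₂).frame i (Sum.inr l) x)
      = A₂.form i.2 x.2 (S₂.frame i.2 l x.2) := by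
    change A₁.form i.1 x.1 0 + A₂.form i.2 x.2 (S₂.frame i.2 l x.2) = _
    rw [map_zero, zero_add]
  have hc : ∀ b d, (c₁.prod c₂).gen (Sum.inr b) * (c₁.prod c₂).gen (Sum.inr d)
      = (1 : Matrix ι₁ ι₁ ℂ) ⊗ₖ (c₂.gen b * c₂.gen d) := by
    intro b d
    simp only [CliffordRep.prod, Sum.elim_inr]
    rw [← Matrix.mul_kronecker_mul, c₁.ivol_sq]
  unfold connMatrix
  rw [hA]
  simp only [leviCivita_prod_inr S₁ S₂ hx, Fintype.sum_sum_type, Sum.elim_inl, Sum.elim_inr,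
    Complex.ofReal_zero, zero_smul, Finset.sum_const_zero, zero_add, hc]
  ext ⟨k, k'⟩ ⟨l, l'⟩
  simp only [Matrix.smul_apply, Matrix.add_apply, Matrix.sum_apply, Matrix.kroneckerMap_apply,
    smul_eq_mul, ← Matrix.one_kronecker_one (m := ι₁) (n := ι₂), mul_add, Finset.mul_sum,
    mul_left_comm]

/-- The zeroth order terms commute with every operator commuting with products of two generators
of the same factor. -/
lemma commute_connMatrix_inl (hx : x ∈ (S₁.prod S₂).U i) (t : Fin (2 * p)) {C : Matrix _ _ ℂ}
    (hC : ∀ b d, C * ((c₁.prod c₂).gen (Sum.inl b) * (c₁.prod c₂).gen (Sum.inl d))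
      = (c₁.prod c₂).gen (Sum.inl b) * (c₁.prod c₂).gen (Sum.inl d) * C) :
    C * (S₁.prod S₂).connMatrix (A₁.prod A₂) i (Sum.inl t) x
      = (S₁.prod S₂).connMatrix (A₁.prod A₂) i (Sum.inl t) x * C := by
  unfold connMatrix
  simp only [leviCivita_prod_inl S₁ S₂ hx, Fintype.sum_sum_type, Sum.elim_inl, Sum.elim_inr,
    Complex.ofReal_zero, zero_smul, Finset.sum_const_zero, add_zero, mul_smul_comm, smul_mul_assoc,
    mul_add, add_mul, mul_one, one_mul, Finset.mul_sum, Finset.sum_mul, hC]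

lemma commute_connMatrix_inr (hx : x ∈ (S₁.prod S₂).U i) (l : κ₂) {C : Matrix _ _ ℂ}
    (hC : ∀ b d, C * ((c₁.prod c₂).gen (Sum.inr b) * (c₁.prod c₂).gen (Sum.inr d))
      = (c₁.prod c₂).gen (Sum.inr b) * (c₁.prod c₂).gen (Sum.inr d) * C) :
    C * (S₁.prod S₂).connMatrix (A₁.prod A₂) i (Sum.inr l) x
      = (S₁.prod S₂).connMatrix (A₁.prod A₂) i (Sum.inr l) x * C := by
  unfold connMatrix
  simp only [leviCivita_prod_inr S₁ S₂ hx, Fintype.sum_sum_type, Sum.elim_inl, Sum.elim_inr,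
    Complex.ofReal_zero, zero_smul, Finset.sum_const_zero, zero_add, mul_smul_comm, smul_mul_assoc,
    mul_add, add_mul, mul_one, one_mul, Finset.mul_sum, Finset.sum_mul, hC]

end SpinCStructure

end ProductDirac

/-! ### Commuting spinor derivatives and the operators `μ_i ∘ D₊`. -/

section AnticommutingDirac

lemma SpinCStructure.contMDiffOn_nabla {E H M : Type*} [NormedAddCommGroup E] [NormedSpace ℝ E]
    [TopologicalSpace H] {I : ModelWithCorners ℝ E H} [TopologicalSpace M] [ChartedSpace H M]
    [IsManifold I 1 M] {g : MetricField I M} {κ ι J : Type*} [Fintype κ] [DecidableEq κ]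
    [Fintype ι] [DecidableEq ι] {c : CliffordRep κ ι} {S : SpinCStructure g c J}
    {A : S.Connection} {i : J} {a : κ}
    (hΓ : ∀ k l, ContMDiffOn I 𝓘(ℝ, ℂ) ∞ (fun x => S.connMatrix A i a x k l) (S.U i))
    {ψ : J → M → ι → ℂ} (hψ : ContMDiffOn I 𝓘(ℝ, ι → ℂ) ∞ (ψ i) (S.U i)) :
    ContMDiffOn I 𝓘(ℝ, ι → ℂ) ∞ (S.nabla A a ψ i) (S.U i) :=
  ((contMDiffOn_dirDeriv (S.isOpen_U i) hψ (S.frame_smooth i a)).add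
    (contMDiffOn_mulVec hΓ hψ)).congr fun x _ => S.nabla_eq A a ψ i x

variable {E₁ H₁ M₁ E₂ H₂ M₂ : Type*}
  [NormedAddCommGroup E₁] [NormedSpace ℝ E₁] [FiniteDimensional ℝ E₁] [TopologicalSpace H₁]
  {I₁ : ModelWithCorners ℝ E₁ H₁} [TopologicalSpace M₁] [ChartedSpace H₁ M₁]
  [NormedAddCommGroup E₂] [NormedSpace ℝ E₂] [FiniteDimensional ℝ E₂] [TopologicalSpace H₂]
  {I₂ : ModelWithCorners ℝ E₂ H₂} [TopologicalSpace M₂] [ChartedSpace H₂ M₂]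
  [I₁.Boundaryless] [I₂.Boundaryless] [IsManifold I₁ ∞ M₁] [IsManifold I₂ ∞ M₂]

namespace SpinCStructure

variable {g₁ : MetricField I₁ M₁} {g₂ : MetricField I₂ M₂} {p : ℕ}
  {κ₂ ι₁ ι₂ J₁ J₂ : Type*} [Fintype κ₂] [DecidableEq κ₂] [Fintype ι₁] [DecidableEq ι₁]
  [Fintype ι₂] [DecidableEq ι₂] {c₁ : CliffordRep (Fin (2 * p)) ι₁} {c₂ : CliffordRep κ₂ ι₂}
  {S₁ : SpinCStructure g₁ c₁ J₁} {S₂ : SpinCStructure g₂ c₂ J₂}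
  {A₁ : S₁.Connection} {A₂ : S₂.Connection} {i : J₁ × J₂} {x : M₁ × M₂}

lemma contMDiffOn_nabla_prod
    (hΓ₁ : ∀ i a k l, ContMDiffOn I₁ 𝓘(ℝ, ℂ) ∞ (fun x => S₁.connMatrix A₁ i a x k l) (S₁.U i))
    (hΓ₂ : ∀ i a k l, ContMDiffOn I₂ 𝓘(ℝ, ℂ) ∞ (fun x => S₂.connMatrix A₂ i a x k l) (S₂.U i))
    {ψ : J₁ × J₂ → M₁ × M₂ → ι₁ × ι₂ → ℂ} {i : J₁ × J₂}
    (hψ : ContMDiffOn (I₁.prod I₂) 𝓘(ℝ, ι₁ × ι₂ → ℂ) ∞ (ψ i) ((S₁.prod S₂).U i))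
    (a : Fin (2 * p) ⊕ κ₂) :
    ContMDiffOn (I₁.prod I₂) 𝓘(ℝ, ι₁ × ι₂ → ℂ) ∞ ((S₁.prod S₂).nabla (A₁.prod A₂) a ψ i)
      ((S₁.prod S₂).U i) := by
  refine contMDiffOn_nabla (fun k l => ?_) hψ
  rcases a with a | a
  · have h := contMDiffOn_mul' ((hΓ₁ i.1 a k.1 l.1).comp (contMDiffOn_fst (I := I₁) (J := I₂)
      (s := (S₁.prod S₂).U i)) fun _ h => h.1)
      (contMDiffOn_const (c := (1 : Matrix ι₂ ι₂ ℂ) k.2 l.2))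
    exact h.congr fun x hx => congrFun (congrFun (connMatrix_prod_inl A₁ A₂ hx a) k) l
  · have h := contMDiffOn_mul' (contMDiffOn_const (c := (1 : Matrix ι₁ ι₁ ℂ) k.1 l.1))
      ((hΓ₂ i.2 a k.2 l.2).comp (contMDiffOn_snd (I := I₁) (J := I₂)
      (s := (S₁.prod S₂).U i)) fun _ h => h.2)
    exact h.congr fun x hx => congrFun (congrFun (connMatrix_prod_inr A₁ A₂ hx a) k) l

/-- The spinor derivatives along the two factors commute. -/
lemma nabla_nabla_comm
    (hΓ₁ : ∀ i a k l, ContMDiffOn I₁ 𝓘(ℝ, ℂ) ∞ (fun x => S₁.connMatrix A₁ i a x k l) (S₁.U i))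
    (hΓ₂ : ∀ i a k l, ContMDiffOn I₂ 𝓘(ℝ, ℂ) ∞ (fun x => S₂.connMatrix A₂ i a x k l) (S₂.U i))
    {ψ : J₁ × J₂ → M₁ × M₂ → ι₁ × ι₂ → ℂ}
    (hψ : ContMDiffOn (I₁.prod I₂) 𝓘(ℝ, ι₁ × ι₂ → ℂ) ∞ (ψ i) ((S₁.prod S₂).U i))
    (hx : x ∈ (S₁.prod S₂).U i) (t : Fin (2 * p)) (l : κ₂) :
    (S₁.prod S₂).nabla (A₁.prod A₂) (Sum.inr l)
        ((S₁.prod S₂).nabla (A₁.prod A₂) (Sum.inl t) ψ) i x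
      = (S₁.prod S₂).nabla (A₁.prod A₂) (Sum.inl t)
        ((S₁.prod S₂).nabla (A₁.prod A₂) (Sum.inr l) ψ) i x := by
  have hU := ((S₁.prod S₂).isOpen_U i).mem_nhds hx
  have md : ∀ {φ : M₁ × M₂ → ι₁ × ι₂ → ℂ},
      ContMDiffOn (I₁.prod I₂) 𝓘(ℝ, ι₁ × ι₂ → ℂ) ∞ φ ((S₁.prod S₂).U i) →
      MDifferentiableAt (I₁.prod I₂) 𝓘(ℝ, ι₁ × ι₂ → ℂ) φ x :=
    fun h => (h.contMDiffAt hU).mdifferentiableAt (by simp)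
  have hd := fun a => contMDiffOn_dirDeriv ((S₁.prod S₂).isOpen_U i) hψ
    ((S₁.prod S₂).frame_smooth i a)
  have hn := contMDiffOn_nabla_prod hΓ₁ hΓ₂ hψ
  -- The zeroth order term is smooth as the difference of the spinor derivative and the plain
  -- derivative.
  have hz : ∀ a, ContMDiffOn (I₁.prod I₂) 𝓘(ℝ, ι₁ × ι₂ → ℂ) ∞
      (fun y => (S₁.prod S₂).connMatrix (A₁.prod A₂) i a y *ᵥ ψ i y) ((S₁.prod S₂).U i) :=
    fun a => ((hn a).sub (hd a)).congr fun y _ => by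
      change _ = (S₁.prod S₂).nabla (A₁.prod A₂) a ψ i y - dirDeriv (ψ i) y _
      rw [nabla_eq, add_sub_cancel_left]
  have split : ∀ a (v : TangentSpace (I₁.prod I₂) x), dirDeriv ((S₁.prod S₂).nabla (A₁.prod A₂) a ψ i) x v
      = dirDeriv (fun y => dirDeriv (ψ i) y ((S₁.prod S₂).frame i a y)) x v
        + dirDeriv (fun y => (S₁.prod S₂).connMatrix (A₁.prod A₂) i a y *ᵥ ψ i y) x v := by
    intro a v
    rw [← dirDeriv_add (md (hd a)) (md (hz a))]
    exact congrArg (fun f => dirDeriv f x v) (funext fun y => nabla_eq _ _ _ _ _ _)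
  have c1 : ContinuousAt (fun y : M₁ => (y, x.2)) x.1 := by fun_prop
  have c2 : ContinuousAt (fun y : M₂ => (x.1, y)) x.2 := by fun_prop
  -- Along the second factor the matrix of `∇_{E_t}` is constant, so it comes out of the derivative;
  -- `dr` is the same with the factors exchanged.
  have dl : dirDeriv (fun y => (S₁.prod S₂).connMatrix (A₁.prod A₂) i (Sum.inl t) y *ᵥ ψ i y) x
        ((S₁.prod S₂).frame i (Sum.inr l) x)
      = (S₁.prod S₂).connMatrix (A₁.prod A₂) i (Sum.inl t) x *ᵥ
        dirDeriv (ψ i) x ((S₁.prod S₂).frame i (Sum.inr l) x) := by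
    have e1 := dirDeriv_tangentPair_snd (md (hz (Sum.inl t))) (S₂.frame i.2 l x.2)
    have e2 := dirDeriv_tangentPair_snd (md hψ) (S₂.frame i.2 l x.2)
    have e3 : (fun y => (S₁.prod S₂).connMatrix (A₁.prod A₂) i (Sum.inl t) (x.1, y)
        *ᵥ ψ i (x.1, y)) =ᶠ[nhds x.2] fun y => mulVecCLM
          ((S₁.prod S₂).connMatrix (A₁.prod A₂) i (Sum.inl t) x) (ψ i (x.1, y)) := by
      filter_upwards [c2.eventually hU] with y hy
      rw [connMatrix_prod_inl A₁ A₂ hy, connMatrix_prod_inl A₁ A₂ hx]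
      rfl
    have e4 : MDifferentiableAt I₂ 𝓘(ℝ, ι₁ × ι₂ → ℂ) (fun y => ψ i (x.1, y)) x.2 :=
      (md hψ).comp x.2 (mdifferentiableAt_const.prodMk mdifferentiableAt_id)
    exact e1.trans ((dirDeriv_congr_of_eventuallyEq e3 _).trans
      ((dirDeriv_clm_comp _ e4 _).trans (congrArg _ e2.symm)))
  have dr : dirDeriv (fun y => (S₁.prod S₂).connMatrix (A₁.prod A₂) i (Sum.inr l) y *ᵥ ψ i y) x
        ((S₁.prod S₂).frame i (Sum.inl t) x)
      = (S₁.prod S₂).connMatrix (A₁.prod A₂) i (Sum.inr l) x *ᵥ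
        dirDeriv (ψ i) x ((S₁.prod S₂).frame i (Sum.inl t) x) := by
    have e1 := dirDeriv_tangentPair_fst (md (hz (Sum.inr l))) (S₁.frame i.1 t x.1)
    have e2 := dirDeriv_tangentPair_fst (md hψ) (S₁.frame i.1 t x.1)
    have e3 : (fun y => (S₁.prod S₂).connMatrix (A₁.prod A₂) i (Sum.inr l) (y, x.2)
        *ᵥ ψ i (y, x.2)) =ᶠ[nhds x.1] fun y => mulVecCLM
          ((S₁.prod S₂).connMatrix (A₁.prod A₂) i (Sum.inr l) x) (ψ i (y, x.2)) := by
      filter_upwards [c1.eventually hU] with y hy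
      rw [connMatrix_prod_inr A₁ A₂ hy, connMatrix_prod_inr A₁ A₂ hx]
      rfl
    have e4 : MDifferentiableAt I₁ 𝓘(ℝ, ι₁ × ι₂ → ℂ) (fun y => ψ i (y, x.2)) x.1 :=
      (md hψ).comp x.1 (mdifferentiableAt_id.prodMk mdifferentiableAt_const)
    exact e1.trans ((dirDeriv_congr_of_eventuallyEq e3 _).trans
      ((dirDeriv_clm_comp _ e4 _).trans (congrArg _ e2.symm)))
  have dd : dirDeriv (fun y => dirDeriv (ψ i) y ((S₁.prod S₂).frame i (Sum.inl t) y)) x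
        ((S₁.prod S₂).frame i (Sum.inr l) x)
      = dirDeriv (fun y => dirDeriv (ψ i) y ((S₁.prod S₂).frame i (Sum.inr l) y)) x
        ((S₁.prod S₂).frame i (Sum.inl t) x) :=
    dirDeriv_dirDeriv_comm (hψ.contMDiffAt hU) (S₁.frame i.1 t) (S₂.frame i.2 l)
      (md (hd (Sum.inl t))) (md (hd (Sum.inr l)))
  -- `Γ₁ ⊗ 1` and `1 ⊗ Γ₂` commute.
  have hcomm : (S₁.prod S₂).connMatrix (A₁.prod A₂) i (Sum.inr l) x
        * (S₁.prod S₂).connMatrix (A₁.prod A₂) i (Sum.inl t) x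
      = (S₁.prod S₂).connMatrix (A₁.prod A₂) i (Sum.inl t) x
        * (S₁.prod S₂).connMatrix (A₁.prod A₂) i (Sum.inr l) x := by
    rw [connMatrix_prod_inl A₁ A₂ hx, connMatrix_prod_inr A₁ A₂ hx, ← Matrix.mul_kronecker_mul,
      ← Matrix.mul_kronecker_mul]
    simp only [one_mul, mul_one]
  rw [nabla_eq _ _ _ ((S₁.prod S₂).nabla _ _ _), nabla_eq _ _ _ ((S₁.prod S₂).nabla _ _ _),
    split, split, dl, dr, dd, nabla_eq, nabla_eq, Matrix.mulVec_add, Matrix.mulVec_add,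
    Matrix.mulVec_mulVec, Matrix.mulVec_mulVec, hcomm]
  abel

/-- A parallel operator anticommuting with Clifford multiplication along the first factor and
commuting with that along the second anticommutes, after composition with `D₊`, with the Dirac
operator of the product. -/
theorem dirac_act_diracPlus
    (hΓ₁ : ∀ i a k l, ContMDiffOn I₁ 𝓘(ℝ, ℂ) ∞ (fun x => S₁.connMatrix A₁ i a x k l) (S₁.U i))
    (hΓ₂ : ∀ i a k l, ContMDiffOn I₂ 𝓘(ℝ, ℂ) ∞ (fun x => S₂.connMatrix A₂ i a x k l) (S₂.U i))
    {μ : Matrix (ι₁ × ι₂) (ι₁ × ι₂) ℂ}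
    (hl : ∀ t, (c₁.prod c₂).gen (Sum.inl t) * μ = -(μ * (c₁.prod c₂).gen (Sum.inl t)))
    (hr : ∀ l, (c₁.prod c₂).gen (Sum.inr l) * μ = μ * (c₁.prod c₂).gen (Sum.inr l))
    {ψ : J₁ × J₂ → M₁ × M₂ → ι₁ × ι₂ → ℂ} (hψ : (S₁.prod S₂).IsSection ψ) :
    (S₁.prod S₂).Same ((S₁.prod S₂).dirac (A₁.prod A₂) (act μ.mulVec (diracPlus A₁ A₂ ψ)))
      (-act μ.mulVec (diracPlus A₁ A₂ ((S₁.prod S₂).dirac (A₁.prod A₂) ψ))) := by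
  intro i x hx
  set S := S₁.prod S₂
  set A : S.Connection := A₁.prod A₂
  have hU := (S.isOpen_U i).mem_nhds hx
  have hs := hψ.1 i
  have hn := contMDiffOn_nabla_prod hΓ₁ hΓ₂ hs
  have md : ∀ {φ : M₁ × M₂ → ι₁ × ι₂ → ℂ},
      ContMDiffOn (I₁.prod I₂) 𝓘(ℝ, ι₁ × ι₂ → ℂ) ∞ φ (S.U i) →
      MDifferentiableAt (I₁.prod I₂) 𝓘(ℝ, ι₁ × ι₂ → ℂ) φ x :=
    fun h => (h.contMDiffAt hU).mdifferentiableAt (by simp)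
  have mg : ∀ a, MDifferentiableAt (I₁.prod I₂) 𝓘(ℝ, ι₁ × ι₂ → ℂ)
      (act ((c₁.prod c₂).gen a).mulVec (S.nabla A a ψ) i) x :=
    fun a => mdifferentiableAt_clm_comp (mulVecCLM ((c₁.prod c₂).gen a)) (md (hn a))
  have ePlus : diracPlus A₁ A₂ ψ
      = ∑ t, act ((c₁.prod c₂).gen (Sum.inl t)).mulVec (S.nabla A (Sum.inl t) ψ) := by
    funext j y
    simp only [Finset.sum_apply]
    rfl
  set P := diracPlus A₁ A₂ ψ
  -- `N` is `D₋ ψ`, the part of the Dirac operator along the second factor.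
  set N : J₁ × J₂ → M₁ × M₂ → ι₁ × ι₂ → ℂ :=
    ∑ l, act ((c₁.prod c₂).gen (Sum.inr l)).mulVec (S.nabla A (Sum.inr l) ψ) with hN
  have eD : S.dirac A ψ = P + N := by
    funext j y
    rw [ePlus]
    simp only [dirac, Fintype.sum_sum_type, Pi.add_apply, hN, Finset.sum_apply]
    rfl
  have mP : MDifferentiableAt (I₁.prod I₂) 𝓘(ℝ, ι₁ × ι₂ → ℂ) (P i) x := by
    rw [ePlus]
    exact mdifferentiableAt_sum_apply _ fun t => mg (Sum.inl t)
  have mN : MDifferentiableAt (I₁.prod I₂) 𝓘(ℝ, ι₁ × ι₂ → ℂ) (N i) x :=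
    mdifferentiableAt_sum_apply _ fun l => mg (Sum.inr l)
  have hlr : ∀ t l, (c₁.prod c₂).gen (Sum.inr l) * (c₁.prod c₂).gen (Sum.inl t)
      = -((c₁.prod c₂).gen (Sum.inl t) * (c₁.prod c₂).gen (Sum.inr l)) :=
    fun t l => (c₁.prod c₂).gen_anti Sum.inr_ne_inl
  -- `μ` is parallel: it has the same sign against all generators of one factor, so it commutes with
  -- the product of two of them.
  have nμ : ∀ a, S.nabla A a (act μ.mulVec P) i x = μ *ᵥ S.nabla A a P i x := by
    rintro (t | l)
    · refine nabla_mulVec A (commute_connMatrix_inl A₁ A₂ hx t fun b d => ?_) mP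
      have h1 := hl b
      have h2 := hl d
      rw [← mul_assoc, ← neg_eq_iff_eq_neg.2 h1, neg_mul, mul_assoc, ← neg_eq_iff_eq_neg.2 h2, mul_neg,
        neg_neg, mul_assoc]
    · refine nabla_mulVec A (commute_connMatrix_inr A₁ A₂ hx l fun b d => ?_) mP
      rw [← mul_assoc, ← hr, mul_assoc, ← hr, mul_assoc]
  -- The `E_t` are parallel along the second factor: they anticommute with every `F_b`, hence
  -- commute with `F_b F_d`.
  have nP : ∀ l, S.nabla A (Sum.inr l) P i x
      = ∑ t, (c₁.prod c₂).gen (Sum.inl t) *ᵥ S.nabla A (Sum.inr l) (S.nabla A (Sum.inl t) ψ) i x := by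
    intro l
    rw [ePlus, nabla_sum A _ fun t => mg (Sum.inl t)]
    refine Finset.sum_congr rfl fun t _ =>
      nabla_mulVec A (commute_connMatrix_inr A₁ A₂ hx l fun b d => ?_) (md (hn _))
    have h1 := hlr t b
    have h2 := hlr t d
    rw [← mul_assoc, ← neg_eq_iff_eq_neg.2 h1, neg_mul, mul_assoc, ← neg_eq_iff_eq_neg.2 h2, mul_neg,
      neg_neg, mul_assoc]
  have nN : ∀ t, S.nabla A (Sum.inl t) N i x
      = ∑ l, (c₁.prod c₂).gen (Sum.inr l) *ᵥ S.nabla A (Sum.inr l) (S.nabla A (Sum.inl t) ψ) i x := by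
    intro t
    rw [hN, nabla_sum A _ fun l => mg (Sum.inr l)]
    refine Finset.sum_congr rfl fun l _ => ?_
    -- The second derivatives are put in the same order as in `nP`, so that the two sums can be
    -- compared.
    rw [nabla_nabla_comm hΓ₁ hΓ₂ hs hx]
    refine nabla_mulVec A (commute_connMatrix_inl A₁ A₂ hx t fun b d => ?_) (md (hn _))
    rw [← mul_assoc, hlr, neg_mul, mul_assoc, hlr, mul_neg, neg_neg, mul_assoc]
  -- This is `D₋ D₊ ψ = -D₊ D₋ ψ`; with equal second derivatives only the sign of `F_l E_t = -E_t
  -- F_l` remains.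
  have cross : ∑ l, (c₁.prod c₂).gen (Sum.inr l) *ᵥ S.nabla A (Sum.inr l) P i x
      = -∑ t, (c₁.prod c₂).gen (Sum.inl t) *ᵥ S.nabla A (Sum.inl t) N i x := by
    simp only [nP, nN, Matrix.mulVec_sum, Matrix.mulVec_mulVec, hlr, Matrix.neg_mulVec,
      Finset.sum_neg_distrib]
    rw [Finset.sum_comm]
  have lhs : S.dirac A (act μ.mulVec P) i x
      = -(μ *ᵥ ∑ t, (c₁.prod c₂).gen (Sum.inl t) *ᵥ S.nabla A (Sum.inl t) P i x)
        + μ *ᵥ ∑ l, (c₁.prod c₂).gen (Sum.inr l) *ᵥ S.nabla A (Sum.inr l) P i x := by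
    simp only [dirac, Fintype.sum_sum_type, nμ, Matrix.mulVec_mulVec, Matrix.mulVec_sum]
    congr 1
    · rw [← Finset.sum_neg_distrib]
      exact Finset.sum_congr rfl fun t _ => by
        rw [← Matrix.neg_mulVec]; exact congrArg (· *ᵥ _) (hl t)
    · exact Finset.sum_congr rfl fun l _ => congrArg (· *ᵥ _) (hr l)
  have rhs : diracPlus A₁ A₂ (S.dirac A ψ) i x
      = ∑ t, (c₁.prod c₂).gen (Sum.inl t) *ᵥ S.nabla A (Sum.inl t) P i x
        + ∑ t, (c₁.prod c₂).gen (Sum.inl t) *ᵥ S.nabla A (Sum.inl t) N i x := by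
    rw [eD, ← Finset.sum_add_distrib]
    refine Finset.sum_congr rfl fun t _ => ?_
    rw [← Matrix.mulVec_add]
    exact congrArg _ (nabla_add A mP mN)
  rw [lhs, cross]
  change _ = -(μ *ᵥ diracPlus A₁ A₂ (S.dirac A ψ) i x)
  rw [rhs, Matrix.mulVec_add, Matrix.mulVec_neg, neg_add]

end SpinCStructure

end AnticommutingDirac

/-! ### Combining the signs of the volume forms and the antilinear maps. -/

section Signs

variable {p q : ℕ} {σ : ℤˣ}

/-- Both volume forms anticommute with the `E_t` and commute with the `F_l`. -/
lemma gen_mul_mu {μ : Matrix ((Fin p → ℤˣ) × (Fin q → ℤˣ)) ((Fin p → ℤˣ) × (Fin q → ℤˣ)) ℂ}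
    (hμ : μ ∈ ({muOne (stdEven p) (stdOdd q σ), muTwo (stdEven p) (stdOdd q σ)} :
      Set (Matrix _ _ ℂ))) :
    (∀ t, ((stdEven p).prod (stdOdd q σ)).gen (Sum.inl t) * μ
      = -(μ * ((stdEven p).prod (stdOdd q σ)).gen (Sum.inl t))) ∧
    (∀ l, ((stdEven p).prod (stdOdd q σ)).gen (Sum.inr l) * μ
      = μ * ((stdEven p).prod (stdOdd q σ)).gen (Sum.inr l)) := by
  rcases hμ with rfl | rfl
  · exact ⟨gen_inl_mul_muOne, gen_inr_mul_muOne⟩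
  · exact ⟨gen_inl_mul_muTwo (odd_two_mul_add_one q), gen_inr_mul_muTwo (odd_two_mul_add_one q)⟩

/-- Multiplication by `μ` reverses the sign for the `E_t` and keeps it for the `F_l`. For the
composition to anticommute with everything, `J₁ ⊗ J₂` must therefore commute with the `E_t` and
anticommute with the `F_l`. -/
lemma mu_mul_antilinear {ι₁ ι₂ κ₂ : Type*} [DecidableEq κ₂] [Fintype ι₁] [DecidableEq ι₁]
    [Fintype ι₂] [DecidableEq ι₂] {c₁ : CliffordRep (Fin (2 * p)) ι₁} {c₂ : CliffordRep κ₂ ι₂}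
    {μ : Matrix (ι₁ × ι₂) (ι₁ × ι₂) ℂ} {J₁ : Matrix ι₁ ι₁ ℂ} {J₂ : Matrix ι₂ ι₂ ℂ} {s : ℂ}
    (hl : ∀ t, (c₁.prod c₂).gen (Sum.inl t) * μ = -(μ * (c₁.prod c₂).gen (Sum.inl t)))
    (hr : ∀ l, (c₁.prod c₂).gen (Sum.inr l) * μ = μ * (c₁.prod c₂).gen (Sum.inr l))
    (h₁ : ∀ t, J₁ * (c₁.gen t).map star = c₁.gen t * J₁)
    (h₂ : ∀ l, J₂ * (c₂.gen l).map star = s • (c₂.gen l * J₂)) (hs : (-1) ^ p * s = -1) (a) :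
    (μ * (J₁ ⊗ₖ J₂)) * ((c₁.prod c₂).gen a).map star
      = -((c₁.prod c₂).gen a * (μ * (J₁ ⊗ₖ J₂))) := by
  have h₁' : ∀ t, J₁ * (c₁.gen t).map star = (1 : ℂ) • (c₁.gen t * J₁) :=
    fun t => by rw [one_smul, h₁]
  rcases a with t | l
  · rw [mul_assoc, kronecker_antilinear_inl h₁', one_smul, ← mul_assoc, ← mul_assoc, hl, neg_mul,
      neg_neg]
  · rw [mul_assoc, kronecker_antilinear_inr h₁' (one_pow 2) h₂, hs, neg_one_smul, mul_neg,
      ← mul_assoc, ← mul_assoc, hr]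

end Signs

end SpinCProduct

end

/-! ### The proposition: checking parities. -/

open SpinCProduct

theorem proposition3p3 {p q : ℕ} (hp : 1 ≤ p) (σ : ℤˣ)
    {M₁ M₂ : Type*}
    [TopologicalSpace M₁] [T2Space M₁] [CompactSpace M₁]
    [ChartedSpace (EuclideanSpace ℝ (Fin (2 * p))) M₁] [IsManifold (𝓡 (2 * p)) ∞ M₁]
    [TopologicalSpace M₂] [T2Space M₂] [CompactSpace M₂]
    [ChartedSpace (EuclideanSpace ℝ (Fin (2 * q + 1))) M₂] [IsManifold (𝓡 (2 * q + 1)) ∞ M₂]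
    (g₁ : Bundle.ContMDiffRiemannianMetric (𝓡 (2 * p)) ∞ (EuclideanSpace ℝ (Fin (2 * p)))
      (fun x : M₁ => TangentSpace (𝓡 (2 * p)) x))
    (g₂ : Bundle.ContMDiffRiemannianMetric (𝓡 (2 * q + 1)) ∞ (EuclideanSpace ℝ (Fin (2 * q + 1)))
      (fun x : M₂ => TangentSpace (𝓡 (2 * q + 1)) x))
    {J₁ J₂ : Type*}
    (S₁ : SpinCStructure g₁.inner (stdEven p) J₁) (S₂ : SpinCStructure g₂.inner (stdOdd q σ) J₂)
    (A₁ : S₁.Connection) (A₂ : S₂.Connection) :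
    (∀ μ ∈ ({muOne (stdEven p) (stdOdd q σ), muTwo (stdEven p) (stdOdd q σ)} : Set (Matrix _ _ ℂ)),
      (∀ ψ, (S₁.prod S₂).IsSection ψ →
        (S₁.prod S₂).Same ((S₁.prod S₂).dirac (A₁.prod A₂)
          (act μ.mulVec (SpinCStructure.diracPlus A₁ A₂ ψ)))
          (-act μ.mulVec (SpinCStructure.diracPlus A₁ A₂ ((S₁.prod S₂).dirac (A₁.prod A₂) ψ)))) ∧
      (1 ≤ q → (Even p ∧ Even q ∨ Odd p ∧ Odd q) → ∀ ψ, (S₁.prod S₂).IsSection ψ →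
        (S₁.prod S₂).conj.IsSection (act μ.mulVec (act (jStar p q) ψ)) ∧
        (S₁.prod S₂).conj.Same ((S₁.prod S₂).conj.dirac (A₁.prod A₂).neg
            (act μ.mulVec (act (jStar p q) ψ)))
          (-act μ.mulVec (act (jStar p q) ((S₁.prod S₂).dirac (A₁.prod A₂) ψ)))) ∧
      (1 ≤ q → Odd p → Odd q → ∀ ψ, (S₁.prod S₂).IsSection ψ →
        ((S₁.prod S₂).conj.IsSection (act μ.mulVec (act (jHatStar p q) ψ)) ∧
          (S₁.prod S₂).conj.Same ((S₁.prod S₂).conj.dirac (A₁.prod A₂).neg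
            (act μ.mulVec (act (jHatStar p q) ψ)))
          (-act μ.mulVec (act (jHatStar p q) ((S₁.prod S₂).dirac (A₁.prod A₂) ψ)))) ∧
        ((S₁.prod S₂).conj.IsSection (act μ.mulVec (act (jZeroStar p q) ψ)) ∧
          (S₁.prod S₂).conj.Same ((S₁.prod S₂).conj.dirac (A₁.prod A₂).neg
            (act μ.mulVec (act (jZeroStar p q) ψ)))
          (-act μ.mulVec (act (jZeroStar p q) ((S₁.prod S₂).dirac (A₁.prod A₂) ψ)))))) ∧
    (1 ≤ q → Even p → Even q → ∀ ψ, (S₁.prod S₂).IsSection ψ →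
      (S₁.prod S₂).conj.IsSection (act (jOneStar p q) ψ) ∧
      (S₁.prod S₂).conj.Same ((S₁.prod S₂).conj.dirac (A₁.prod A₂).neg
            (act (jOneStar p q) ψ))
          (-act (jOneStar p q) ((S₁.prod S₂).dirac (A₁.prod A₂) ψ))) := by
  refine ⟨fun μ hμ => ?_, fun _ hp' hq' ψ hψ => ?_⟩
  · obtain ⟨hl, hr⟩ := gen_mul_mu hμ
    have jZero_even : ∀ t, jZero p * ((stdEven p).gen t).map star = (stdEven p).gen t * jZero p :=
      jZero_stdGen p
    refine ⟨fun ψ hψ => ?_, fun _ hpq ψ hψ => ?_, fun _ hp' hq' ψ hψ => ⟨?_, ?_⟩⟩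
    · exact SpinCStructure.dirac_act_diracPlus (SpinCStructure.contMDiffOn_connMatrix g₁.contMDiff A₁)
        (SpinCStructure.contMDiffOn_connMatrix g₂.contMDiff A₂) hl hr hψ
    -- The sign for the `F_l` is `(-1)^p (-1)^(q+1)`, which is `-1` exactly when `p` and `q` have
    -- equal parity.
    · have hB := mu_mul_antilinear hl hr jZero_even (jOne_stdOdd q σ) (by
        rw [← pow_add]
        refine Odd.neg_one_pow ?_
        rcases hpq with ⟨h, h'⟩ | ⟨h, h'⟩
        · exact h.add_odd h'.add_one
        · exact h.add_even h'.add_one)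
      simp only [jStar, act_mulVec_act_antilinear]
      exact ⟨SpinCStructure.isSection_antilinear hB hψ, SpinCStructure.dirac_antilinear _ hB hψ⟩
    -- For odd `p` the sign `(-1)^(p+1)` of `j₁` is `1`, as for `j₀`; for odd `q` the map `j₀`
    -- commutes with all generators of `Δ_{2q+1}`. The `-1` for the `F_l` is `(-1)^p`.
    · have hB := mu_mul_antilinear (s := 1) (J₂ := jZero q) (J₁ := jOne p) hl hr
        (fun t => (jOne_stdGen p t).trans (by rw [hp'.add_one.neg_one_pow, one_smul]; rfl))
        (fun l => by rw [jZero_stdOdd q σ hq', one_smul]) (by rw [hp'.neg_one_pow, mul_one])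
      simp only [jHatStar, act_mulVec_act_antilinear]
      exact ⟨SpinCStructure.isSection_antilinear hB hψ, SpinCStructure.dirac_antilinear _ hB hψ⟩
    · have hB := mu_mul_antilinear (s := 1) (J₂ := jZero q) hl hr jZero_even
        (fun l => by rw [jZero_stdOdd q σ hq', one_smul]) (by rw [hp'.neg_one_pow, mul_one])
      simp only [jZeroStar, act_mulVec_act_antilinear]
      exact ⟨SpinCStructure.isSection_antilinear hB hψ, SpinCStructure.dirac_antilinear _ hB hψ⟩
  -- For even `p` the map `j₁` already anticommutes with the `E_t`, and for the `F_l` the sign is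
  -- `(-1)^p (-1)^(q+1) = -1`, so no volume form is needed.
  · have h₁ : ∀ t, jOne p * ((stdEven p).gen t).map star
        = (-1 : ℂ) • ((stdEven p).gen t * jOne p) := fun t =>
      (jOne_stdGen p t).trans (by rw [hp'.add_one.neg_one_pow]; rfl)
    have hB : ∀ a, (jOne p ⊗ₖ jOne q) * (((stdEven p).prod (stdOdd q σ)).gen a).map star
        = -(((stdEven p).prod (stdOdd q σ)).gen a * (jOne p ⊗ₖ jOne q)) := by
      rintro (t | l)
      · rw [kronecker_antilinear_inl h₁, neg_one_smul]
      · rw [kronecker_antilinear_inr h₁ (by norm_num) (jOne_stdOdd q σ), hp'.neg_one_pow,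
          hq'.add_one.neg_one_pow, one_mul, neg_one_smul]
    exact ⟨SpinCStructure.isSection_antilinear hB hψ, SpinCStructure.dirac_antilinear _ hB hψ⟩
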